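/- Let $p\ge 3$ be a prime. Let $H=\mathrm{Dist}(SL_2)$ be the algebra of distributions supported at the identity of the algebraic group $SL_2$ over $\mathbb{F}_p$: the $\mathbb{F}_p$-linear functionals on the coordinate ring $\mathbb{F}_p[SL_2]$ that vanish on some power of the augmentation ideal (the ideal of functions vanishing at $1$), with the convolution product dual to the multiplication of $SL_2$. Let $\{e,f,h\}$ be a standard basis of $\mathfrak{sl}_2(\mathbb{F}_p)$, that is, $[e,f]=h\ne 0$, $[h,e]=2e$, $[h,f]=-2f$ (so that $e^2=f^2=0$ as matrices, and $h$ spans the Lie algebra of an $\mathbb{F}_p$-split maximal torus). For $x\in\{e,f\}$ and $r\ge 0$ let $x^{(r)}\in H$ be the $r$-th divided power "$x^r/r!$" of $x$, that is, the functional sending a function $\varphi$ to the coefficient of $t^r$ in $\varphi(\exp(tx))=\varphi(1+tx)$. Then, as a unital associative $\mathbb{F}_p$-algebra, $H$ is presented by the generators $e^{(p^k)}, f^{(p^k)}$ ($k\ge 0$) subject to the following relations, for all $k\ge 0$ and $n>0$, where $X_k:=[e^{(p^k)},f^{(p^k)}]$: 1. $[X_k,e^{(p^k)}]=2e^{(p^k)}$,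 $[X_k,f^{(p^k)}]=-2f^{(p^k)}$; 2. $[X_k,e^{(p^{k+n})}]=0=[X_k,f^{(p^{k+n})}]$; 3. $[e^{(p^k)},e^{(p^{k+n})}]=0=[f^{(p^k)},f^{(p^{k+n})}]$; 4. $[e^{(p^k)},f^{(p^{k+n})}]=(-1)^{n}(f^{(p^k)})^{p-1}(f^{(p^{k+1})})^{p-1}\cdots (f^{(p^{k+n-1})})^{p-1}(X_k+1)$ and $[e^{(p^{k+n})},f^{(p^{k})}]=(-1)^{n}(X_k+1)(e^{(p^k)})^{p-1}(e^{(p^{k+1})})^{p-1}\cdots (e^{(p^{k+n-1})})^{p-1}$; 5. $(e^{(p^k)})^p=0=(f^{(p^k)})^p$; 6. $X_k^p=X_k$. Moreover, for every $k\ge 0$ the subalgebra of $H$ generated by $e^{(p^k)}$ and $f^{(p^k)}$ is a copy of the restricted enveloping algebra of $\mathfrak{sl}_2$: there is an injective homomorphism of unital $\mathbb{F}_p$-algebras from $U(\mathfrak{sl}_2)/(x^p-x^{[p]} : x\in\mathfrak{sl}_2)$, where $x^{[p]}$ is the $p$-th power of the matrix $x$, to $H$ which sends $e\mapsto e^{(p^k)}$,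 $f\mapsto f^{(p^k)}$ and whose image is this subalgebra. -/

import Mathlib

noncomputable section

open scoped TensorProduct Polynomial

namespace SL2Dist

/-! ### The algebra of distributions of an affine group (or monoid) scheme `Spec A` -/

section Distributions

variable (R A : Type*) [CommRing R] [CommRing A] [Bialgebra R A]

/-- The ideal of functions vanishing at the unit element. -/
def augIdeal : Ideal A := RingHom.ker (Bialgebra.counitAlgHom R A)

variable {R A}

theorem comul_mem_of_mem_augIdeal {x : A} (hx : x ∈ augIdeal R A) :
    Bialgebra.comulAlgHom R A x ∈
      (augIdeal R A).map (Algebra.TensorProduct.includeLeft : A →ₐ[R] A ⊗[R] A) ⊔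
      (augIdeal R A).map (Algebra.TensorProduct.includeRight : A →ₐ[R] A ⊗[R] A) := by
  set K := (augIdeal R A).map (Algebra.TensorProduct.includeLeft : A →ₐ[R] A ⊗[R] A) ⊔
      (augIdeal R A).map (Algebra.TensorProduct.includeRight : A →ₐ[R] A ⊗[R] A) with hK
  let ε := Bialgebra.counitAlgHom R A
  let εε : A ⊗[R] A →ₐ[R] R := Algebra.TensorProduct.lift ε ε (fun _ _ => Commute.all _ _)
  have hsub : ∀ a : A, a - algebraMap R A (ε a) ∈ augIdeal R A := by
    intro a
    simp [augIdeal, RingHom.mem_ker, ε]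
  have key : ∀ t : A ⊗[R] A, t - algebraMap R (A ⊗[R] A) (εε t) ∈ K := by
    intro t
    induction t using TensorProduct.induction_on with
    | zero => simp
    | add s t hs ht =>
      have := K.add_mem hs ht
      convert this using 1
      simp only [map_add]; ring
    | tmul a b =>
      have h1 : (a - algebraMap R A (ε a)) ⊗ₜ[R] (1 : A) ∈ K :=
        (le_sup_left : _ ≤ K) (Ideal.mem_map_of_mem
          (Algebra.TensorProduct.includeLeft : A →ₐ[R] A ⊗[R] A) (hsub a))
      have h2 : (1 : A) ⊗ₜ[R] (b - algebraMap R A (ε b)) ∈ K :=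
        (le_sup_right : _ ≤ K) (Ideal.mem_map_of_mem
          (Algebra.TensorProduct.includeRight : A →ₐ[R] A ⊗[R] A) (hsub b))
      have h3 := K.add_mem (K.mul_mem_left ((1 : A) ⊗ₜ[R] b) h1)
        (K.mul_mem_left (algebraMap R (A ⊗[R] A) (ε a)) h2)
      convert h3 using 1
      simp only [εε, Algebra.TensorProduct.lift_tmul, Algebra.TensorProduct.tmul_mul_tmul,
        Algebra.TensorProduct.algebraMap_apply, TensorProduct.tmul_sub, TensorProduct.sub_tmul,
        one_mul, mul_one, mul_sub, map_mul]
      have : algebraMap R A (ε a) ⊗ₜ[R] algebraMap R A (ε b)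
          = (algebraMap R A (ε a) * algebraMap R A (ε b)) ⊗ₜ[R] (1 : A) := by
        rw [Algebra.algebraMap_eq_smul_one (ε b), TensorProduct.tmul_smul,
          TensorProduct.smul_tmul', mul_smul_comm, mul_one]
      rw [this]
      abel
  have hεε : εε (Bialgebra.comulAlgHom R A x) = 0 := by
    have h : εε.comp (Bialgebra.comulAlgHom R A) = ε := by
      have h1 : εε = (ε.comp ((Algebra.TensorProduct.lid R A).toAlgHom)).comp
          (Algebra.TensorProduct.map ε (AlgHom.id R A)) := by
        ext <;> simp [εε, ε]
      ext a
      rw [h1]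
      have := Coalgebra.rTensor_counit_comul (R := R) a
      have h2 : Algebra.TensorProduct.map ε (AlgHom.id R A) (Bialgebra.comulAlgHom R A a)
          = (1 : R) ⊗ₜ[R] a := this
      rw [AlgHom.comp_apply, AlgHom.comp_apply, h2]
      simp
    rw [← AlgHom.comp_apply, h]
    exact hx
  have := key (Bialgebra.comulAlgHom R A x)
  rwa [hεε, map_zero, sub_zero] at this

theorem comul_mem_pow {x : A} {N : ℕ} (hx : x ∈ augIdeal R A ^ N) :
    Bialgebra.comulAlgHom R A x ∈
      ((augIdeal R A).map (Algebra.TensorProduct.includeLeft : A →ₐ[R] A ⊗[R] A) ⊔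
      (augIdeal R A).map (Algebra.TensorProduct.includeRight : A →ₐ[R] A ⊗[R] A)) ^ N := by
  have h : (augIdeal R A).map (Bialgebra.comulAlgHom R A) ≤
      (augIdeal R A).map (Algebra.TensorProduct.includeLeft : A →ₐ[R] A ⊗[R] A) ⊔
      (augIdeal R A).map (Algebra.TensorProduct.includeRight : A →ₐ[R] A ⊗[R] A) :=
    Ideal.map_le_iff_le_comap.2 fun _ hy => comul_mem_of_mem_augIdeal hy
  have h2 := Ideal.pow_right_mono h N
  rw [← Ideal.map_pow] at h2
  exact h2 (Ideal.mem_map_of_mem _ hx)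

variable (R A)

/-- The algebra of distributions supported at the unit element: the `R`-linear functionals on the
coordinate ring `A` that kill some power of the augmentation ideal, with the convolution product
`(μ * ν) φ = (μ ⊗ ν) (Δ φ)` (the type synonym `WithConv` carries this product; the unit is the
counit of `A`). -/
def distAlg : Subalgebra R (WithConv (A →ₗ[R] R)) where
  carrier := {μ | ∃ n : ℕ, ∀ x ∈ augIdeal R A ^ n, μ x = 0}
  mul_mem' := by
    rintro μ ν ⟨m, hm⟩ ⟨n, hn⟩
    refine ⟨m + n, fun x hx => ?_⟩
    have h1 := Ideal.sup_pow_add_le_pow_sup_pow (comul_mem_pow hx)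
    rw [← Ideal.map_pow, ← Ideal.map_pow] at h1
    rw [LinearMap.convMul_apply]
    change LinearMap.mul' R R (TensorProduct.map μ.ofConv ν.ofConv
      (Bialgebra.comulAlgHom R A x)) = 0
    set F : A ⊗[R] A →ₗ[R] R :=
      LinearMap.mul' R R ∘ₗ TensorProduct.map μ.ofConv ν.ofConv with hF
    change F _ = 0
    obtain ⟨y, hy, z, hz, hyz⟩ := Submodule.mem_sup.1 h1
    rw [← hyz, map_add]
    have hy0 : ∀ t, F (t * y) = 0 := by
      refine Submodule.span_induction (p := fun y _ => ∀ t, F (t * y) = 0) ?_ (by simp)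
        (fun a b _ _ ha hb t => by rw [mul_add, map_add, ha, hb, add_zero])
        (fun a b _ hb t => by rw [smul_eq_mul, ← mul_assoc, hb]) hy
      rintro _ ⟨i, hi, rfl⟩ t
      induction t using TensorProduct.induction_on with
      | zero => simp
      | add s t hs ht => rw [add_mul, map_add, hs, ht, add_zero]
      | tmul a b =>
        have := hm _ (Ideal.mul_mem_left _ a hi)
        simp [hF, this]
    have hz0 : ∀ t, F (t * z) = 0 := by
      refine Submodule.span_induction (p := fun y _ => ∀ t, F (t * y) = 0) ?_ (by simp)
        (fun a b _ _ ha hb t => by rw [mul_add, map_add, ha, hb, add_zero])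
        (fun a b _ hb t => by rw [smul_eq_mul, ← mul_assoc, hb]) hz
      rintro _ ⟨i, hi, rfl⟩ t
      induction t using TensorProduct.induction_on with
      | zero => simp
      | add s t hs ht => rw [add_mul, map_add, hs, ht, add_zero]
      | tmul a b =>
        have := hn _ (Ideal.mul_mem_left _ b hi)
        simp [hF, this]
    rw [← one_mul y, ← one_mul z, hy0, hz0, add_zero]
  add_mem' := by
    rintro μ ν ⟨m, hm⟩ ⟨n, hn⟩
    refine ⟨m + n, fun x hx => ?_⟩
    have h1 := hm x (Ideal.pow_le_pow_right (Nat.le_add_right m n) hx)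
    have h2 := hn x (Ideal.pow_le_pow_right (Nat.le_add_left n m) hx)
    change μ.ofConv x + ν.ofConv x = 0
    rw [h1, h2, add_zero]
  algebraMap_mem' r := by
    refine ⟨1, fun x hx => ?_⟩
    rw [pow_one] at hx
    have hx' : Coalgebra.counit (R := R) x = 0 := hx
    simp [hx']

end Distributions

/-! ### The coordinate bialgebra of `SL₂` -/

section CoordinateRing

variable (R : Type*) [CommRing R]

/-- The coordinate ring `R[x₀₀, x₀₁, x₁₀, x₁₁] / (det - 1)` of `SL₂` over `R`. -/
def CoordRing : Type _ :=
  MvPolynomial (Fin 2 × Fin 2) R ⧸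
    Ideal.span {(Matrix.mvPolynomialX (Fin 2) (Fin 2) R).det - 1}

instance : CommRing (CoordRing R) :=
  inferInstanceAs (CommRing (MvPolynomial (Fin 2 × Fin 2) R ⧸
    Ideal.span {(Matrix.mvPolynomialX (Fin 2) (Fin 2) R).det - 1}))

instance : Algebra R (CoordRing R) :=
  inferInstanceAs (Algebra R (MvPolynomial (Fin 2 × Fin 2) R ⧸
    Ideal.span {(Matrix.mvPolynomialX (Fin 2) (Fin 2) R).det - 1}))

namespace CoordRing

/-- The quotient map. -/
def mk : MvPolynomial (Fin 2 × Fin 2) R →ₐ[R] CoordRing R :=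
  Ideal.Quotient.mkₐ R (Ideal.span {(Matrix.mvPolynomialX (Fin 2) (Fin 2) R).det - 1})

/-- The universal matrix of determinant one: its entries are the coordinate functions. -/
def univ : Matrix (Fin 2) (Fin 2) (CoordRing R) :=
  (Matrix.mvPolynomialX (Fin 2) (Fin 2) R).map (mk R)

theorem det_univ : (univ R).det = 1 := by
  have h : mk R ((Matrix.mvPolynomialX (Fin 2) (Fin 2) R).det - 1) = 0 :=
    Ideal.Quotient.eq_zero_iff_mem.2 (Ideal.subset_span rfl)
  rw [map_sub, map_one, sub_eq_zero] at h
  rw [← h, AlgHom.map_det]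
  rfl

variable {R} {B : Type*} [CommRing B] [Algebra R B]

/-- A matrix of determinant one over an `R`-algebra `B` is a `B`-valued point of `SL₂`: it
evaluates functions. -/
def eval (M : Matrix (Fin 2) (Fin 2) B) (hM : M.det = 1) : CoordRing R →ₐ[R] B :=
  Ideal.Quotient.liftₐ (Ideal.span {(Matrix.mvPolynomialX (Fin 2) (Fin 2) R).det - 1})
    (MvPolynomial.aeval fun ij : Fin 2 × Fin 2 => M ij.1 ij.2) (by
      have h : Ideal.span {(Matrix.mvPolynomialX (Fin 2) (Fin 2) R).det - 1} ≤
          RingHom.ker (MvPolynomial.aeval (R := R) fun ij : Fin 2 × Fin 2 => M ij.1 ij.2) := by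
        rw [Ideal.span_singleton_le_iff_mem, RingHom.mem_ker, map_sub, map_one, AlgHom.map_det,
          sub_eq_zero, ← hM]
        congr 1
        ext i j
        simp
      exact fun a ha => h ha)

@[simp] theorem eval_univ (M : Matrix (Fin 2) (Fin 2) B) (hM : M.det = 1) (i j : Fin 2) :
    eval (R := R) M hM (univ R i j) = M i j := by
  change MvPolynomial.aeval (R := R) (fun ij : Fin 2 × Fin 2 => M ij.1 ij.2)
    (Matrix.mvPolynomialX (Fin 2) (Fin 2) R i j) = _
  simp

@[ext high] theorem algHom_ext {C : Type*} [Semiring C] [Algebra R C] {φ ψ : CoordRing R →ₐ[R] C}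
    (h : ∀ i j, φ (univ R i j) = ψ (univ R i j)) : φ = ψ := by
  have h2 : φ.comp (mk R) = ψ.comp (mk R) := by
    ext ⟨i, j⟩
    simpa [univ] using h i j
  apply AlgHom.ext
  intro x
  obtain ⟨y, rfl⟩ := Ideal.Quotient.mkₐ_surjective R _ x
  exact DFunLike.congr_fun h2 y

variable (R)

/-- The comultiplication dual to matrix multiplication: `x i j ↦ ∑ k, x i k ⊗ x k j`. -/
def comulHom : CoordRing R →ₐ[R] CoordRing R ⊗[R] CoordRing R :=
  eval
    ((univ R).map (Algebra.TensorProduct.includeLeft :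
        CoordRing R →ₐ[R] CoordRing R ⊗[R] CoordRing R) *
      (univ R).map (Algebra.TensorProduct.includeRight :
        CoordRing R →ₐ[R] CoordRing R ⊗[R] CoordRing R)) (by
    rw [Matrix.det_mul]
    have h (φ : CoordRing R →ₐ[R] CoordRing R ⊗[R] CoordRing R) : ((univ R).map φ).det = 1 := by
      have := AlgHom.map_det φ (univ R)
      rw [det_univ, map_one] at this
      exact this.symm
    rw [h, h, one_mul])

theorem comulHom_univ (i j : Fin 2) :
    comulHom R (univ R i j) = ∑ k, univ R i k ⊗ₜ[R] univ R k j := by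
  simp [comulHom, Matrix.mul_apply]

/-- The counit: evaluation at the identity matrix. -/
def counitHom : CoordRing R →ₐ[R] R := eval 1 Matrix.det_one

instance : Bialgebra R (CoordRing R) :=
  Bialgebra.ofAlgHom (comulHom R) (counitHom R)
    (by
      ext i j
      simp [comulHom_univ, TensorProduct.add_tmul, TensorProduct.tmul_add]
      abel)
    (by
      ext i j
      fin_cases i <;> fin_cases j <;> simp [comulHom_univ, counitHom])
    (by
      ext i j
      fin_cases i <;> fin_cases j <;> simp [comulHom_univ, counitHom])

end CoordRing

/-- The algebra of distributions of `SL₂` over `R`, supported at the unit element. -/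
abbrev DistSL2 : Type _ := distAlg R (CoordRing R)

end CoordinateRing

/-! ### Divided powers of nilpotent elements of `sl₂` -/

section DividedPowers

open LieAlgebra.SpecialLinear (sl)

variable {R : Type*} [CommRing R]

theorem det_one_add_X_smul (x : sl (Fin 2) R) (hx : x.1.det = 0) :
    (1 + (Polynomial.X : R[X]) • x.1.map Polynomial.C).det = 1 := by
  have htr : x.1 0 0 + x.1 1 1 = 0 := by
    have h : Matrix.trace x.1 = 0 := x.2
    rwa [Matrix.trace_fin_two] at h
  rw [Matrix.det_fin_two] at hx
  have h1 := congrArg (Polynomial.C : R →+* R[X]) htr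
  have h2 := congrArg (Polynomial.C : R →+* R[X]) hx
  simp only [map_add, map_sub, map_mul, map_zero] at h1 h2
  rw [Matrix.det_fin_two]
  simp
  linear_combination (Polynomial.X : R[X]) * h1 + (Polynomial.X : R[X]) ^ 2 * h2

/-- Restriction of functions on `SL₂` to the one-parameter subgroup `t ↦ exp (t x) = 1 + t x`, for
an element `x` of `sl₂` with `det x = 0` (so that `x ^ 2 = 0`). -/
def restrictExp (x : sl (Fin 2) R) (hx : x.1.det = 0) : CoordRing R →ₐ[R] R[X] :=
  CoordRing.eval (1 + (Polynomial.X : R[X]) • x.1.map Polynomial.C) (det_one_add_X_smul x hx)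

theorem coeff_restrictExp_of_mem (x : sl (Fin 2) R) (hx : x.1.det = 0) (r : ℕ)
    {φ : CoordRing R} (hφ : φ ∈ augIdeal R (CoordRing R) ^ (r + 1)) :
    (restrictExp x hx φ).coeff r = 0 := by
  have h1 : (Polynomial.aeval (0 : R)).comp (restrictExp x hx) =
      Bialgebra.counitAlgHom R (CoordRing R) := by
    change _ = CoordRing.counitHom R
    ext i j
    fin_cases i <;> fin_cases j <;> simp [restrictExp, CoordRing.counitHom]
  have h2 : (augIdeal R (CoordRing R)).map (restrictExp x hx) ≤
      Ideal.span {(Polynomial.X : R[X])} := by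
    rw [Ideal.map_le_iff_le_comap]
    intro ψ hψ
    have h3 : Bialgebra.counitAlgHom R (CoordRing R) ψ = 0 := hψ
    rw [← h1] at h3
    rw [Ideal.mem_comap, Ideal.mem_span_singleton, Polynomial.X_dvd_iff]
    simpa [Polynomial.coeff_zero_eq_aeval_zero] using h3
  have h3 := Ideal.pow_right_mono h2 (r + 1)
  rw [← Ideal.map_pow, Ideal.span_singleton_pow] at h3
  have h4 := h3 (Ideal.mem_map_of_mem _ hφ)
  rw [Ideal.mem_span_singleton, Polynomial.X_pow_dvd_iff] at h4
  exact h4 r (Nat.lt_succ_self r)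

/-- The divided power `x^(r) = x ^ r / r!` in the algebra of distributions, for `x` in `sl₂` with
`det x = 0`: the functional sending `φ` to the coefficient of `t ^ r` in `φ (exp (t x))`. In
particular `x^(0) = 1`, and `x^(1)` is `x` itself, as a tangent vector at the unit element. -/
def dividedPow (x : sl (Fin 2) R) (hx : x.1.det = 0) (r : ℕ) : DistSL2 R :=
  ⟨WithConv.toConv (Polynomial.lcoeff R r ∘ₗ (restrictExp x hx).toLinearMap),
    r + 1, fun _ hφ => coeff_restrictExp_of_mem x hx r hφ⟩

theorem dividedPow_zero (x : sl (Fin 2) R) (hx : x.1.det = 0) : dividedPow x hx 0 = 1 := by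
  have h1 : (Polynomial.aeval (0 : R)).comp (restrictExp x hx) =
      Bialgebra.counitAlgHom R (CoordRing R) := by
    change _ = CoordRing.counitHom R
    ext i j
    fin_cases i <;> fin_cases j <;> simp [restrictExp, CoordRing.counitHom]
  apply Subtype.ext
  apply WithConv.ext
  apply LinearMap.ext
  intro φ
  have h2 := DFunLike.congr_fun h1 φ
  change (restrictExp x hx φ).coeff 0 = Coalgebra.counit (R := R) φ
  rw [Polynomial.coeff_zero_eq_aeval_zero]
  exact h2

theorem dividedPow_mul (x : sl (Fin 2) R) (hx : x.1.det = 0) (r s : ℕ) :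
    dividedPow x hx r * dividedPow x hx s = (r + s).choose r • dividedPow x hx (r + s) := by
  have hxx : x.1 * x.1 = 0 := by
    have htr : x.1 0 0 + x.1 1 1 = 0 := by
      have h : Matrix.trace x.1 = 0 := x.2
      rwa [Matrix.trace_fin_two] at h
    rw [Matrix.det_fin_two] at hx
    ext i j
    fin_cases i <;> fin_cases j <;> simp [Matrix.mul_apply, Fin.sum_univ_two]
    · linear_combination x.1 0 0 * htr - hx
    · linear_combination x.1 0 1 * htr
    · linear_combination x.1 1 0 * htr
    · linear_combination x.1 1 1 * htr - hx
  -- the one-parameter subgroup is a homomorphism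
  let θ := restrictExp x hx
  let add : R[X] →ₐ[R] R[X] ⊗[R] R[X] :=
    Polynomial.aeval ((Polynomial.X : R[X]) ⊗ₜ[R] (1 : R[X]) + 1 ⊗ₜ[R] (Polynomial.X : R[X]))
  have h1 : (Algebra.TensorProduct.map θ θ).comp (CoordRing.comulHom R) = add.comp θ := by
    have hθ : ∀ i j, θ (CoordRing.univ R i j) =
        (1 : Matrix (Fin 2) (Fin 2) R[X]) i j + Polynomial.X * Polynomial.C (x.1 i j) := by
      intro i j
      simp [θ, restrictExp]
    have hC : ∀ c : R, add (Polynomial.C c) = algebraMap R _ c := fun c => by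
      rw [← Polynomial.algebraMap_eq, AlgHom.commutes]
    have hX : add Polynomial.X = (Polynomial.X : R[X]) ⊗ₜ[R] (1 : R[X]) + 1 ⊗ₜ[R] Polynomial.X := by
      simp [add]
    have hl : ∀ c : R, (Polynomial.C c : R[X]) ⊗ₜ[R] (1 : R[X]) = algebraMap R _ c := fun c => rfl
    have hr : ∀ c : R, (1 : R[X]) ⊗ₜ[R] (Polynomial.C c : R[X]) = algebraMap R _ c := fun c => by
      rw [Algebra.TensorProduct.algebraMap_apply', Polynomial.algebraMap_eq]
    set U : R[X] ⊗[R] R[X] := (Polynomial.X : R[X]) ⊗ₜ[R] (1 : R[X]) with hU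
    set V : R[X] ⊗[R] R[X] := (1 : R[X]) ⊗ₜ[R] (Polynomial.X : R[X]) with hV
    have hL : ∀ i j, θ (CoordRing.univ R i j) ⊗ₜ[R] (1 : R[X]) =
        (1 : Matrix (Fin 2) (Fin 2) (R[X] ⊗[R] R[X])) i j +
          U * algebraMap R _ (x.1 i j) := by
      intro i j
      rw [hθ, TensorProduct.add_tmul, ← hl, hU, Algebra.TensorProduct.tmul_mul_tmul, one_mul]
      congr 1
      fin_cases i <;> fin_cases j <;> simp [Algebra.TensorProduct.one_def]
    have hR : ∀ i j, (1 : R[X]) ⊗ₜ[R] θ (CoordRing.univ R i j) =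
        (1 : Matrix (Fin 2) (Fin 2) (R[X] ⊗[R] R[X])) i j +
          V * algebraMap R _ (x.1 i j) := by
      intro i j
      rw [hθ, TensorProduct.tmul_add, ← hr, hV, Algebra.TensorProduct.tmul_mul_tmul, one_mul]
      congr 1
      fin_cases i <;> fin_cases j <;> simp [Algebra.TensorProduct.one_def]
    have hsq : ∀ i j, algebraMap R (R[X] ⊗[R] R[X]) (x.1 i 0) * algebraMap R _ (x.1 0 j) +
        algebraMap R _ (x.1 i 1) * algebraMap R _ (x.1 1 j) = 0 := by
      intro i j
      have := congrFun (congrFun hxx i) j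
      rw [Matrix.mul_apply, Fin.sum_univ_two] at this
      rw [← map_mul, ← map_mul, ← map_add, this]
      simp
    have hprod : ∀ a b : CoordRing R, Algebra.TensorProduct.map θ θ (a ⊗ₜ[R] b) =
        (θ a ⊗ₜ[R] (1 : R[X])) * ((1 : R[X]) ⊗ₜ[R] θ b) := by
      intro a b
      simp
    ext i j
    rw [AlgHom.comp_apply, AlgHom.comp_apply, CoordRing.comulHom_univ, hθ, Fin.sum_univ_two,
      map_add, hprod, hprod, hL, hL, hR, hR, map_add, map_mul, hC, hX]
    have h00 := hsq i j
    generalize (algebraMap R (R[X] ⊗[R] R[X]) : R → R[X] ⊗[R] R[X]) = c at h00 ⊢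
    clear_value U V
    have e01 : (1 : Matrix (Fin 2) (Fin 2) (R[X] ⊗[R] R[X])) 0 1 = 0 := by simp
    have e10 : (1 : Matrix (Fin 2) (Fin 2) (R[X] ⊗[R] R[X])) 1 0 = 0 := by simp
    have e00 : (1 : Matrix (Fin 2) (Fin 2) (R[X] ⊗[R] R[X])) 0 0 = 1 := by simp
    have e11 : (1 : Matrix (Fin 2) (Fin 2) (R[X] ⊗[R] R[X])) 1 1 = 1 := by simp
    have f01 : (1 : Matrix (Fin 2) (Fin 2) R[X]) 0 1 = 0 := by simp
    have f10 : (1 : Matrix (Fin 2) (Fin 2) R[X]) 1 0 = 0 := by simp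
    have f00 : (1 : Matrix (Fin 2) (Fin 2) R[X]) 0 0 = 1 := by simp
    have f11 : (1 : Matrix (Fin 2) (Fin 2) R[X]) 1 1 = 1 := by simp
    have hi : i = 0 ∨ i = 1 := by omega
    have hj : j = 0 ∨ j = 1 := by omega
    rcases hi with rfl | rfl <;> rcases hj with rfl | rfl <;>
      simp only [e00, e01, e10, e11, f00, f01, f10, f11, map_zero, map_one] <;>
      linear_combination U * V * h00
  -- comparison of coefficients
  let F : R[X] ⊗[R] R[X] →ₗ[R] R :=
    LinearMap.mul' R R ∘ₗ TensorProduct.map (Polynomial.lcoeff R r) (Polynomial.lcoeff R s)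
  have h2 : ∀ q : R[X], F (add q) = (r + s).choose r • q.coeff (r + s) := by
    intro q
    induction q using Polynomial.induction_on' with
    | add a b ha hb => rw [map_add, map_add, ha, hb, Polynomial.coeff_add, smul_add]
    | monomial n c =>
      have hadd : add (Polynomial.monomial n c) = c • ∑ m ∈ Finset.range (n + 1),
          n.choose m • ((Polynomial.X ^ m : R[X]) ⊗ₜ[R] (Polynomial.X ^ (n - m) : R[X])) := by
        rw [← Polynomial.smul_X_eq_monomial, map_smul, map_pow]
        congr 1
        simp only [add, Polynomial.aeval_X]
        rw [add_pow]
        refine Finset.sum_congr rfl fun m _ => ?_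
        simp [Algebra.TensorProduct.tmul_pow, nsmul_eq_mul, mul_comm]
      rw [hadd, map_smul, map_sum]
      simp only [map_nsmul]
      have hF : ∀ a b : ℕ, F ((Polynomial.X ^ a : R[X]) ⊗ₜ[R] (Polynomial.X ^ b : R[X])) =
          (if r = a then 1 else 0) * (if s = b then 1 else 0) := by
        intro a b
        simp [F, Polynomial.coeff_X_pow]
      simp only [hF, Polynomial.coeff_monomial]
      by_cases hn : n = r + s
      · subst hn
        rw [Finset.sum_eq_single r]
        · simp [mul_comm]
        · intro m _ hm
          simp [hm.symm]
        · intro h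
          exact absurd (Finset.mem_range.2 (by omega)) h
      · rw [if_neg hn, Finset.sum_eq_zero]
        · simp
        · intro m hm
          have := Finset.mem_range.1 hm
          by_cases hrm : r = m
          · have : s ≠ n - m := by omega
            simp [this]
          · simp [hrm]
  apply Subtype.ext
  apply WithConv.ext
  apply LinearMap.ext
  intro φ
  have h3 : ∀ t : CoordRing R ⊗[R] CoordRing R,
      LinearMap.mul' R R (TensorProduct.map (Polynomial.lcoeff R r ∘ₗ θ.toLinearMap)
        (Polynomial.lcoeff R s ∘ₗ θ.toLinearMap) t) = F (Algebra.TensorProduct.map θ θ t) := by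
    intro t
    induction t using TensorProduct.induction_on with
    | zero => simp
    | add a b ha hb => rw [map_add, map_add, map_add, map_add, ha, hb]
    | tmul a b => simp [F]
  have h4 := h3 (CoordRing.comulHom R φ)
  rw [← AlgHom.comp_apply, h1, AlgHom.comp_apply, h2] at h4
  exact h4

/-- `x^(1) ^ r = r! • x^(r)`: over `ℤ` or `ℚ` this determines `x^(r)` as `x ^ r / r!`. -/
theorem dividedPow_one_pow (x : sl (Fin 2) R) (hx : x.1.det = 0) (r : ℕ) :
    dividedPow x hx 1 ^ r = r.factorial • dividedPow x hx r := by
  induction r with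
  | zero => simp [dividedPow_zero]
  | succ r ih =>
    rw [pow_succ, ih, smul_mul_assoc, dividedPow_mul, smul_smul, Nat.factorial_succ]
    congr 1
    rw [Nat.choose_succ_self_right]
    ring

/-- The two root vectors of a standard basis of `sl₂` have determinant zero. -/
theorem det_eq_zero_of_triple {p : ℕ} [Fact p.Prime] (hp : 3 ≤ p) {h e f : sl (Fin 2) (ZMod p)}
    (ht : IsSl2Triple h e f) : e.1.det = 0 := by
  have h2 : (2 : ZMod p) ≠ 0 := by
    intro h0
    have h1 : ((2 : ℕ) : ZMod p) = 0 := by exact_mod_cast h0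
    rw [ZMod.natCast_eq_zero_iff] at h1
    have := Nat.le_of_dvd (by norm_num) h1
    omega
  have he : e.1 0 0 + e.1 1 1 = 0 := by
    have h : Matrix.trace e.1 = 0 := e.2
    rwa [Matrix.trace_fin_two] at h
  have hh : h.1 0 0 + h.1 1 1 = 0 := by
    have h' : Matrix.trace h.1 = 0 := h.2
    rwa [Matrix.trace_fin_two] at h'
  have hb : h.1 * e.1 - e.1 * h.1 = 2 • e.1 := by
    rw [← LieAlgebra.SpecialLinear.sl_bracket, ht.lie_h_e_nsmul]
    rfl
  have h00 := congrFun (congrFun hb 0) 0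
  have h01 := congrFun (congrFun hb 0) 1
  have h10 := congrFun (congrFun hb 1) 0
  simp [Matrix.mul_apply, Fin.sum_univ_two] at h00 h01 h10
  have he' : e.1 1 1 = -e.1 0 0 := by linear_combination he
  have hh' : h.1 1 1 = -h.1 0 0 := by linear_combination hh
  rw [hh', he'] at h01 h10
  have : (2 : ZMod p) * (2 * e.1.det) = 0 := by
    rw [Matrix.det_fin_two, he']
    linear_combination 2 * e.1 0 0 * h00 + e.1 1 0 * h01 + e.1 0 1 * h10
  simpa [h2] using this

end DividedPowers

/-! ### The algebra with the asserted presentation -/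

section Presentation

/-- Symbols for the generators `e^(p^k)` and `f^(p^k)`. -/
inductive Gen : Type
  | e (k : ℕ)
  | f (k : ℕ)

variable (p : ℕ)

/-- The symbol `e^(p^k)` in the free algebra. -/
def genE (k : ℕ) : FreeAlgebra (ZMod p) Gen := FreeAlgebra.ι (ZMod p) (Gen.e k)

/-- The symbol `f^(p^k)` in the free algebra. -/
def genF (k : ℕ) : FreeAlgebra (ZMod p) Gen := FreeAlgebra.ι (ZMod p) (Gen.f k)

/-- `X_k = [e^(p^k), f^(p^k)]`. -/
def genX (k : ℕ) : FreeAlgebra (ZMod p) Gen := ⁅genE p k, genF p k⁆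

/-- The product `(e^(p^k))^(p-1) (e^(p^(k+1)))^(p-1) ⋯ (e^(p^(k+n-1)))^(p-1)`, in this order. -/
def prodE (k n : ℕ) : FreeAlgebra (ZMod p) Gen :=
  ((List.range n).map fun i => genE p (k + i) ^ (p - 1)).prod

/-- The product `(f^(p^k))^(p-1) (f^(p^(k+1)))^(p-1) ⋯ (f^(p^(k+n-1)))^(p-1)`, in this order. -/
def prodF (k n : ℕ) : FreeAlgebra (ZMod p) Gen :=
  ((List.range n).map fun i => genF p (k + i) ^ (p - 1)).prod

/-- The defining relations, for all `k ≥ 0` and `n > 0`. -/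
inductive Rel : FreeAlgebra (ZMod p) Gen → FreeAlgebra (ZMod p) Gen → Prop
  | rel1_e (k : ℕ) : Rel ⁅genX p k, genE p k⁆ (2 * genE p k)
  | rel1_f (k : ℕ) : Rel ⁅genX p k, genF p k⁆ (-2 * genF p k)
  | rel2_e (k n : ℕ) (hn : 0 < n) : Rel ⁅genX p k, genE p (k + n)⁆ 0
  | rel2_f (k n : ℕ) (hn : 0 < n) : Rel ⁅genX p k, genF p (k + n)⁆ 0
  | rel3_e (k n : ℕ) (hn : 0 < n) : Rel ⁅genE p k, genE p (k + n)⁆ 0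
  | rel3_f (k n : ℕ) (hn : 0 < n) : Rel ⁅genF p k, genF p (k + n)⁆ 0
  | rel4_f (k n : ℕ) (hn : 0 < n) :
      Rel ⁅genE p k, genF p (k + n)⁆ ((-1) ^ n * prodF p k n * (genX p k + 1))
  | rel4_e (k n : ℕ) (hn : 0 < n) :
      Rel ⁅genE p (k + n), genF p k⁆ ((-1) ^ n * (genX p k + 1) * prodE p k n)
  | rel5_e (k : ℕ) : Rel (genE p k ^ p) 0
  | rel5_f (k : ℕ) : Rel (genF p k ^ p) 0
  | rel6 (k : ℕ) : Rel (genX p k ^ p) (genX p k)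

/-- The associative unital algebra over `F_p` with generators `Gen` and relations `Rel`. -/
abbrev Presented : Type := RingQuot (Rel p)

end Presentation

/-! ### The restricted enveloping algebra of `sl₂` -/

section Restricted

open LieAlgebra.SpecialLinear (sl)

variable (p : ℕ)

/-- The relations `x ^ p = x^[p]` for `x` in `sl₂`, where the `p`-operation `x^[p]` of `sl₂` is the
`p`-th power of matrices. -/
inductive RestrictedRel : UniversalEnvelopingAlgebra (ZMod p) (sl (Fin 2) (ZMod p)) →
    UniversalEnvelopingAlgebra (ZMod p) (sl (Fin 2) (ZMod p)) → Prop
  | pow (x y : sl (Fin 2) (ZMod p)) (h : y.1 = x.1 ^ p) :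
      RestrictedRel (UniversalEnvelopingAlgebra.ι (ZMod p) x ^ p)
        (UniversalEnvelopingAlgebra.ι (ZMod p) y)

/-- The restricted enveloping algebra of `sl₂` over `F_p`. -/
abbrev RestrictedEnv : Type := RingQuot (RestrictedRel p)

/-- The canonical map from `sl₂` to its restricted enveloping algebra. -/
def restrictedι (x : sl (Fin 2) (ZMod p)) : RestrictedEnv p :=
  RingQuot.mkAlgHom (ZMod p) (RestrictedRel p) (UniversalEnvelopingAlgebra.ι (ZMod p) x)

end Restricted

end SL2Dist
end

/-! Conjugation by a suitable matrix turns e and f into the elementary matrices, so that SL₂ has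
coordinates a, b, c, d with ad - bc = 1. Modulo a power of the augmentation ideal the function a is
invertible, because 1 - a^(p^K) = (1 - a)^(p^K); hence d can be eliminated and a distribution is
determined by its values on the monomials a^i b^j c^k (`Standardizes.ext_coordMonomial`). Left
multiplication by f^(l) and right multiplication by e^(l) act on these monomials without involving
d, and exp(xe) exp(yf) has the entries 1 + xy, x, y, 1. Identities between the relevant products
thus become congruences of binomial coefficients, which Lucas' theorem settles.

Relations. With q = p^k, the only identity of functionals that is needed, beside the product rule of
divided powers, is [e^(q(s+1)), f^(q)] = ([e^(q), f^(q)] - s) e^(qs), together with its mirror image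
(`Standardizes.commutator_eq`). Relations 1 to 5 follow formally (`DividedPowerPair`). Relation 6 is
a consequence of the others: put x = e^(q), y = f^(q), X = [x, y]. Relation 4 for n = 1 makes (X +
1) x^(p-1) a commutator [y, u], so the sum of the y^i (X + 1) x^(p-1) y^(p-1-i) over i < p
telescopes to y^p u - u y^p = 0. Computed inside the commutative algebra generated by yx and X, the
same sum is X - X^p (`Sl2Relations.sum_pow_mul_pow`).

Presentation. In any algebra with these relations the pair of level k generates an algebra of
dimension at most p^3, and commutators of the pair of level K with the algebra P_K generated by the
lower levels stay in P_K. So dim P_K ≤ p^(3K) (`HyperRelations.finrank_levelAlgebra_le`). In H, the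
p^(3K) products f^(α) e^(m) f^(m) e^(δ) with α, m, δ < p^K lie in P_K and have a unitriangular
matrix of values on the functions (a-1)^i b^j c^k with i, j, k < p^K. This gives independence, hence
dim P_K = p^(3K) in H and injectivity of the map from the presented algebra; it also gives
surjectivity, since a distribution killing I^n, with I the augmentation ideal and n ≤ p^K, is a
combination of these products.

Restricted enveloping algebra. The map exists once (aX + bx + cy)^p = (a² + bc)^((p-1)/2) (aX + bx +
cy) is known in every algebra with the relations of one level; this is derived from a form of
Jacobson's formula (`add_pow_char_sub_of_ad_ad`). The source has dimension at most p^3, and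
p^(3(k+1)) ≤ dim P_(k+1) ≤ dim(level k) · p^(3k) shows that the image has at least this dimension.
-/

noncomputable section

open scoped TensorProduct Polynomial

namespace SL2Dist

/-! ### Adapted coordinates, and divided powers as coefficient functionals -/

section Functionals

open LieAlgebra.SpecialLinear (sl)

variable {R : Type*} [CommRing R]

/-- The conjugate `g' * univ * g` of the universal matrix. -/
def coordMatrix (g g' : Matrix (Fin 2) (Fin 2) R) : Matrix (Fin 2) (Fin 2) (CoordRing R) :=
  g'.map (algebraMap R (CoordRing R)) * CoordRing.univ R * g.map (algebraMap R (CoordRing R))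

theorem algHom_map_coordMatrix (g g' : Matrix (Fin 2) (Fin 2) R) {D : Type*} [CommRing D]
    [Algebra R D] (P : CoordRing R →ₐ[R] D) :
    (coordMatrix g g').map P =
      g'.map (algebraMap R D) * (CoordRing.univ R).map P * g.map (algebraMap R D) := by
  have h (m : Matrix (Fin 2) (Fin 2) R) :
      (m.map (algebraMap R (CoordRing R))).map P = m.map (algebraMap R D) := by
    ext i j
    simp
  have h2 (m n : Matrix (Fin 2) (Fin 2) (CoordRing R)) : (m * n).map P = m.map P * n.map P :=
    Matrix.map_mul (f := (P : CoordRing R →+* D))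
  rw [coordMatrix, h2, h2, h, h]

theorem map_algebraMap_mul {D : Type*} [CommRing D] [Algebra R D]
    (m n : Matrix (Fin 2) (Fin 2) R) :
    (m * n).map (algebraMap R D) = m.map (algebraMap R D) * n.map (algebraMap R D) :=
  Matrix.map_mul (f := algebraMap R D)

/-- Multiplication of the `D`-valued point `P` of `SL₂` with `exp (t x)` from the right, `t` an
indeterminate. -/
def mulExp {D : Type*} [CommRing D] [Algebra R D] (P : CoordRing R →ₐ[R] D) (x : sl (Fin 2) R)
    (hx : x.1.det = 0) : CoordRing R →ₐ[R] D[X] :=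
  (Algebra.TensorProduct.lift ((Polynomial.CAlgHom (R := R) (A := D)).comp P)
    ((Polynomial.mapAlgHom (Algebra.ofId R D)).comp (restrictExp x hx))
    (fun _ _ => Commute.all _ _)).comp (Bialgebra.comulAlgHom R (CoordRing R))

theorem mulExp_univ {D : Type*} [CommRing D] [Algebra R D] (P : CoordRing R →ₐ[R] D)
    (x : sl (Fin 2) R) (hx : x.1.det = 0) :
    (CoordRing.univ R).map (mulExp P x hx) = ((CoordRing.univ R).map P).map Polynomial.C *
      (1 + (Polynomial.X : D[X]) • x.1.map (algebraMap R D[X])) := by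
  ext1 i j
  have h1 : Bialgebra.comulAlgHom R (CoordRing R) (CoordRing.univ R i j) =
    ∑ k, CoordRing.univ R i k ⊗ₜ[R] CoordRing.univ R k j := CoordRing.comulHom_univ R i j
  rw [Matrix.map_apply, mulExp, AlgHom.comp_apply, h1, map_sum, Matrix.mul_apply]
  refine Finset.sum_congr rfl fun k _ => ?_
  rw [Algebra.TensorProduct.lift_tmul]
  congr 1
  rw [AlgHom.comp_apply, restrictExp, CoordRing.eval_univ]
  have h2 : (Polynomial.mapAlgHom (Algebra.ofId R D)) ((1 : Matrix (Fin 2) (Fin 2) R[X]) k j) =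
      (1 : Matrix (Fin 2) (Fin 2) D[X]) k j := by
    by_cases h : k = j <;> simp [Matrix.one_apply, h]
  simp only [Matrix.add_apply, Matrix.smul_apply, smul_eq_mul, map_add, map_mul, h2]
  simp [Polynomial.algebraMap_apply]

/-- Conjugation carries the factor exp(tx) to exp(t g'xg), so in the adapted coordinates only
exponentials of elementary matrices have to be multiplied. -/
theorem mulExp_coordMatrix {D : Type*} [CommRing D] [Algebra R D] (P : CoordRing R →ₐ[R] D)
    (x : sl (Fin 2) R) (hx : x.1.det = 0) {g g' : Matrix (Fin 2) (Fin 2) R} (hg : g * g' = 1)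
    (hg' : g' * g = 1) :
    (coordMatrix g g').map (mulExp P x hx) = ((coordMatrix g g').map P).map Polynomial.C *
      (1 + (Polynomial.X : D[X]) • (g' * x.1 * g).map (algebraMap R D[X])) := by
  have h1 (m n : Matrix (Fin 2) (Fin 2) D) :
      (m * n).map Polynomial.C = m.map Polynomial.C * n.map Polynomial.C :=
    Matrix.map_mul (f := (Polynomial.C : D →+* D[X]))
  have h2 (m : Matrix (Fin 2) (Fin 2) R) :
      (m.map (algebraMap R D)).map Polynomial.C = m.map (algebraMap R D[X]) := by
    ext i j
    simp [Polynomial.algebraMap_apply]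
  have h3 : g.map (algebraMap R D[X]) * g'.map (algebraMap R D[X]) = 1 := by
    rw [← map_algebraMap_mul, hg]
    simp
  have h4 : g'.map (algebraMap R D[X]) * g.map (algebraMap R D[X]) = 1 := by
    rw [← map_algebraMap_mul, hg']
    simp
  rw [algHom_map_coordMatrix, algHom_map_coordMatrix, mulExp_univ, h1, h1, h2, h2,
    map_algebraMap_mul, map_algebraMap_mul]
  generalize g.map (algebraMap R D[X]) = G at h3 h4 ⊢
  generalize g'.map (algebraMap R D[X]) = G' at h3 h4 ⊢
  generalize x.1.map (algebraMap R D[X]) = Y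
  generalize ((CoordRing.univ R).map P).map Polynomial.C = U
  calc G' * (U * (1 + (Polynomial.X : D[X]) • Y)) * G
      = G' * U * (G + (Polynomial.X : D[X]) • (Y * G)) := by
        rw [Matrix.mul_assoc, Matrix.mul_assoc U, Matrix.add_mul, Matrix.one_mul,
          Matrix.smul_mul, Matrix.mul_assoc]
    _ = G' * U * (G * (1 + (Polynomial.X : D[X]) • (G' * Y * G))) := by
        rw [Matrix.mul_add G, Matrix.mul_one, Matrix.mul_smul, Matrix.mul_assoc G' Y,
          ← Matrix.mul_assoc G G', h3, Matrix.one_mul]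
    _ = _ := by simp only [Matrix.mul_assoc]

/-- Multiplication of the universal point of `SL₂` with `exp (t x)` from the left, `t` an
indeterminate. -/
def expMul (x : sl (Fin 2) R) (hx : x.1.det = 0) : CoordRing R →ₐ[R] (CoordRing R)[X] :=
  (Algebra.TensorProduct.lift
    ((Polynomial.mapAlgHom (Algebra.ofId R (CoordRing R))).comp (restrictExp x hx))
    (Polynomial.CAlgHom (R := R) (A := CoordRing R))
    (fun _ _ => Commute.all _ _)).comp (Bialgebra.comulAlgHom R (CoordRing R))

theorem expMul_univ (x : sl (Fin 2) R) (hx : x.1.det = 0) :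
    (CoordRing.univ R).map (expMul x hx) =
      (1 + (Polynomial.X : (CoordRing R)[X]) • x.1.map (algebraMap R (CoordRing R)[X])) *
        (CoordRing.univ R).map Polynomial.C := by
  ext1 i j
  have h1 : Bialgebra.comulAlgHom R (CoordRing R) (CoordRing.univ R i j) =
    ∑ k, CoordRing.univ R i k ⊗ₜ[R] CoordRing.univ R k j := CoordRing.comulHom_univ R i j
  rw [Matrix.map_apply, expMul, AlgHom.comp_apply, h1, map_sum, Matrix.mul_apply]
  refine Finset.sum_congr rfl fun k _ => ?_
  rw [Algebra.TensorProduct.lift_tmul]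
  congr 1
  rw [AlgHom.comp_apply, restrictExp, CoordRing.eval_univ]
  have h2 : (Polynomial.mapAlgHom (Algebra.ofId R (CoordRing R)))
      ((1 : Matrix (Fin 2) (Fin 2) R[X]) i k) =
      (1 : Matrix (Fin 2) (Fin 2) (CoordRing R)[X]) i k := by
    by_cases h : i = k <;> simp [Matrix.one_apply, h]
  simp only [Matrix.add_apply, Matrix.smul_apply, smul_eq_mul, map_add, map_mul, h2]
  simp [Polynomial.algebraMap_apply]

theorem expMul_coordMatrix (x : sl (Fin 2) R) (hx : x.1.det = 0)
    {g g' : Matrix (Fin 2) (Fin 2) R} (hg : g * g' = 1) :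
    (coordMatrix g g').map (expMul x hx) =
      (1 + (Polynomial.X : (CoordRing R)[X]) •
        (g' * x.1 * g).map (algebraMap R (CoordRing R)[X])) *
        (coordMatrix g g').map Polynomial.C := by
  have h1 (m n : Matrix (Fin 2) (Fin 2) (CoordRing R)) :
      (m * n).map Polynomial.C = m.map Polynomial.C * n.map Polynomial.C :=
    Matrix.map_mul (f := (Polynomial.C : CoordRing R →+* (CoordRing R)[X]))
  have h2 (m : Matrix (Fin 2) (Fin 2) R) :
      (m.map (algebraMap R (CoordRing R))).map Polynomial.C =
        m.map (algebraMap R (CoordRing R)[X]) := by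
    ext i j
    simp [Polynomial.algebraMap_apply]
  have h3 : g.map (algebraMap R (CoordRing R)[X]) * g'.map (algebraMap R (CoordRing R)[X]) = 1 := by
    rw [← map_algebraMap_mul, hg]
    simp
  rw [algHom_map_coordMatrix, expMul_univ, coordMatrix, h1, h1, h2, h2, map_algebraMap_mul,
    map_algebraMap_mul]
  generalize g.map (algebraMap R (CoordRing R)[X]) = G at h3 ⊢
  generalize g'.map (algebraMap R (CoordRing R)[X]) = G' at h3 ⊢
  generalize x.1.map (algebraMap R (CoordRing R)[X]) = Y
  generalize (CoordRing.univ R).map Polynomial.C = U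
  calc G' * ((1 + (Polynomial.X : (CoordRing R)[X]) • Y) * U) * G
      = (G' + (Polynomial.X : (CoordRing R)[X]) • (G' * Y)) * (U * G) := by
        rw [← Matrix.mul_assoc, Matrix.mul_assoc _ U, Matrix.mul_add, Matrix.mul_one,
          Matrix.mul_smul]
    _ = (1 + (Polynomial.X : (CoordRing R)[X]) • (G' * Y * G)) * G' * (U * G) := by
        rw [Matrix.add_mul 1, Matrix.one_mul, Matrix.smul_mul, Matrix.mul_assoc (G' * Y), h3,
          Matrix.mul_one]
    _ = _ := by simp only [Matrix.mul_assoc]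

/-- The functional `μ` is the composite of evaluation at the point `P` and the functional `l`. -/
def Represents {D : Type*} [CommRing D] [Algebra R D] (μ : DistSL2 R) (P : CoordRing R →ₐ[R] D)
    (l : D →ₗ[R] R) : Prop :=
  ∀ φ : CoordRing R, μ.1 φ = l (P φ)

/-- The coefficient of `X ^ n`, as an `R`-linear map on `D[X]`. -/
def coeffMap (R D : Type*) [CommRing R] [CommRing D] [Algebra R D] (n : ℕ) : D[X] →ₗ[R] D :=
  (Polynomial.lcoeff D n).restrictScalars R

@[simp] theorem coeffMap_apply {D : Type*} [CommRing D] [Algebra R D] (n : ℕ) (P : D[X]) :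
    coeffMap R D n P = P.coeff n := rfl

theorem represents_one :
    Represents (1 : DistSL2 R) (Bialgebra.counitAlgHom R (CoordRing R)) LinearMap.id :=
  fun _ => rfl

/-- Iteration turns a product of divided powers into the extraction of coefficients from the value
of a function at a product of exponentials with independent parameters. -/
theorem Represents.mul_dividedPow {D : Type*} [CommRing D] [Algebra R D] {μ : DistSL2 R}
    {P : CoordRing R →ₐ[R] D} {l : D →ₗ[R] R} (hμ : Represents μ P l) (x : sl (Fin 2) R)
    (hx : x.1.det = 0) (n : ℕ) :
    Represents (μ * dividedPow x hx n) (mulExp P x hx) (l ∘ₗ coeffMap R D n) := by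
  intro φ
  change LinearMap.mul' R R (TensorProduct.map μ.1.ofConv
    (Polynomial.lcoeff R n ∘ₗ (restrictExp x hx).toLinearMap)
    (Bialgebra.comulAlgHom R (CoordRing R) φ)) = _
  rw [mulExp, AlgHom.comp_apply]
  generalize Bialgebra.comulAlgHom R (CoordRing R) φ = t
  induction t using TensorProduct.induction_on with
  | zero => simp
  | add a b ha hb => simp only [map_add, ha, hb]
  | tmul a b =>
    have := hμ a
    simp only [TensorProduct.map_tmul, LinearMap.mul'_apply, Algebra.TensorProduct.lift_tmul,
      AlgHom.comp_apply, LinearMap.comp_apply, coeffMap_apply, Polynomial.CAlgHom_apply,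
      Polynomial.coeff_C_mul, Polynomial.coe_mapAlgHom, Polynomial.coeff_map]
    change μ.1 a * _ = _
    rw [this, mul_comm (P a)]
    change _ = l (algebraMap R D _ * P a)
    rw [← Algebra.smul_def, map_smul, smul_eq_mul, mul_comm]
    rfl

/-- A divided power on the left is moved onto the function, which leaves the distribution on the
right arbitrary. -/
theorem dividedPow_mul_apply (x : sl (Fin 2) R) (hx : x.1.det = 0) (n : ℕ) (μ : DistSL2 R)
    (φ : CoordRing R) : (dividedPow x hx n * μ).1 φ = μ.1 ((expMul x hx φ).coeff n) := by
  change LinearMap.mul' R R (TensorProduct.map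
    (Polynomial.lcoeff R n ∘ₗ (restrictExp x hx).toLinearMap) μ.1.ofConv
    (Bialgebra.comulAlgHom R (CoordRing R) φ)) = μ.1.ofConv _
  rw [expMul, AlgHom.comp_apply]
  generalize Bialgebra.comulAlgHom R (CoordRing R) φ = t
  induction t using TensorProduct.induction_on with
  | zero => simp
  | add a b ha hb => simp only [map_add, ha, hb, Polynomial.coeff_add]
  | tmul a b =>
    simp only [TensorProduct.map_tmul, LinearMap.mul'_apply, Algebra.TensorProduct.lift_tmul,
      AlgHom.comp_apply, LinearMap.comp_apply, Polynomial.CAlgHom_apply,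
      Polynomial.coeff_mul_C, Polynomial.coe_mapAlgHom, Polynomial.coeff_map]
    change _ = μ.1.ofConv (algebraMap R (CoordRing R) _ * b)
    rw [← Algebra.smul_def, map_smul, smul_eq_mul]
    rfl

theorem mul_dividedPow_apply (x : sl (Fin 2) R) (hx : x.1.det = 0) (n : ℕ) (μ : DistSL2 R)
    (φ : CoordRing R) : (μ * dividedPow x hx n).1 φ =
      μ.1 ((mulExp (AlgHom.id R (CoordRing R)) x hx φ).coeff n) :=
  Represents.mul_dividedPow (l := μ.1.ofConv) (fun _ => rfl) x hx n φ

/-- Conjugation by `g`, with inverse `g'`, takes `e` and `f` to the elementary matrices. -/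
structure Standardizes (g g' : Matrix (Fin 2) (Fin 2) R) (e f : sl (Fin 2) R) : Prop where
  mul_eq : g * g' = 1
  mul_eq' : g' * g = 1
  conj_e : g' * e.1 * g = !![0, 1; 0, 0]
  conj_f : g' * f.1 * g = !![0, 0; 1, 0]

namespace Standardizes

variable {g g' : Matrix (Fin 2) (Fin 2) R} {e f : sl (Fin 2) R} {D : Type*} [CommRing D]
  [Algebra R D]

theorem mulExp_e (S : Standardizes g g' e f) (P : CoordRing R →ₐ[R] D) (he : e.1.det = 0)
    (i : Fin 2) :
    mulExp P e he (coordMatrix g g' i 0) = Polynomial.C (P (coordMatrix g g' i 0)) ∧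
    mulExp P e he (coordMatrix g g' i 1) = Polynomial.C (P (coordMatrix g g' i 1)) +
      Polynomial.C (P (coordMatrix g g' i 0)) * Polynomial.X := by
  have h := mulExp_coordMatrix P e he S.mul_eq S.mul_eq'
  rw [S.conj_e] at h
  have h0 := congrFun (congrFun h i) 0
  have h1 := congrFun (congrFun h i) 1
  simp [Matrix.mul_apply, Fin.sum_univ_two] at h0 h1
  exact ⟨h0, by rw [h1, add_comm]⟩

theorem mulExp_f (S : Standardizes g g' e f) (P : CoordRing R →ₐ[R] D) (hf : f.1.det = 0)
    (i : Fin 2) :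
    mulExp P f hf (coordMatrix g g' i 0) = Polynomial.C (P (coordMatrix g g' i 0)) +
      Polynomial.C (P (coordMatrix g g' i 1)) * Polynomial.X ∧
    mulExp P f hf (coordMatrix g g' i 1) = Polynomial.C (P (coordMatrix g g' i 1)) := by
  have h := mulExp_coordMatrix P f hf S.mul_eq S.mul_eq'
  rw [S.conj_f] at h
  have h0 := congrFun (congrFun h i) 0
  have h1 := congrFun (congrFun h i) 1
  simp [Matrix.mul_apply, Fin.sum_univ_two] at h0 h1
  exact ⟨h0, h1⟩

theorem expMul_f (S : Standardizes g g' e f) (hf : f.1.det = 0) (j : Fin 2) :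
    expMul f hf (coordMatrix g g' 0 j) = Polynomial.C (coordMatrix g g' 0 j) ∧
    expMul f hf (coordMatrix g g' 1 j) = Polynomial.C (coordMatrix g g' 1 j) +
      Polynomial.C (coordMatrix g g' 0 j) * Polynomial.X := by
  have h := expMul_coordMatrix f hf (g := g) (g' := g') S.mul_eq
  rw [S.conj_f] at h
  have h0 := congrFun (congrFun h 0) j
  have h1 := congrFun (congrFun h 1) j
  simp [Matrix.mul_apply, Fin.sum_univ_two] at h0 h1
  exact ⟨h0, by rw [h1]; ring⟩

theorem counit_coordMatrix (S : Standardizes g g' e f) (i j : Fin 2) :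
    Bialgebra.counitAlgHom R (CoordRing R) (coordMatrix g g' i j) =
      (1 : Matrix (Fin 2) (Fin 2) R) i j := by
  have h := algHom_map_coordMatrix g g' (Bialgebra.counitAlgHom R (CoordRing R))
  have h1 : (CoordRing.univ R).map (Bialgebra.counitAlgHom R (CoordRing R)) = 1 := by
    ext i j
    exact CoordRing.eval_univ 1 Matrix.det_one i j
  rw [h1, Matrix.mul_one, ← map_algebraMap_mul, S.mul_eq'] at h
  have := congrFun (congrFun h i) j
  simpa using this

theorem det_coordMatrix (S : Standardizes g g' e f) : (coordMatrix g g').det = 1 := by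
  have h : (g'.map (algebraMap R (CoordRing R)) * g.map (algebraMap R (CoordRing R))).det = 1 := by
    rw [← map_algebraMap_mul, S.mul_eq']
    simp
  rw [coordMatrix, Matrix.det_mul, Matrix.det_mul, CoordRing.det_univ, mul_one, ← Matrix.det_mul, h]

theorem adjoin_coordMatrix (S : Standardizes g g' e f) :
    Algebra.adjoin R (Set.range fun ij : Fin 2 × Fin 2 => coordMatrix g g' ij.1 ij.2) = ⊤ := by
  set B := Algebra.adjoin R (Set.range fun ij : Fin 2 × Fin 2 => coordMatrix g g' ij.1 ij.2) with hB
  have h : CoordRing.univ R = g.map (algebraMap R (CoordRing R)) * coordMatrix g g' *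
      g'.map (algebraMap R (CoordRing R)) := by
    have h3 : g.map (algebraMap R (CoordRing R)) * g'.map (algebraMap R (CoordRing R)) = 1 := by
      rw [← map_algebraMap_mul, S.mul_eq]
      simp
    rw [coordMatrix, ← Matrix.mul_assoc, ← Matrix.mul_assoc, h3, Matrix.one_mul, Matrix.mul_assoc,
      h3, Matrix.mul_one]
  have hmem : ∀ i j, CoordRing.univ R i j ∈ B := by
    intro i j
    rw [h, Matrix.mul_apply]
    refine B.sum_mem fun k _ => B.mul_mem ?_ (B.algebraMap_mem _)
    rw [Matrix.mul_apply]
    exact B.sum_mem fun l _ => B.mul_mem (B.algebraMap_mem _)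
      (Algebra.subset_adjoin ⟨(l, k), rfl⟩)
  let φ : CoordRing R →ₐ[R] B := CoordRing.eval (Matrix.of fun i j => ⟨CoordRing.univ R i j, hmem i j⟩) (by
    apply Subtype.ext
    have := CoordRing.det_univ R
    rw [Matrix.det_fin_two] at this ⊢
    exact this)
  have hφ : B.val.comp φ = AlgHom.id R (CoordRing R) := by
    ext i j
    rw [AlgHom.comp_apply, CoordRing.eval_univ]
    rfl
  rw [eq_top_iff]
  intro x _
  have := DFunLike.congr_fun hφ x
  change ((φ x : B) : CoordRing R) = x at this
  rw [← this]
  exact (φ x).2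

end Standardizes

/-- The new basis consists of a nonzero vector v in the image of e and of w = fv: then ev = 0, ew =
v, fv = w and fw = 0. -/
theorem exists_standardizes {p : ℕ} [Fact p.Prime] (hp : 3 ≤ p)
    {h e f : sl (Fin 2) (ZMod p)} (ht : IsSl2Triple h e f) :
    ∃ g g' : Matrix (Fin 2) (Fin 2) (ZMod p), Standardizes g g' e f := by
  have sq_zero : ∀ x : sl (Fin 2) (ZMod p), x.1.det = 0 → x.1 * x.1 = 0 := by
    intro x hx
    have htr : x.1 0 0 + x.1 1 1 = 0 := by
      have h : Matrix.trace x.1 = 0 := x.2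
      rwa [Matrix.trace_fin_two] at h
    rw [Matrix.det_fin_two] at hx
    ext i j
    fin_cases i <;> fin_cases j <;> simp [Matrix.mul_apply, Fin.sum_univ_two]
    · linear_combination x.1 0 0 * htr - hx
    · linear_combination x.1 0 1 * htr
    · linear_combination x.1 1 0 * htr
    · linear_combination x.1 1 1 * htr - hx
  have h2 : (2 : ZMod p) ≠ 0 := by
    intro h0
    have h1 : ((2 : ℕ) : ZMod p) = 0 := by exact_mod_cast h0
    rw [ZMod.natCast_eq_zero_iff] at h1
    have := Nat.le_of_dvd (by norm_num) h1
    omega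
  have he2 := sq_zero e (det_eq_zero_of_triple hp ht)
  have hf2 := sq_zero f (det_eq_zero_of_triple hp ht.symm)
  have hh : h.1 = e.1 * f.1 - f.1 * e.1 := by
    rw [← LieAlgebra.SpecialLinear.sl_bracket, ht.lie_e_f]
  -- As e² = 0, the commutator of ef - fe with e is 2efe; it equals 2e, and 2 is invertible.
  have hefe : e.1 * f.1 * e.1 = e.1 := by
    have hb : h.1 * e.1 - e.1 * h.1 = (2 : ZMod p) • e.1 := by
      rw [← LieAlgebra.SpecialLinear.sl_bracket, ht.lie_h_e_smul (ZMod p)]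
      rfl
    rw [hh, Matrix.sub_mul, Matrix.mul_sub, Matrix.mul_assoc f.1, he2, ← Matrix.mul_assoc e.1 e.1,
      he2, ← Matrix.mul_assoc, Matrix.mul_zero, Matrix.zero_mul, sub_zero, zero_sub, sub_neg_eq_add,
      ← two_smul (ZMod p)] at hb
    exact smul_right_injective _ h2 hb
  have he0 : e.1 ≠ 0 := fun h0 => ht.e_ne_zero (Subtype.ext h0)
  obtain ⟨i, j, hij⟩ : ∃ i j, e.1 i j ≠ 0 := by
    by_contra! hc
    exact he0 (Matrix.ext hc)
  let v : Fin 2 → ZMod p := e.1.mulVec (Pi.single j 1)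
  let w : Fin 2 → ZMod p := f.1.mulVec v
  have hv : v ≠ 0 := fun h0 => hij (by simpa [v] using congrFun h0 i)
  have hev : e.1.mulVec v = 0 := by
    rw [Matrix.mulVec_mulVec, he2, Matrix.zero_mulVec]
  have hfw : f.1.mulVec w = 0 := by
    rw [Matrix.mulVec_mulVec, hf2, Matrix.zero_mulVec]
  have hew : e.1.mulVec w = v := by
    simp only [w, v, Matrix.mulVec_mulVec]
    rw [← Matrix.mul_assoc, hefe]
  let g : Matrix (Fin 2) (Fin 2) (ZMod p) := Matrix.of fun a b => if b = 0 then v a else w a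
  have hg : IsUnit g := by
    rw [← Matrix.mulVec_injective_iff_isUnit]
    refine (injective_iff_map_eq_zero g.mulVecLin).2 fun c hc => ?_
    have hc' : c 0 • v + c 1 • w = 0 := by
      rw [← hc]
      ext a
      simp [g, Matrix.mulVec, dotProduct, Fin.sum_univ_two, mul_comm]
    have h1 := congrArg e.1.mulVec hc'
    rw [Matrix.mulVec_add, Matrix.mulVec_smul, Matrix.mulVec_smul, hev, hew, smul_zero, zero_add,
      Matrix.mulVec_zero, smul_eq_zero, or_iff_left hv] at h1
    rw [h1, zero_smul, add_zero, smul_eq_zero, or_iff_left hv] at hc'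
    ext a
    fin_cases a
    · exact hc'
    · exact h1
  obtain ⟨u, hu⟩ := hg
  have hgu : g * (u⁻¹).1 = 1 := by rw [← hu]; exact u.mul_inv
  have hug : (u⁻¹).1 * g = 1 := by rw [← hu]; exact u.inv_mul
  have hE : e.1 * g = g * !![0, 1; 0, 0] := by
    ext a b
    have h1 := congrFun hev a
    have h2 := congrFun hew a
    simp only [Matrix.mulVec, dotProduct, Fin.sum_univ_two] at h1 h2
    fin_cases b <;> simp [g, Matrix.mul_apply, Fin.sum_univ_two, h1, h2]
  have hF : f.1 * g = g * !![0, 0; 1, 0] := by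
    ext a b
    have h1 := congrFun hfw a
    have h2 : f.1.mulVec v a = w a := rfl
    simp only [Matrix.mulVec, dotProduct, Fin.sum_univ_two] at h1 h2
    fin_cases b <;> simp [g, Matrix.mul_apply, Fin.sum_univ_two, h1, h2]
  exact ⟨g, (u⁻¹).1, hgu, hug, by rw [Matrix.mul_assoc, hE, ← Matrix.mul_assoc, hug, Matrix.one_mul],
    by rw [Matrix.mul_assoc, hF, ← Matrix.mul_assoc, hug, Matrix.one_mul]⟩

end Functionals

/-! ### Eliminating d: distributions are determined by monomials in a, b, c -/

section Separation

open LieAlgebra.SpecialLinear (sl)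

variable {p : ℕ} [Fact p.Prime] {g g' : Matrix (Fin 2) (Fin 2) (ZMod p)}
  {e f : sl (Fin 2) (ZMod p)}

/-- The monomials in all the coordinates but the last one. -/
def coordMonomial (g g' : Matrix (Fin 2) (Fin 2) (ZMod p)) (i j k : ℕ) : CoordRing (ZMod p) :=
  coordMatrix g g' 0 0 ^ i * coordMatrix g g' 0 1 ^ j * coordMatrix g g' 1 0 ^ k

instance : CharP (CoordRing (ZMod p)) p :=
  haveI : Nontrivial (CoordRing (ZMod p)) :=
    (Bialgebra.counitAlgHom (ZMod p) (CoordRing (ZMod p))).toRingHom.domain_nontrivial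
  charP_of_injective_algebraMap (algebraMap (ZMod p) (CoordRing (ZMod p))).injective p

/-- The coordinate ring is spanned by the monomials in three of the coordinates, up to any given
power of the augmentation ideal. -/
theorem Standardizes.span_coordMonomial_sup (S : Standardizes g g' e f) (n : ℕ) :
    Submodule.span (ZMod p) (Set.range fun m : ℕ × ℕ × ℕ => coordMonomial g g' m.1 m.2.1 m.2.2) ⊔
      (augIdeal (ZMod p) (CoordRing (ZMod p)) ^ n).restrictScalars (ZMod p) = ⊤ := by
  set W₀ := Submodule.span (ZMod p)
    (Set.range fun m : ℕ × ℕ × ℕ => coordMonomial g g' m.1 m.2.1 m.2.2) with hW₀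
  set I := augIdeal (ZMod p) (CoordRing (ZMod p)) with hI
  have hmem : ∀ i j k, coordMonomial g g' i j k ∈ W₀ := fun i j k =>
    Submodule.subset_span ⟨(i, j, k), rfl⟩
  have hstable : ∀ y : CoordRing (ZMod p), (∀ i j k, y * coordMonomial g g' i j k ∈ W₀) →
      ∀ x ∈ W₀, y * x ∈ W₀ := by
    intro y hy x hx
    induction hx using Submodule.span_induction with
    | mem x hx =>
      obtain ⟨m, rfl⟩ := hx
      exact hy _ _ _
    | zero => simp
    | add x z _ _ hx hz => rw [mul_add]; exact W₀.add_mem hx hz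
    | smul c x _ hx => rw [mul_smul_comm]; exact W₀.smul_mem c hx
  set a := coordMatrix g g' 0 0 with ha
  set b := coordMatrix g g' 0 1 with hb
  set c := coordMatrix g g' 1 0 with hc
  set d := coordMatrix g g' 1 1 with hd
  have hA : ∀ x ∈ W₀, a * x ∈ W₀ := hstable a fun i j k => by
    convert hmem (i + 1) j k using 1
    rw [coordMonomial, coordMonomial]
    ring
  have hB : ∀ x ∈ W₀, b * x ∈ W₀ := hstable b fun i j k => by
    convert hmem i (j + 1) k using 1
    rw [coordMonomial, coordMonomial]
    ring
  have hC : ∀ x ∈ W₀, c * x ∈ W₀ := hstable c fun i j k => by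
    convert hmem i j (k + 1) using 1
    rw [coordMonomial, coordMonomial]
    ring
  have hdet : a * d = 1 + b * c := by
    have := S.det_coordMatrix
    rw [Matrix.det_fin_two] at this
    linear_combination this
  -- A power of p is taken so that Frobenius gives 1 - a^(p^K) = (1 - a)^(p^K), which lies in I^n.
  obtain ⟨K, hK⟩ : ∃ K, n ≤ p ^ K :=
    ⟨n, (Nat.lt_pow_self (Fact.out : p.Prime).one_lt).le⟩
  have hq : 0 < p ^ K := pow_pos (Fact.out : p.Prime).pos K
  have hI1 : 1 - a ^ p ^ K ∈ I ^ n := by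
    have h1 : 1 - a ^ p ^ K = (1 - a) ^ p ^ K := by
      rw [sub_pow_char_pow, one_pow]
    rw [h1]
    refine Ideal.pow_le_pow_right hK (Ideal.pow_mem_pow ?_ _)
    rw [hI, augIdeal, RingHom.mem_ker, map_sub, map_one, ha, S.counit_coordMatrix]
    simp
  have hsup : ∀ y : CoordRing (ZMod p),
      (∀ x ∈ W₀, y * x ∈ W₀ ⊔ (I ^ n).restrictScalars (ZMod p)) →
      ∀ x ∈ W₀ ⊔ (I ^ n).restrictScalars (ZMod p),
        y * x ∈ W₀ ⊔ (I ^ n).restrictScalars (ZMod p) := by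
    intro y hy x hx
    obtain ⟨w, hw, z, hz, rfl⟩ := Submodule.mem_sup.1 hx
    rw [mul_add]
    exact add_mem (hy w hw) (Submodule.mem_sup_right (Ideal.mul_mem_left _ y hz))
  have hD : ∀ x ∈ W₀, d * x ∈ W₀ ⊔ (I ^ n).restrictScalars (ZMod p) := by
    intro x hx
    have h1 : ∀ m : ℕ, ∀ x ∈ W₀, a ^ m * x ∈ W₀ := by
      intro m
      induction m with
      | zero => simp
      | succ m ih =>
        intro x hx
        rw [pow_succ, mul_assoc]
        exact ih _ (hA x hx)
    -- Modulo I^n the inverse of a is a^(p^K - 1), and ad = 1 + bc; so d agrees with a^(p^K - 1) (1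
    -- + bc).
    have h2 : d * x = a ^ (p ^ K - 1) * (x + b * (c * x)) + (1 - a ^ p ^ K) * (d * x) := by
      have h3 : a ^ p ^ K = a ^ (p ^ K - 1) * a := by
        rw [← pow_succ, Nat.sub_add_cancel hq]
      rw [h3]
      linear_combination (a ^ (p ^ K - 1) * x) * hdet
    rw [h2]
    exact add_mem (Submodule.mem_sup_left (h1 _ _ (add_mem hx (hB _ (hC _ hx)))))
      (Submodule.mem_sup_right (Ideal.mul_mem_right _ _ hI1))
  rw [eq_top_iff]
  rintro y -
  have hy : y ∈ Algebra.adjoin (ZMod p)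
      (Set.range fun ij : Fin 2 × Fin 2 => coordMatrix g g' ij.1 ij.2) := by
    rw [S.adjoin_coordMatrix]
    trivial
  have key : ∀ x ∈ W₀ ⊔ (I ^ n).restrictScalars (ZMod p),
      y * x ∈ W₀ ⊔ (I ^ n).restrictScalars (ZMod p) := by
    induction hy using Algebra.adjoin_induction with
    | mem y hy =>
      obtain ⟨⟨i, j⟩, rfl⟩ := hy
      apply hsup
      fin_cases i <;> fin_cases j
      · exact fun x hx => Submodule.mem_sup_left (hA x hx)
      · exact fun x hx => Submodule.mem_sup_left (hB x hx)
      · exact fun x hx => Submodule.mem_sup_left (hC x hx)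
      · exact hD
    | algebraMap r =>
      intro x hx
      rw [← Algebra.smul_def]
      exact Submodule.smul_mem _ r hx
    | add y z _ _ hy hz =>
      intro x hx
      rw [add_mul]
      exact add_mem (hy x hx) (hz x hx)
    | mul y z _ _ hy hz =>
      intro x hx
      rw [mul_assoc]
      exact hy _ (hz x hx)
  have := key 1 (Submodule.mem_sup_left (by simpa [coordMonomial] using hmem 0 0 0))
  rwa [mul_one] at this

/-- A distribution is determined by its values on the monomials in three of the coordinates. -/
theorem Standardizes.ext_coordMonomial (S : Standardizes g g' e f) {μ ν : DistSL2 (ZMod p)}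
    (h : ∀ i j k, μ.1 (coordMonomial g g' i j k) = ν.1 (coordMonomial g g' i j k)) : μ = ν := by
  obtain ⟨n, hn⟩ := (μ - ν).2
  have hsub : ∀ φ, (μ - ν).1 φ = μ.1 φ - ν.1 φ := fun φ => rfl
  apply Subtype.ext
  apply WithConv.ext
  apply LinearMap.ext
  intro φ
  have hφ : φ ∈ (⊤ : Submodule (ZMod p) (CoordRing (ZMod p))) := trivial
  rw [← S.span_coordMonomial_sup n] at hφ
  obtain ⟨w, hw, z, hz, rfl⟩ := Submodule.mem_sup.1 hφ
  suffices (μ - ν).1 (w + z) = 0 from sub_eq_zero.1 ((hsub _).symm.trans this)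
  have hz' : (μ - ν).1 z = 0 := hn z hz
  have hw' : (μ - ν).1 w = 0 := by
    change (μ - ν).1.ofConv w = 0
    have : Submodule.span (ZMod p)
        (Set.range fun m : ℕ × ℕ × ℕ => coordMonomial g g' m.1 m.2.1 m.2.2) ≤
        LinearMap.ker (μ - ν).1.ofConv := by
      rw [Submodule.span_le]
      rintro _ ⟨m, rfl⟩
      exact sub_eq_zero.2 (h _ _ _)
    exact this hw
  change (μ - ν).1.ofConv (w + z) = 0
  rw [map_add]
  change (μ - ν).1 w + (μ - ν).1 z = 0
  rw [hw', hz', add_zero]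

end Separation

/-! ### Coefficients of (1 + xy)^i x^j y^k -/

section Values

open Polynomial

theorem coeff_C_add_C_mul_X_pow {D : Type*} [CommRing D] (u v : D) (j n : ℕ) :
    ((C u + C v * X) ^ j).coeff n = u ^ (j - n) * v ^ n * (j.choose n : D) := by
  rw [add_comm, add_pow, Polynomial.finsetSum_coeff]
  have h2 : ∀ m, ((C v * X) ^ m * C u ^ (j - m) * (j.choose m : D[X])).coeff n =
      if m = n then u ^ (j - n) * v ^ n * (j.choose n : D) else 0 := by
    intro m
    have : (C v * X) ^ m * C u ^ (j - m) * (j.choose m : D[X]) =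
        C (u ^ (j - m) * v ^ m * (j.choose m : D)) * X ^ m := by
      simp only [mul_pow, map_mul, map_pow, map_natCast]
      ring
    rw [this, coeff_C_mul_X_pow]
    by_cases h : n = m
    · subst h; simp
    · rw [if_neg h, if_neg (Ne.symm h)]
  simp only [h2, Finset.sum_ite_eq', Finset.mem_range]
  split_ifs with h3
  · rfl
  · rw [Nat.choose_eq_zero_of_lt (by omega)]
    simp

/-- The values of `x ^ m y ^ n`-coefficients on `(1 + x y) ^ i x ^ j y ^ k`. -/
def hookCoeff (D : Type*) [CommRing D] (m n i j k : ℕ) : D :=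
  if k ≤ n ∧ m + k = n + j then (i.choose (n - k) : D) else 0

theorem coeff_coeff_hook {D : Type*} [CommRing D] (m n i j k : ℕ) :
    (((1 + C X * X) ^ i * (C X) ^ j * X ^ k : D[X][X]).coeff n).coeff m =
      hookCoeff D m n i j k := by
  rw [Polynomial.coeff_mul_X_pow', hookCoeff]
  by_cases hk : k ≤ n
  · have h1 : (1 : D[X][X]) = C 1 := by simp
    rw [if_pos hk, ← map_pow, coeff_mul_C, h1, coeff_C_add_C_mul_X_pow, one_pow, one_mul]
    have h2 : (X : D[X]) ^ (n - k) * (i.choose (n - k) : D[X]) * X ^ j =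
        C (i.choose (n - k) : D) * X ^ (n - k + j) := by
      rw [map_natCast]
      ring
    rw [h2, coeff_C_mul_X_pow]
    exact if_congr (by omega) rfl rfl
  · rw [if_neg hk, if_neg (by tauto), coeff_zero]

end Values

/-! ### Values of products of divided powers on monomials -/

section Values

open LieAlgebra.SpecialLinear (sl)
open Polynomial (X C)

/-- The monomials in all the coordinates but the last one, multiplied with a power of `a - 1`,
where `a` is the first coordinate. -/
def shiftedMonomial {p : ℕ} (g g' : Matrix (Fin 2) (Fin 2) (ZMod p)) (i s j k : ℕ) : CoordRing (ZMod p) :=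
  (coordMatrix g g' 0 0 - 1) ^ i * coordMatrix g g' 0 0 ^ s * coordMatrix g g' 0 1 ^ j *
    coordMatrix g g' 1 0 ^ k

theorem shiftedMonomial_zero {p : ℕ} (g g' : Matrix (Fin 2) (Fin 2) (ZMod p)) (s j k : ℕ) :
    shiftedMonomial g g' 0 s j k = coordMonomial g g' s j k := by
  rw [shiftedMonomial, pow_zero, one_mul, coordMonomial]

variable {p : ℕ} [Fact p.Prime] {g g' : Matrix (Fin 2) (Fin 2) (ZMod p)}
  {e f : sl (Fin 2) (ZMod p)}

namespace Standardizes

theorem e_apply (S : Standardizes g g' e f) (he : e.1.det = 0) (m i j k : ℕ) :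
    (dividedPow e he m).1 (coordMonomial g g' i j k) = if j = m ∧ k = 0 then 1 else 0 := by
  have h := represents_one.mul_dividedPow e he m
  rw [one_mul] at h
  rw [h, coordMonomial]
  simp only [map_mul, map_pow, (S.mulExp_e _ he _).1, (S.mulExp_e _ he _).2, S.counit_coordMatrix]
  by_cases hk : k = 0 <;>
    simp [hk, Polynomial.coeff_X_pow, eq_comm]

/-- The matrix exp(xe) exp(yf) has first row (1 + xy, x) and lower left entry y, so (a - 1)^i
contributes (xy)^i to the generating function. The inner variable is x, the outer one y. -/
theorem e_mul_f_apply_shifted (S : Standardizes g g' e f) (he : e.1.det = 0) (hf : f.1.det = 0)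
    (m n i s j k : ℕ) :
    (dividedPow e he m * dividedPow f hf n).1 (shiftedMonomial g g' i s j k) =
      hookCoeff (ZMod p) m n s (i + j) (i + k) := by
  have h := (represents_one.mul_dividedPow e he m).mul_dividedPow f hf n
  rw [one_mul] at h
  have h1 : mulExp (mulExp (Bialgebra.counitAlgHom (ZMod p) (CoordRing (ZMod p))) e he) f hf
      (shiftedMonomial g g' i s j k) =
      (1 + C X * X) ^ s * (C X) ^ (i + j) * X ^ (i + k) := by
    have ha : mulExp (mulExp (Bialgebra.counitAlgHom (ZMod p) (CoordRing (ZMod p))) e he) f hf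
        (coordMatrix g g' 0 0) = 1 + C X * X := by
      simp [(S.mulExp_e _ he _).1, (S.mulExp_e _ he _).2, S.counit_coordMatrix,
        (S.mulExp_f _ hf _).1]
    have hb : mulExp (mulExp (Bialgebra.counitAlgHom (ZMod p) (CoordRing (ZMod p))) e he) f hf
        (coordMatrix g g' 0 1) = C X := by
      simp [(S.mulExp_e _ he _).2, S.counit_coordMatrix, (S.mulExp_f _ hf _).2]
    have hc : mulExp (mulExp (Bialgebra.counitAlgHom (ZMod p) (CoordRing (ZMod p))) e he) f hf
        (coordMatrix g g' 1 0) = X := by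
      simp [(S.mulExp_e _ he _).1, (S.mulExp_e _ he _).2, S.counit_coordMatrix,
        (S.mulExp_f _ hf _).1]
    rw [shiftedMonomial, map_mul, map_mul, map_mul, map_pow, map_pow, map_pow, map_pow, map_sub,
      map_one, ha, hb, hc]
    generalize (C X : (ZMod p)[X][X]) = u
    ring
  rw [h, h1]
  exact coeff_coeff_hook _ _ _ _ _

theorem e_mul_f_apply (S : Standardizes g g' e f) (he : e.1.det = 0) (hf : f.1.det = 0)
    (m n i j k : ℕ) :
    (dividedPow e he m * dividedPow f hf n).1 (coordMonomial g g' i j k) =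
      hookCoeff (ZMod p) m n i j k := by
  rw [← shiftedMonomial_zero, S.e_mul_f_apply_shifted, zero_add, zero_add]

/-- Right multiplication by exp(te) fixes a and c and sends b to b + ta; the coordinate d does not
enter. -/
theorem mul_e_apply_shifted (S : Standardizes g g' e f) (he : e.1.det = 0) (l : ℕ)
    (μ : DistSL2 (ZMod p)) (i s j k : ℕ) :
    (μ * dividedPow e he l).1 (shiftedMonomial g g' i s j k) =
      (j.choose l : ZMod p) * μ.1 (shiftedMonomial g g' i (s + l) (j - l) k) := by
  rw [mul_dividedPow_apply]
  have h : (mulExp (AlgHom.id (ZMod p) (CoordRing (ZMod p))) e he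
      (shiftedMonomial g g' i s j k)).coeff l =
      (j.choose l : ZMod p) • shiftedMonomial g g' i (s + l) (j - l) k := by
    rw [shiftedMonomial, map_mul, map_mul, map_mul, map_pow, map_pow, map_pow, map_pow, map_sub,
      map_one, (S.mulExp_e _ he _).1, (S.mulExp_e _ he _).2, (S.mulExp_e _ he _).1, ← map_one C,
      ← map_sub C, ← map_pow C _ s, ← map_pow C _ k, ← map_pow C _ i, ← map_mul C,
      Polynomial.coeff_mul_C, Polynomial.coeff_C_mul, coeff_C_add_C_mul_X_pow, shiftedMonomial,
      Algebra.smul_def, map_natCast]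
    simp only [AlgHom.id_apply]
    ring
  rw [h]
  exact map_smul μ.1.ofConv _ _

theorem mul_e_apply (S : Standardizes g g' e f) (he : e.1.det = 0) (l : ℕ)
    (μ : DistSL2 (ZMod p)) (i j k : ℕ) :
    (μ * dividedPow e he l).1 (coordMonomial g g' i j k) =
      (j.choose l : ZMod p) * μ.1 (coordMonomial g g' (i + l) (j - l) k) := by
  rw [← shiftedMonomial_zero, S.mul_e_apply_shifted, shiftedMonomial_zero]

/-- Left multiplication by exp(tf) fixes a and b and sends c to c + ta; again d does not enter. -/
theorem f_mul_apply_shifted (S : Standardizes g g' e f) (hf : f.1.det = 0) (l : ℕ)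
    (μ : DistSL2 (ZMod p)) (i s j k : ℕ) :
    (dividedPow f hf l * μ).1 (shiftedMonomial g g' i s j k) =
      (k.choose l : ZMod p) * μ.1 (shiftedMonomial g g' i (s + l) j (k - l)) := by
  rw [dividedPow_mul_apply]
  have h : (expMul f hf (shiftedMonomial g g' i s j k)).coeff l =
      (k.choose l : ZMod p) • shiftedMonomial g g' i (s + l) j (k - l) := by
    rw [shiftedMonomial, map_mul, map_mul, map_mul, map_pow, map_pow, map_pow, map_pow, map_sub,
      map_one, (S.expMul_f hf _).1, (S.expMul_f hf _).1, (S.expMul_f hf _).2, ← map_one C,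
      ← map_sub C, ← map_pow C _ s, ← map_pow C _ j, ← map_pow C _ i, ← map_mul C, ← map_mul C,
      Polynomial.coeff_C_mul, coeff_C_add_C_mul_X_pow, shiftedMonomial, Algebra.smul_def,
      map_natCast]
    ring
  rw [h]
  exact map_smul μ.1.ofConv _ _

theorem f_mul_apply (S : Standardizes g g' e f) (hf : f.1.det = 0) (l : ℕ)
    (μ : DistSL2 (ZMod p)) (i j k : ℕ) :
    (dividedPow f hf l * μ).1 (coordMonomial g g' i j k) =
      (k.choose l : ZMod p) * μ.1 (coordMonomial g g' (i + l) j (k - l)) := by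
  rw [← shiftedMonomial_zero, S.f_mul_apply_shifted, shiftedMonomial_zero]

theorem f_mul_e_apply (S : Standardizes g g' e f) (he : e.1.det = 0) (hf : f.1.det = 0)
    (m n i j k : ℕ) :
    (dividedPow f hf n * dividedPow e he m).1 (coordMonomial g g' i j k) =
      if j = m ∧ k = n then 1 else 0 := by
  rw [S.f_mul_apply, S.e_apply]
  rcases lt_trichotomy k n with h | rfl | h
  · simp [Nat.choose_eq_zero_of_lt h, h.ne]
  · simp
  · rw [if_neg (fun hh => by omega), if_neg (fun hh => h.ne' hh.2), mul_zero]

end Standardizes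
end Values

/-! ### Lucas' theorem for blocks of digits -/

section Lucas

variable {p : ℕ} [Fact p.Prime]

/-- Lucas' theorem, splitting off the last `k` digits. -/
theorem cast_choose_pow_mul_add (k A B : ℕ) {a b : ℕ} (ha : a < p ^ k) (hb : b < p ^ k) :
    (((p ^ k * A + a).choose (p ^ k * B + b) : ℕ) : ZMod p) = A.choose B * a.choose b := by
  have hp : 0 < p := (Fact.out : p.Prime).pos
  have lucas : ∀ n m : ℕ, ((n.choose m : ℕ) : ZMod p) =
      (n % p).choose (m % p) * (n / p).choose (m / p) := by
    intro n m
    have := (ZMod.natCast_eq_natCast_iff _ _ _).2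
      (Choose.choose_modEq_choose_mod_mul_choose_div_nat (n := n) (k := m) (p := p))
    rw [this, Nat.cast_mul]
  induction k generalizing a b with
  | zero =>
    obtain rfl : a = 0 := by simpa using ha
    obtain rfl : b = 0 := by simpa using hb
    simp
  | succ k ih =>
    have h (A a : ℕ) : (p ^ (k + 1) * A + a) % p = a % p ∧
        (p ^ (k + 1) * A + a) / p = p ^ k * A + a / p := by
      have : p ^ (k + 1) * A + a = a + p * (p ^ k * A) := by ring
      rw [this, Nat.add_mul_mod_self_left, Nat.add_mul_div_left _ _ hp, add_comm]
      exact ⟨rfl, rfl⟩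
    rw [pow_succ] at ha hb
    rw [lucas, (h A a).1, (h A a).2, (h B b).1, (h B b).2,
      ih (Nat.div_lt_of_lt_mul (by rwa [mul_comm])) (Nat.div_lt_of_lt_mul (by rwa [mul_comm])),
      lucas a b]
    ring

end Lucas

/-! ### The basic commutation formula -/

section Commutator

/-- Used with x = e^(q), y = f^(q), u = e^(q(s+1)), v = e^(qs). The hypothesis is the commutator
formula with yxv replaced by (s + 1) yu; the products left over are those whose values on monomials
are known. -/
theorem lie_eq_sub_natCast_mul {F B : Type*} [Field F] [Ring B] [Algebra F B] {x y u v : B}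
    {s : ℕ} (hu : x * v = (s + 1 : F) • u)
    (h : u * y + (s : F) • (y * u) + (s : F) • v = x * y * v) :
    ⁅u, y⁆ = (⁅x, y⁆ - (s : B)) * v := by
  rw [Ring.lie_def, Ring.lie_def, sub_mul, sub_mul, ← h, mul_assoc _ _ v,
    hu, mul_smul_comm, add_smul, one_smul, ← nsmul_eq_mul, Nat.cast_smul_eq_nsmul,
    Nat.cast_smul_eq_nsmul]
  abel

open LieAlgebra.SpecialLinear (sl)

variable {p : ℕ} [Fact p.Prime] {g g' : Matrix (Fin 2) (Fin 2) (ZMod p)}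
  {e f : sl (Fin 2) (ZMod p)}

theorem Standardizes.commutator_eq (S : Standardizes g g' e f) (he : e.1.det = 0)
    (hf : f.1.det = 0) (k s : ℕ) :
    ⁅dividedPow e he (p ^ k * (s + 1)), dividedPow f hf (p ^ k)⁆ =
      (⁅dividedPow e he (p ^ k), dividedPow f hf (p ^ k)⁆ - (s : DistSL2 (ZMod p))) *
        dividedPow e he (p ^ k * s) := by
  set q := p ^ k with hq
  have hq0 : 0 < q := pow_pos (Fact.out : p.Prime).pos k
  have hs : dividedPow e he q * dividedPow e he (q * s) =
      (s + 1 : ZMod p) • dividedPow e he (q * (s + 1)) := by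
    have h1 := cast_choose_pow_mul_add (p := p) k (s + 1) 1 (a := 0) (b := 0) hq0 hq0
    rw [← hq] at h1
    simp only [add_zero, mul_one, Nat.choose_one_right, Nat.choose_zero_right, Nat.cast_one,
      Nat.cast_add] at h1
    rw [dividedPow_mul, add_comm, ← h1, Nat.cast_smul_eq_nsmul]
    congr 2
  suffices h : dividedPow e he (q * (s + 1)) * dividedPow f hf q +
      (s : ZMod p) • (dividedPow f hf q * dividedPow e he (q * (s + 1))) +
      (s : ZMod p) • dividedPow e he (q * s) =
      dividedPow e he q * dividedPow f hf q * dividedPow e he (q * s) by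
    exact lie_eq_sub_natCast_mul hs h
  apply S.ext_coordMonomial
  intro i j l
  have hadd (μ ν : DistSL2 (ZMod p)) (φ) : (μ + ν).1 φ = μ.1 φ + ν.1 φ := rfl
  have hsmul (c : ZMod p) (μ : DistSL2 (ZMod p)) (φ) : (c • μ).1 φ = c * μ.1 φ := rfl
  rw [hadd, hadd, hsmul, hsmul, S.e_mul_f_apply, S.f_mul_e_apply, S.e_apply, S.mul_e_apply,
    S.e_mul_f_apply]
  have e1 : q * (s + 1) = q * s + q := by ring
  -- Elsewhere both sides vanish. Here the claim is C(i, q-l) + s[l = q] + s[l = 0] = C(qs+l, qs)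
  -- C(i+qs, q-l) modulo p. By Lucas: for l = 0 the digit i/q grows by s; for 0 < l < q only i mod q
  -- matters and C(qs+l, qs) is 1; for l = q the first factor on the right is s + 1.
  by_cases hjl : l ≤ q ∧ j = q * s + l
  · obtain ⟨hl, rfl⟩ := hjl
    have H1 : hookCoeff (ZMod p) (q * (s + 1)) q i (q * s + l) l = i.choose (q - l) :=
      if_pos ⟨hl, by rw [e1]; ring⟩
    have H2 : hookCoeff (ZMod p) q q (i + q * s) (q * s + l - q * s) l =
        (i + q * s).choose (q - l) := if_pos ⟨hl, by omega⟩
    rw [H1, H2]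
    have h2 := Nat.mod_add_div i q
    have hr : i % q < q := Nat.mod_lt _ hq0
    have h5 : i % q + q * (i / q + s) = i + q * s := by
      rw [mul_add, ← add_assoc, h2]
    rcases hl.lt_or_eq with hlq | rfl
    · have h1 := cast_choose_pow_mul_add (p := p) k s s (a := l) (b := 0) hlq hq0
      rw [← hq] at h1
      simp only [add_zero, Nat.choose_self, Nat.choose_zero_right, Nat.cast_one, mul_one] at h1
      have c1 : ¬ (q * s + l = q * (s + 1) ∧ l = q) := fun hh => hlq.ne hh.2
      rw [h1, one_mul, if_neg c1, mul_zero, add_zero]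
      rcases Nat.eq_zero_or_pos l with rfl | hl0
      · have h3 := cast_choose_pow_mul_add (p := p) k (i / q) 1 hr hq0
        have h4 := cast_choose_pow_mul_add (p := p) k (i / q + s) 1 hr hq0
        rw [← hq, add_comm _ (i % q), mul_one, add_zero] at h3 h4
        rw [h2] at h3
        rw [h5] at h4
        rw [Nat.sub_zero, h3, h4]
        simp
      · have hlt : q - l < q := by omega
        have h3 := cast_choose_pow_mul_add (p := p) k (i / q) 0 hr hlt
        have h4 := cast_choose_pow_mul_add (p := p) k (i / q + s) 0 hr hlt
        rw [← hq, add_comm _ (i % q), mul_zero, zero_add] at h3 h4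
        rw [h2] at h3
        rw [h5] at h4
        have c2 : ¬ (q * s + l = q * s ∧ l = 0) := fun hh => hl0.ne' hh.2
        rw [if_neg c2, h3, h4]
        simp
    · have h1 := cast_choose_pow_mul_add (p := p) k (s + 1) s (a := 0) (b := 0) hq0 hq0
      rw [← hq, add_zero, add_zero, e1] at h1
      have c2 : ¬ (q * s + q = q * s ∧ q = 0) := fun hh => hq0.ne' hh.2
      rw [h1, if_pos ⟨e1.symm, rfl⟩, if_neg c2, Nat.sub_self]
      simp [add_comm]
  · have H1 : hookCoeff (ZMod p) (q * (s + 1)) q i j l = 0 := if_neg (by omega)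
    have c1 : ¬ (j = q * (s + 1) ∧ l = q) := by omega
    have c2 : ¬ (j = q * s ∧ l = 0) := by omega
    rw [H1, if_neg c1, if_neg c2]
    rcases lt_or_ge j (q * s) with hj | hj
    · simp [Nat.choose_eq_zero_of_lt hj]
    · have H2 : hookCoeff (ZMod p) q q (i + q * s) (j - q * s) l = 0 := if_neg (by omega)
      rw [H2]
      simp

end Commutator

/-! ### A polynomial identity behind X^p = X -/

section ArtinSchreier

variable {p : ℕ} [Fact p.Prime]

theorem prod_range_natCast_zmod {M : Type*} [CommMonoid M] (φ : ZMod p → M) :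
    ∏ c ∈ Finset.range p, φ c = ∏ a : ZMod p, φ a := by
  refine Finset.prod_nbij' (fun c : ℕ => (c : ZMod p)) ZMod.val (fun _ _ => Finset.mem_univ _)
    (fun a _ => Finset.mem_range.2 (ZMod.val_lt a)) (fun c hc => ?_) (fun a _ => ?_)
    (fun _ _ => rfl)
  · exact ZMod.val_cast_of_lt (Finset.mem_range.1 hc)
  · exact ZMod.natCast_zmod_val a

theorem sum_range_natCast_zmod {M : Type*} [AddCommMonoid M] (φ : ZMod p → M) :
    ∑ c ∈ Finset.range p, φ c = ∑ a : ZMod p, φ a :=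
  prod_range_natCast_zmod (M := Multiplicative M) φ

open Polynomial in
theorem prod_X_sub_C_zmod : ∏ a : ZMod p, (X - C a) = (X ^ p - X : (ZMod p)[X]) := by
  have hp := (Fact.out : p.Prime).one_lt
  have h1 : (X ^ p - X : (ZMod p)[X]).roots = Finset.univ.val := by
    have := FiniteField.roots_X_pow_card_sub_X (ZMod p)
    rwa [ZMod.card] at this
  have h2 : (X ^ p - X : (ZMod p)[X]).Monic := by
    apply monic_X_pow_sub
    rw [degree_X]
    exact_mod_cast hp
  have h3 := prod_multiset_X_sub_C_of_monic_of_roots_card_eq h2 (by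
    rw [h1, FiniteField.X_pow_card_sub_X_natDegree_eq (ZMod p) hp]
    simp [ZMod.card])
  rw [← h3, h1]
  rfl

variable {T : Type*} [CommRing T] [Algebra (ZMod p) T]

theorem prod_sub_algebraMap (n : T) : ∏ a : ZMod p, (n - algebraMap (ZMod p) T a) = n ^ p - n := by
  have := congrArg (Polynomial.aeval n) (prod_X_sub_C_zmod (p := p))
  simpa [map_prod] using this

/-- The derivative of ∏ (X - a) = X^p - X, evaluated at n. -/
theorem sum_prod_sub_algebraMap (n : T) :
    ∑ i : ZMod p, ∏ a ∈ Finset.univ.erase i, (n - algebraMap (ZMod p) T a) = -1 := by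
  have := congrArg (fun P => Polynomial.aeval n (Polynomial.derivative P))
    (prod_X_sub_C_zmod (p := p))
  simpa [Polynomial.derivative_prod_finset, map_prod, Polynomial.derivative_X_pow] using this

theorem prod_add_algebraMap (s : T) :
    ∏ a : ZMod p, (s + 1 + algebraMap (ZMod p) T a) = s ^ p - s := by
  rw [← prod_sub_algebraMap (p := p) s]
  refine Fintype.prod_equiv (Equiv.subLeft (-1)) _ _ fun a => ?_
  simp only [Equiv.subLeft_apply, map_sub, map_neg, map_one]
  ring

theorem sum_prod_add_algebraMap (s : T) :
    ∑ i : ZMod p, ∏ a ∈ Finset.univ.erase i, (s + 1 + algebraMap (ZMod p) T a) = -1 := by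
  rw [← sum_prod_sub_algebraMap (p := p) s]
  refine Fintype.sum_equiv (Equiv.subLeft (-1)) _ _ fun i => ?_
  refine Finset.prod_equiv (Equiv.subLeft (-1)) (fun a => ?_) fun a _ => ?_
  · simp
  · simp only [Equiv.subLeft_apply, map_sub, map_neg, map_one]
    ring

/-- Each factor splits as (n - c)(s + 1 + c), and the weight is (s + 1 + i) - (n - i). Each of its
two parts completes one of the products over c ≠ i to a full one, namely s^p - s or n^p - n, while
the other product sums to -1. -/
theorem sum_mul_prod_split (hp : CharP T p) (n s : T) :
    ∑ i : ZMod p, ((s - n) + 1 + 2 * algebraMap (ZMod p) T i) * ∏ c ∈ Finset.univ.erase i,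
      (n * (s + 1) - algebraMap (ZMod p) T c * (s - n) -
        algebraMap (ZMod p) T c * (algebraMap (ZMod p) T c + 1)) =
    -((s - n) ^ p - (s - n)) := by
  have hfac : ∀ c : ZMod p, n * (s + 1) - algebraMap (ZMod p) T c * (s - n) -
      algebraMap (ZMod p) T c * (algebraMap (ZMod p) T c + 1) =
      (n - algebraMap (ZMod p) T c) * (s + 1 + algebraMap (ZMod p) T c) := fun c => by ring
  simp only [hfac, Finset.prod_mul_distrib]
  have hterm : ∀ i : ZMod p, ((s - n) + 1 + 2 * algebraMap (ZMod p) T i) *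
      ((∏ c ∈ Finset.univ.erase i, (n - algebraMap (ZMod p) T c)) *
        ∏ c ∈ Finset.univ.erase i, (s + 1 + algebraMap (ZMod p) T c)) =
      (∏ c ∈ Finset.univ.erase i, (n - algebraMap (ZMod p) T c)) * (s ^ p - s) -
      (n ^ p - n) * ∏ c ∈ Finset.univ.erase i, (s + 1 + algebraMap (ZMod p) T c) := by
    intro i
    rw [← prod_add_algebraMap (p := p) s, ← prod_sub_algebraMap (p := p) n,
      ← Finset.mul_prod_erase Finset.univ (fun c => s + 1 + algebraMap (ZMod p) T c)
        (Finset.mem_univ i),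
      ← Finset.mul_prod_erase Finset.univ (fun c => n - algebraMap (ZMod p) T c)
        (Finset.mem_univ i)]
    ring
  rw [Finset.sum_congr rfl fun i _ => hterm i, Finset.sum_sub_distrib, ← Finset.sum_mul,
    ← Finset.mul_sum, sum_prod_sub_algebraMap, sum_prod_add_algebraMap, sub_pow_char]
  ring

/-- The general case reduces to the split one by adjoining a number n with n(x + n + 1) = t and
putting s = x + n. -/
theorem sum_mul_prod_erase (hp : CharP T p) (t x : T) :
    ∑ i : ZMod p, (x + 1 + 2 * algebraMap (ZMod p) T i) * ∏ c ∈ Finset.univ.erase i,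
      (t - algebraMap (ZMod p) T c * x -
        algebraMap (ZMod p) T c * (algebraMap (ZMod p) T c + 1)) =
    -(x ^ p - x) := by
  have : Nontrivial T := hp.nontrivial_of_char_ne_one (Fact.out : p.Prime).ne_one
  let G : T[X] := Polynomial.X ^ 2 + (Polynomial.C (x + 1) * Polynomial.X - Polynomial.C t)
  have hdeg : (Polynomial.C (x + 1) * Polynomial.X - Polynomial.C t : T[X]).degree < (2 : ℕ) := by
    refine (Polynomial.degree_sub_le _ _).trans_lt (max_lt ?_ ?_)
    · exact (Polynomial.degree_C_mul_X_le _).trans_lt (by norm_num)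
    · exact Polynomial.degree_C_le.trans_lt (by norm_num)
  have hG : G.Monic := Polynomial.monic_X_pow_add hdeg
  have hGd : G.natDegree = 2 := by
    have := Polynomial.degree_add_eq_left_of_degree_lt
      (hdeg.trans_eq (Polynomial.degree_X_pow (R := T) 2).symm)
    rw [Polynomial.degree_X_pow] at this
    exact Polynomial.natDegree_eq_of_degree_eq_some this
  -- As G is monic of positive degree, T embeds in the extension, so the identity descends.
  have hinj : Function.Injective (AdjoinRoot.of G) := by
    rw [injective_iff_map_eq_zero]
    intro r hr
    by_contra h0
    have h1 : G ∣ Polynomial.C r := AdjoinRoot.mk_eq_zero.1 hr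
    exact hG.not_dvd_of_natDegree_lt (Polynomial.C_ne_zero.2 h0) (by simp [hGd]) h1
  have hC : CharP (AdjoinRoot G) p := charP_of_injective_ringHom hinj p
  let n : AdjoinRoot G := AdjoinRoot.root G
  have hn : n ^ 2 + (AdjoinRoot.of G (x + 1) * n - AdjoinRoot.of G t) = 0 := by
    have := AdjoinRoot.eval₂_root G
    simpa [G] using this
  have h := sum_mul_prod_split hC n (AdjoinRoot.of G x + n)
  rw [add_sub_cancel_right] at h
  have ht : n * (AdjoinRoot.of G x + n + 1) = AdjoinRoot.of G t := by
    rw [map_add, map_one] at hn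
    linear_combination hn
  rw [ht] at h
  have hal : ∀ c : ZMod p, algebraMap (ZMod p) (AdjoinRoot G) c =
      AdjoinRoot.of G (algebraMap (ZMod p) T c) := fun c => rfl
  apply hinj
  simpa only [map_sum, map_mul, map_add, map_one, map_prod, map_sub, map_neg, map_pow, hal,
    map_ofNat] using h

/-- The indices above i are replaced by their negatives modulo p, which gives the second product the
shape in which x^k y^k factors. -/
theorem sum_range_mul_prod_range (hp : CharP T p) (t x : T) :
    ∑ i ∈ Finset.range p, (x + 1 + 2 * (i : T)) *
      ((∏ c ∈ Finset.range i, (t - c * x - c * (c + 1))) *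
        ∏ c ∈ Finset.range (p - 1 - i), (t + (c + 1) * x - (c + 1) * c)) =
    -(x ^ p - x) := by
  rw [← sum_mul_prod_erase hp t x, ← sum_range_natCast_zmod]
  refine Finset.sum_congr rfl fun i hi => ?_
  rw [Finset.mem_range] at hi
  rw [map_natCast]
  congr 1
  let φ : ZMod p → T := fun c => t - algebraMap (ZMod p) T c * x -
        algebraMap (ZMod p) T c * (algebraMap (ZMod p) T c + 1)
  have h1 : ∏ c ∈ Finset.range i, (t - c * x - c * (c + 1)) =
      ∏ c ∈ Finset.range i, φ c := by simp [φ]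
  have h2 : ∏ c ∈ Finset.range (p - 1 - i), (t + (c + 1) * x - (c + 1) * c) =
      ∏ c ∈ Finset.Ico (i + 1) p, φ c := by
    have hlen : p - 1 - i = p - (i + 1) := by omega
    rw [Finset.prod_Ico_eq_prod_range, hlen, ← Finset.prod_range_reflect]
    refine Finset.prod_congr rfl fun c hc => ?_
    rw [Finset.mem_range] at hc
    have h3 : (((i + 1 + c : ℕ) : ZMod p)) = -((p - (i + 1) - 1 - c : ℕ) + 1 : ZMod p) := by
      rw [eq_neg_iff_add_eq_zero]
      have : (i + 1 + c) + ((p - (i + 1) - 1 - c) + 1) = p := by omega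
      exact_mod_cast (congrArg (Nat.cast : ℕ → ZMod p) this).trans (CharP.cast_eq_zero _ p)
    simp only [φ]
    rw [h3]
    simp only [map_neg, map_add, map_natCast, map_one]
    ring
  have h3 : ∏ c ∈ Finset.univ.erase (i : ZMod p), φ c =
      ∏ c ∈ (Finset.range p).erase i, φ c := by
    refine (Finset.prod_nbij' (fun c : ℕ => (c : ZMod p)) ZMod.val (fun c hc => ?_)
      (fun a ha => ?_) (fun c hc => ?_) (fun a _ => ?_) (fun _ _ => rfl)).symm
    · rw [Finset.mem_erase, Finset.mem_range] at hc
      refine Finset.mem_erase.2 ⟨fun h => hc.1 ?_, Finset.mem_univ _⟩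
      rw [← ZMod.val_cast_of_lt hc.2, h, ZMod.val_cast_of_lt hi]
    · refine Finset.mem_erase.2 ⟨fun h => (Finset.mem_erase.1 ha).1 ?_,
        Finset.mem_range.2 (ZMod.val_lt a)⟩
      rw [← h, ZMod.natCast_zmod_val]
    · exact ZMod.val_cast_of_lt (Finset.mem_range.1 (Finset.mem_erase.1 hc).2)
    · exact ZMod.natCast_zmod_val a
  have h4 : (Finset.range p).erase i = Finset.range i ∪ Finset.Ico (i + 1) p := by
    ext c
    simp only [Finset.mem_erase, Finset.mem_range, Finset.mem_union, Finset.mem_Ico]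
    omega
  have h5 : Disjoint (Finset.range i) (Finset.Ico (i + 1) p) := by
    rw [Finset.disjoint_left]
    intro c h6 h7
    rw [Finset.mem_range] at h6
    rw [Finset.mem_Ico] at h7
    omega
  rw [h1, h2, ← Finset.prod_union h5, ← h4, ← h3]

end ArtinSchreier

/-! ### Consequences of the relations of sl₂; the relation X^p = X -/

section Sl2Relations

/-- Elements `x`, `y` which, together with their commutator, satisfy the relations of a standard
basis of `sl₂`. -/
structure Sl2Relations {B : Type*} [Ring B] (x y : B) : Prop where
  lie_x : ⁅⁅x, y⁆, x⁆ = 2 * x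
  lie_y : ⁅⁅x, y⁆, y⁆ = -2 * y

namespace Sl2Relations

variable {B : Type*} [Ring B] {x y : B}

theorem lie_mul_x (h : Sl2Relations x y) : ⁅x, y⁆ * x = x * (⁅x, y⁆ + 2) := by
  have := h.lie_x
  rw [Ring.lie_def ⁅x, y⁆, sub_eq_iff_eq_add] at this
  rw [this]
  noncomm_ring

theorem lie_mul_y (h : Sl2Relations x y) : ⁅x, y⁆ * y = y * (⁅x, y⁆ - 2) := by
  have := h.lie_y
  rw [Ring.lie_def ⁅x, y⁆, sub_eq_iff_eq_add] at this
  rw [this]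
  noncomm_ring

theorem lie_mul_y_pow (h : Sl2Relations x y) (i : ℕ) :
    ⁅x, y⁆ * y ^ i = y ^ i * (⁅x, y⁆ - 2 * i) := by
  induction i with
  | zero => simp
  | succ i ih =>
    rw [pow_succ, ← mul_assoc, ih, mul_assoc, sub_mul, h.lie_mul_y]
    simp only [Nat.cast_add, Nat.cast_one, two_mul, mul_add, add_mul, mul_assoc,
      (Nat.cast_commute i y).eq]
    noncomm_ring

theorem mul_mul_x (h : Sl2Relations x y) : y * x * x = x * (y * x - ⁅x, y⁆ - 2) := by
  have h1 : y * x = x * y - ⁅x, y⁆ := by rw [Ring.lie_def]; abel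
  nth_rewrite 1 [h1]
  rw [sub_mul, h.lie_mul_x]
  noncomm_ring

theorem mul_mul_y (x y : B) : y * x * y = y * (y * x + ⁅x, y⁆) := by
  rw [Ring.lie_def]
  noncomm_ring

/-- The factor on the right is the one by which y^(i+1) x^(i+1) extends y^i x^i. -/
theorem mul_mul_x_pow (h : Sl2Relations x y) (i : ℕ) :
    y * x * x ^ i = x ^ i * (y * x - i * ⁅x, y⁆ - i * (i + 1)) := by
  induction i with
  | zero => simp
  | succ i ih =>
    have h1 := h.mul_mul_x
    have h2 := h.lie_mul_x
    rw [pow_succ, ← mul_assoc, ih]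
    generalize y * x = t at h1 ⊢
    generalize ⁅x, y⁆ = z at h1 h2 ⊢
    have hc := (Nat.cast_commute i x).eq
    have h3 : (t - i * z - i * (i + 1)) * x = x * (t - z - 2 - i * (z + 2) - i * (i + 1)) := by
      simp only [sub_mul, mul_sub, mul_add, add_mul, mul_assoc, h1, h2, hc]
      simp only [← mul_assoc, hc]
      simp only [mul_assoc, mul_one, hc]
    rw [mul_assoc, h3, mul_assoc]
    congr 2
    rw [← one_add_one_eq_two]
    push_cast
    noncomm_ring

/-- The factor on the right is the one by which x^(i+1) y^(i+1) extends x^i y^i. -/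
theorem mul_mul_y_pow (h : Sl2Relations x y) (i : ℕ) :
    x * y * y ^ i = y ^ i * (y * x + (i + 1) * ⁅x, y⁆ - (i + 1) * i) := by
  induction i with
  | zero => simp [Ring.lie_def]
  | succ i ih =>
    have h1 := mul_mul_y x y
    have h2 := h.lie_mul_y
    rw [pow_succ, ← mul_assoc, ih]
    generalize y * x = t at h1 ⊢
    generalize ⁅x, y⁆ = z at h1 h2 ⊢
    have hc := (Nat.cast_commute i y).eq
    have h3 : (t + (i + 1) * z - (i + 1) * i) * y =
        y * (t + z + (i + 1) * (z - 2) - (i + 1) * i) := by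
      simp only [sub_mul, mul_sub, mul_add, add_mul, mul_assoc, h1, h2, hc]
      simp only [← mul_assoc, hc]
      simp only [mul_assoc, mul_one, one_mul]
      noncomm_ring
    rw [mul_assoc, h3, mul_assoc]
    congr 2
    push_cast
    noncomm_ring

theorem commute_mul_lie (h : Sl2Relations x y) : Commute (y * x) ⁅x, y⁆ := by
  have h1 := h.lie_mul_x
  have h2 := h.lie_mul_y
  generalize ⁅x, y⁆ = z at h1 h2 ⊢
  rw [Commute, SemiconjBy, ← mul_assoc z, h2, mul_assoc y (z - 2), sub_mul, h1]
  noncomm_ring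

open scoped IsMulCommutative in
-- Moving y^i past X + 1 turns a summand into (X + 1 + 2i) (y^i x^i) (x^(p-1-i) y^(p-1-i)). Both
-- brackets are products in the commutative algebra generated by yx and X, where
-- `sum_range_mul_prod_range` applies.
theorem sum_pow_mul_pow {p : ℕ} [Fact p.Prime] [Algebra (ZMod p) B] (h : Sl2Relations x y) :
    ∑ i ∈ Finset.range p, y ^ i * ((⁅x, y⁆ + 1) * x ^ (p - 1)) * y ^ (p - 1 - i) =
      -(⁅x, y⁆ ^ p - ⁅x, y⁆) := by
  rcases subsingleton_or_nontrivial B with hB | hB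
  · exact Subsingleton.elim _ _
  have hcomm : ∀ a ∈ ({y * x, ⁅x, y⁆} : Set B), ∀ b ∈ ({y * x, ⁅x, y⁆} : Set B),
      a * b = b * a := by
    rintro a (rfl | rfl) b (rfl | rfl)
    · rfl
    · exact h.commute_mul_lie
    · exact h.commute_mul_lie.symm
    · rfl
  have := Algebra.isMulCommutative_adjoin (ZMod p) hcomm
  set T := Algebra.adjoin (ZMod p) ({y * x, ⁅x, y⁆} : Set B)
  let t : T := ⟨y * x, Algebra.subset_adjoin (by simp)⟩
  let z : T := ⟨⁅x, y⁆, Algebra.subset_adjoin (by simp)⟩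
  have hT : CharP T p := charP_of_injective_algebraMap (algebraMap (ZMod p) T).injective p
  have key := congrArg (Subtype.val : T → B) (sum_range_mul_prod_range hT t z)
  have hy : ∀ i : ℕ, y ^ i * x ^ i =
      ((∏ c ∈ Finset.range i, (t - c * z - c * (c + 1)) : T) : B) := by
    intro i
    induction i with
    | zero => simp
    | succ i ih =>
      rw [Finset.prod_range_succ, MulMemClass.coe_mul, ← ih, pow_succ, pow_succ', mul_assoc,
        ← mul_assoc y x, h.mul_mul_x_pow, ← mul_assoc]
      rfl
  have hx : ∀ i : ℕ, x ^ i * y ^ i =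
      ((∏ c ∈ Finset.range i, (t + (c + 1) * z - (c + 1) * c) : T) : B) := by
    intro i
    induction i with
    | zero => simp
    | succ i ih =>
      rw [Finset.prod_range_succ, MulMemClass.coe_mul, ← ih, pow_succ, pow_succ', mul_assoc,
        ← mul_assoc x y, h.mul_mul_y_pow, ← mul_assoc]
      rfl
  refine Eq.trans ?_ key
  rw [AddSubmonoidClass.coe_finsetSum]
  refine Finset.sum_congr rfl fun i hi => ?_
  rw [Finset.mem_range] at hi
  rw [MulMemClass.coe_mul, MulMemClass.coe_mul, ← hy, ← hx]
  have h1 : x ^ (p - 1) = x ^ i * x ^ (p - 1 - i) := by rw [← pow_add]; congr 1; omega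
  have h2 : y ^ i * (⁅x, y⁆ + 1) = (⁅x, y⁆ + 1 + 2 * i) * y ^ i := by
    have h3 := h.lie_mul_y_pow i
    have hc : (2 * (i : B)) * y ^ i = y ^ i * (2 * i) := by
      have := (Nat.cast_commute (2 * i) (y ^ i)).eq
      exact_mod_cast this
    rw [add_mul, add_mul, h3, hc]
    noncomm_ring
  rw [← mul_assoc (y ^ i), h2, h1]
  simp only [mul_assoc]
  rfl

/-- The relation `X ^ p = X` follows from the existence of an integral of the inner derivation of
`x ^ (p - 1)`. -/
theorem lie_pow_eq_of_lie_eq {p : ℕ} [Fact p.Prime] [Algebra (ZMod p) B] (h : Sl2Relations x y)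
    (hy : y ^ p = 0) (u : B) (hu : ⁅u, y⁆ = -((⁅x, y⁆ + 1) * x ^ (p - 1))) :
    ⁅x, y⁆ ^ p = ⁅x, y⁆ := by
  have h1 := h.sum_pow_mul_pow (p := p)
  have hu' : (⁅x, y⁆ + 1) * x ^ (p - 1) = y * u - u * y := by
    rw [eq_neg_iff_add_eq_zero, Ring.lie_def] at hu
    rw [← sub_eq_zero, ← hu]
    noncomm_ring
  rw [hu'] at h1
  -- With (X + 1) x^(p-1) = yu - uy the sum telescopes to y^p u - u y^p.
  have h2 : ∀ i ∈ Finset.range p, y ^ i * (y * u - u * y) * y ^ (p - 1 - i) =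
      y ^ (i + 1) * u * y ^ (p - (i + 1)) - y ^ i * u * y ^ (p - i) := by
    intro i hi
    rw [Finset.mem_range] at hi
    have h3 : p - i = (p - 1 - i) + 1 := by omega
    have h4 : p - (i + 1) = p - 1 - i := by omega
    rw [h3, h4, pow_succ, pow_succ']
    noncomm_ring
  rw [Finset.sum_congr rfl h2, Finset.sum_range_sub (fun i => y ^ i * u * y ^ (p - i)), hy,
    Nat.sub_zero, hy] at h1
  simp only [zero_mul, mul_zero, sub_zero] at h1
  exact sub_eq_zero.1 (neg_eq_zero.1 h1.symm)

end Sl2Relations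
end Sl2Relations

/-! ### The defining relations from the commutation formula -/

section DividedPowerPair

variable {B : Type*} [Ring B]

theorem ring_lie_swap (x y : B) : ⁅y, x⁆ = -⁅x, y⁆ := by
  rw [Ring.lie_def, Ring.lie_def, neg_sub]

theorem ring_neg_lie (x y : B) : ⁅-x, y⁆ = -⁅x, y⁆ := by
  rw [Ring.lie_def, Ring.lie_def]
  noncomm_ring

/-- The relations between the elements `e k = e^(p^k)` and `f k = f^(p^k)`. -/
structure HyperRelations (p : ℕ) (e f : ℕ → B) : Prop where
  sl2 : ∀ k, Sl2Relations (e k) (f k)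
  lie_lie_e : ∀ k n, 0 < n → ⁅⁅e k, f k⁆, e (k + n)⁆ = 0
  lie_lie_f : ∀ k n, 0 < n → ⁅⁅e k, f k⁆, f (k + n)⁆ = 0
  lie_e_e : ∀ k n, 0 < n → ⁅e k, e (k + n)⁆ = 0
  lie_f_f : ∀ k n, 0 < n → ⁅f k, f (k + n)⁆ = 0
  lie_e_f : ∀ k n, 0 < n → ⁅e k, f (k + n)⁆ =
    (-1) ^ n * ((List.range n).map fun i => f (k + i) ^ (p - 1)).prod * (⁅e k, f k⁆ + 1)
  lie_f_e : ∀ k n, 0 < n → ⁅e (k + n), f k⁆ =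
    (-1) ^ n * (⁅e k, f k⁆ + 1) * ((List.range n).map fun i => e (k + i) ^ (p - 1)).prod
  e_pow : ∀ k, e k ^ p = 0
  f_pow : ∀ k, f k ^ p = 0
  lie_pow : ∀ k, ⁅e k, f k⁆ ^ p = ⁅e k, f k⁆

/-- A system of divided powers, with multiplication rule `x^(m) x^(n) = (m + n choose m) x^(m+n)`. -/
structure IsDividedPowers (E : ℕ → B) : Prop where
  zero : E 0 = 1
  mul : ∀ m n, E m * E n = (m + n).choose m • E (m + n)

/-- Two systems of divided powers with the commutation rules of the divided powers of the root
vectors of `sl₂`. -/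
structure DividedPowerPair (p : ℕ) (E F : ℕ → B) : Prop where
  left : IsDividedPowers E
  right : IsDividedPowers F
  lie_left : ∀ k s, ⁅E (p ^ k * (s + 1)), F (p ^ k)⁆ =
    (⁅E (p ^ k), F (p ^ k)⁆ - (s : B)) * E (p ^ k * s)
  lie_right : ∀ k s, ⁅F (p ^ k * (s + 1)), E (p ^ k)⁆ =
    (⁅F (p ^ k), E (p ^ k)⁆ - (s : B)) * F (p ^ k * s)

theorem DividedPowerPair.symm {p : ℕ} {E F : ℕ → B} (h : DividedPowerPair p E F) :
    DividedPowerPair p F E := ⟨h.right, h.left, h.lie_right, h.lie_left⟩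

namespace IsDividedPowers

variable {p : ℕ} [Fact p.Prime] [Algebra (ZMod p) B] {E : ℕ → B}

theorem commute (h : IsDividedPowers E) (m n : ℕ) : Commute (E m) (E n) := by
  rw [Commute, SemiconjBy, h.mul, h.mul, add_comm n m, Nat.choose_symm_add]

theorem mul_smul (h : IsDividedPowers E) (m n : ℕ) :
    E m * E n = (((m + n).choose m : ℕ) : ZMod p) • E (m + n) := by
  rw [h.mul, Nat.cast_smul_eq_nsmul]

theorem pow_eq (h : IsDividedPowers E) (k m : ℕ) :
    E (p ^ k) ^ m = ((m.factorial : ℕ) : ZMod p) • E (p ^ k * m) := by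
  have hq : 0 < p ^ k := pow_pos (Fact.out : p.Prime).pos k
  induction m with
  | zero => simp [h.zero]
  | succ m ih =>
    have h1 := cast_choose_pow_mul_add (p := p) k (m + 1) m (a := 0) (b := 0) hq hq
    simp only [add_zero, Nat.choose_self, Nat.cast_one, mul_one] at h1
    rw [pow_succ, ih, smul_mul_assoc, h.mul_smul (p := p), smul_smul]
    have h2 : p ^ k * m + p ^ k = p ^ k * (m + 1) := by ring
    rw [h2, h1, Nat.factorial_succ, Nat.choose_succ_self_right, mul_comm (m + 1), Nat.cast_mul]

theorem pow_char (h : IsDividedPowers E) (k : ℕ) : E (p ^ k) ^ p = 0 := by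
  rw [h.pow_eq, (ZMod.natCast_eq_zero_iff _ _).2 (Nat.dvd_factorial (Fact.out : p.Prime).pos le_rfl),
    zero_smul]

theorem pow_char_sub_one (h : IsDividedPowers E) (k : ℕ) :
    E (p ^ k) ^ (p - 1) = -E (p ^ k * (p - 1)) := by
  rw [h.pow_eq, ZMod.wilsons_lemma, neg_one_smul]

/-- Each factor is -E(p^(k+i) (p-1)) by Wilson's theorem. The exponents have disjoint base p digits,
so by Lucas the product has coefficient 1, up to the sign. -/
theorem prod_pow (h : IsDividedPowers E) (k n : ℕ) :
    ((List.range n).map fun i => E (p ^ (k + i)) ^ (p - 1)).prod =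
      (-1) ^ n * E (p ^ k * (p ^ n - 1)) := by
  have hp := (Fact.out : p.Prime).pos
  induction n with
  | zero => simp [h.zero]
  | succ n ih =>
    have hq : 0 < p ^ (k + n) := pow_pos hp _
    have hn : 1 ≤ p ^ n := Nat.one_le_pow _ _ hp
    have hlt : p ^ k * (p ^ n - 1) < p ^ (k + n) := by
      rw [pow_add]
      exact Nat.mul_lt_mul_of_pos_left (by omega) (pow_pos hp k)
    have h1 := cast_choose_pow_mul_add (p := p) (k + n) (p - 1) 0 hlt hlt
    have h2 : p ^ k * (p ^ n - 1) + p ^ (k + n) * (p - 1) = p ^ k * (p ^ (n + 1) - 1) := by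
      have h3 : p ^ n - 1 + p ^ n * (p - 1) = p ^ (n + 1) - 1 := by
        obtain ⟨m, rfl⟩ : ∃ m, p = m + 1 := ⟨p - 1, by omega⟩
        rw [Nat.add_sub_cancel, pow_succ, mul_add, mul_one]
        omega
      rw [← h3, pow_add]
      ring
    rw [add_comm, h2] at h1
    rw [List.range_succ, List.map_append, List.prod_append, ih, List.map_singleton,
      List.prod_singleton, h.pow_char_sub_one, mul_assoc, mul_neg, h.mul_smul (p := p), h2]
    simp only [mul_zero, zero_add] at h1
    rw [h1]
    simp [pow_succ]

end IsDividedPowers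

namespace DividedPowerPair

variable {p : ℕ} [Fact p.Prime] [Algebra (ZMod p) B] {E F : ℕ → B}

/-- Write x, y for the pair and X for its commutator. The formula for s = 1 and x² = 2E(2p^k) give
[x², y] = 2(X - 1)x. On the other hand [x², y] = xX + Xx. -/
theorem lie_lie_left (h : DividedPowerPair p E F) (hp : 3 ≤ p) (k : ℕ) :
    ⁅⁅E (p ^ k), F (p ^ k)⁆, E (p ^ k)⁆ = 2 * E (p ^ k) := by
  have h2 : (2 : ZMod p) ≠ 0 := by
    intro h0
    have h1 : ((2 : ℕ) : ZMod p) = 0 := by exact_mod_cast h0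
    rw [ZMod.natCast_eq_zero_iff] at h1
    have := Nat.le_of_dvd (by norm_num) h1
    omega
  have h1 := h.lie_left k 1
  have h3 := h.left.pow_eq (p := p) k 2
  have h4 : (((2 : ℕ).factorial : ℕ) : ZMod p) = 2 := by norm_num
  rw [h4] at h3
  rw [mul_one, one_add_one_eq_two] at h1
  have h5 := congrArg (fun z => ⁅z, F (p ^ k)⁆) h3
  simp only [Ring.lie_def] at h1 h5 ⊢
  rw [smul_mul_assoc, mul_smul_comm, ← smul_sub, h1, ofNat_smul_eq_nsmul, two_nsmul, pow_two] at h5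
  have h6 : ∀ x y : B, x * x * y - y * (x * x) =
      (x * y - y * x - ((1 : ℕ) : B)) * x + (x * y - y * x - ((1 : ℕ) : B)) * x →
      (x * y - y * x) * x - x * (x * y - y * x) = 2 * x := by
    intro x y hxy
    rw [← sub_eq_zero] at hxy ⊢
    rw [← neg_eq_zero, ← hxy]
    push_cast
    noncomm_ring
  exact h6 _ _ h5

theorem sl2 (h : DividedPowerPair p E F) (hp : 3 ≤ p) (k : ℕ) :
    Sl2Relations (E (p ^ k)) (F (p ^ k)) := by
  refine ⟨h.lie_lie_left hp k, ?_⟩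
  have := h.symm.lie_lie_left hp k
  rw [ring_lie_swap (E (p ^ k)), ring_neg_lie, neg_eq_iff_eq_neg] at this
  rw [this, neg_mul]

theorem lie_left_eq (h : DividedPowerPair p E F) (k : ℕ) {n : ℕ} (hn : 0 < n) :
    ⁅E (p ^ (k + n)), F (p ^ k)⁆ =
      (⁅E (p ^ k), F (p ^ k)⁆ + 1) * E (p ^ k * (p ^ n - 1)) := by
  have hp := (Fact.out : p.Prime).pos
  have h1 := h.lie_left k (p ^ n - 1)
  have hn1 : 1 ≤ p ^ n := Nat.one_le_pow _ _ hp
  rw [Nat.sub_add_cancel hn1, ← pow_add] at h1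
  rw [h1]
  congr 1
  -- Here n > 0 is needed: p^n vanishes in B.
  have h2 : ((p ^ n - 1 : ℕ) : B) = -1 := by
    rw [Nat.cast_sub hn1]
    have : ((p : ℕ) : B) = 0 := by
      rw [← map_natCast (algebraMap (ZMod p) B), CharP.cast_eq_zero, map_zero]
    simp [this, hn.ne']
  rw [h2, sub_neg_eq_add]

/-- With x, u, v for E at p^k, p^(k+n), p^k(p^n - 1), y = F(p^k) and X = [x, y]: since x commutes
with u, the Jacobi identity gives [X, u] = -[x, [u, y]] = -[x, (X + 1)v]. As x commutes with v this
is [X, x]v = 2xv, and xv = p^n u = 0. -/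
theorem lie_lie_left_pow (h : DividedPowerPair p E F) (hp : 3 ≤ p) (k : ℕ) {n : ℕ} (hn : 0 < n) :
    ⁅⁅E (p ^ k), F (p ^ k)⁆, E (p ^ (k + n))⁆ = 0 := by
  have hpos := (Fact.out : p.Prime).pos
  have hn1 : 1 ≤ p ^ n := Nat.one_le_pow _ _ hpos
  have h1 := h.lie_left_eq k hn
  have h2 := h.lie_lie_left hp k
  have h3 := (h.left.commute (p ^ k) (p ^ (k + n))).eq
  have h4 := (h.left.commute (p ^ k) (p ^ k * (p ^ n - 1))).eq
  have h5 : E (p ^ k) * E (p ^ k * (p ^ n - 1)) = 0 := by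
    have hq : 0 < p ^ k := pow_pos hpos _
    have h6 := cast_choose_pow_mul_add (p := p) k (p ^ n) 1 (a := 0) (b := 0) hq hq
    simp only [add_zero, Nat.choose_one_right, mul_one, Nat.choose_zero_right, Nat.cast_one,
      Nat.cast_pow, CharP.cast_eq_zero, zero_pow hn.ne'] at h6
    have h7 : p ^ k + p ^ k * (p ^ n - 1) = p ^ k * p ^ n := by
      rw [← mul_one_add]
      congr 1
      omega
    rw [h.left.mul_smul (p := p), h7, h6, zero_smul]
  generalize E (p ^ k * (p ^ n - 1)) = v at *
  generalize E (p ^ (k + n)) = u at *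
  simp only [Ring.lie_def] at *
  generalize E (p ^ k) = x at *
  generalize F (p ^ k) = y at *
  have h8 : (x * y - y * x) * u - u * (x * y - y * x) =
      -(x * (u * y - y * u)) + (u * y - y * u) * x + x * (u * y) - u * (x * y)
        + u * (y * x) - (u * y) * x + (y * u) * x - y * (x * u) := by noncomm_ring
  rw [h8, h1]
  have h9 : -(x * ((x * y - y * x + 1) * v)) + (x * y - y * x + 1) * v * x =
      ((x * y - y * x) * x - x * (x * y - y * x)) * v := by
    rw [mul_assoc _ v, ← h4]
    noncomm_ring
  rw [h9, h2, mul_assoc 2, h5]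
  have h10 : u * (x * y) = x * (u * y) := by rw [← mul_assoc, ← h3, mul_assoc]
  have h11 : y * u * x = y * (x * u) := by rw [mul_assoc, h3]
  rw [h10, h11, mul_zero]
  noncomm_ring

/-- The element whose commutator with F(p^k) is -(X_k + 1) E(p^k)^(p-1) is the next generator
E(p^(k+1)). -/
theorem lie_pow (h : DividedPowerPair p E F) (hp : 3 ≤ p) (k : ℕ) :
    ⁅E (p ^ k), F (p ^ k)⁆ ^ p = ⁅E (p ^ k), F (p ^ k)⁆ := by
  refine (h.sl2 hp k).lie_pow_eq_of_lie_eq (h.right.pow_char k) (E (p ^ (k + 1))) ?_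
  rw [h.lie_left_eq k one_pos, pow_one, h.left.pow_char_sub_one, mul_neg, neg_neg]

theorem lie_lie_right_pow (h : DividedPowerPair p E F) (hp : 3 ≤ p) (k : ℕ) {n : ℕ} (hn : 0 < n) :
    ⁅⁅E (p ^ k), F (p ^ k)⁆, F (p ^ (k + n))⁆ = 0 := by
  have := h.symm.lie_lie_left_pow hp k hn
  rwa [ring_lie_swap (E (p ^ k)), ring_neg_lie, neg_eq_zero] at this

/-- The mirror image of `lie_left_eq` gives (X_k - 1) F(p^k (p^n - 1)); moving X_k to the right
changes X_k - 1 into X_k + 1. -/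
theorem lie_right_eq (h : DividedPowerPair p E F) (hp : 3 ≤ p) (k : ℕ) {n : ℕ} (hn : 0 < n) :
    ⁅E (p ^ k), F (p ^ (k + n))⁆ =
      F (p ^ k * (p ^ n - 1)) * (⁅E (p ^ k), F (p ^ k)⁆ + 1) := by
  have h1 := h.symm.lie_left_eq k hn
  rw [ring_lie_swap (E (p ^ k)) (F (p ^ k)), ring_lie_swap (E (p ^ k))] at h1
  have h2 := h.right.prod_pow (p := p) k n
  have h3 : ⁅E (p ^ k), F (p ^ k)⁆ * F (p ^ k * (p ^ n - 1)) =
      F (p ^ k * (p ^ n - 1)) * (⁅E (p ^ k), F (p ^ k)⁆ + 2) := by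
    have h4 : F (p ^ k * (p ^ n - 1)) =
        (-1) ^ n * ((List.range n).map fun i => F (p ^ (k + i)) ^ (p - 1)).prod := by
      rw [h2, ← mul_assoc, ← pow_add, (Even.add_self n).neg_one_pow, one_mul]
    have hc : ∀ z : B, Commute z ((-1) ^ n) := fun z => (Commute.neg_one_right z).pow_right n
    rw [h4, ← mul_assoc, (hc _).eq, mul_assoc, mul_assoc]
    congr 1
    -- Only the first factor F(p^k)^(p-1) fails to commute with X_k; it shifts X_k by -2(p - 1) = 2.
    obtain ⟨m, rfl⟩ : ∃ m, n = m + 1 := ⟨n - 1, by omega⟩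
    rw [List.range_succ_eq_map, List.map_cons, List.prod_cons, add_zero, ← mul_assoc,
      (h.sl2 hp k).lie_mul_y_pow, mul_assoc, mul_assoc]
    congr 1
    have h5 : ⁅E (p ^ k), F (p ^ k)⁆ - 2 * ((p - 1 : ℕ) : B) = ⁅E (p ^ k), F (p ^ k)⁆ + 2 := by
      have : ((p : ℕ) : B) = 0 := by
        rw [← map_natCast (algebraMap (ZMod p) B), CharP.cast_eq_zero, map_zero]
      rw [Nat.cast_sub (by omega), this, Nat.cast_one, zero_sub, mul_neg_one, sub_neg_eq_add]
    rw [h5]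
    refine (Commute.list_prod_right _ _ fun z hz => ?_).eq
    rw [List.map_map, List.mem_map] at hz
    obtain ⟨i, -, rfl⟩ := hz
    refine Commute.add_left (Commute.pow_right ?_ _) (Commute.ofNat_left 2 _)
    exact sub_eq_zero.1 (h.lie_lie_right_pow hp k (Nat.succ_pos i))
  rw [neg_eq_iff_eq_neg] at h1
  rw [h1, add_mul, neg_mul, h3]
  noncomm_ring

theorem hyperRelations (h : DividedPowerPair p E F) (hp : 3 ≤ p) :
    HyperRelations p (fun k => E (p ^ k)) (fun k => F (p ^ k)) where
  sl2 := h.sl2 hp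
  lie_lie_e k n hn := h.lie_lie_left_pow hp k hn
  lie_lie_f k n hn := h.lie_lie_right_pow hp k hn
  lie_e_e k n _ := sub_eq_zero.2 (h.left.commute _ _).eq
  lie_f_f k n _ := sub_eq_zero.2 (h.right.commute _ _).eq
  lie_e_f k n hn := by
    rw [h.right.prod_pow, h.lie_right_eq hp k hn, ← mul_assoc ((-1) ^ n), ← pow_add,
      (Even.add_self n).neg_one_pow, one_mul]
  lie_f_e k n hn := by
    have hc : ∀ z : B, Commute z ((-1) ^ n) := fun z => (Commute.neg_one_right z).pow_right n
    rw [h.left.prod_pow, h.lie_left_eq k hn, ← (hc _).eq, mul_assoc, ← mul_assoc ((-1) ^ n),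
      ← pow_add, (Even.add_self n).neg_one_pow, one_mul]
  e_pow k := h.left.pow_char k
  f_pow k := h.right.pow_char k
  lie_pow := h.lie_pow hp

end DividedPowerPair
end DividedPowerPair

/-! ### The divided powers of e and f in the algebra of distributions -/

section Dist

open LieAlgebra.SpecialLinear (sl)

variable {p : ℕ} [Fact p.Prime]

theorem dividedPow_isDividedPowers {R : Type*} [CommRing R] (x : sl (Fin 2) R)
    (hx : x.1.det = 0) : IsDividedPowers (dividedPow x hx) :=
  ⟨dividedPow_zero x hx, dividedPow_mul x hx⟩

/-- The two commutation rules come from the triple and from the opposite triple (-h, f, e), each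
with its own adapted coordinates. -/
theorem dividedPowerPair_dividedPow (hp : 3 ≤ p) {h e f : sl (Fin 2) (ZMod p)}
    (ht : IsSl2Triple h e f) :
    DividedPowerPair p (dividedPow e (det_eq_zero_of_triple hp ht))
      (dividedPow f (det_eq_zero_of_triple hp ht.symm)) := by
  obtain ⟨g, g', S⟩ := exists_standardizes hp ht
  obtain ⟨g₁, g₁', S₁⟩ := exists_standardizes hp ht.symm
  exact ⟨dividedPow_isDividedPowers _ _, dividedPow_isDividedPowers _ _,
    S.commutator_eq _ _, S₁.commutator_eq _ _⟩

end Dist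

/-! ### Upper bounds for dimensions from the relations -/

section Spanning

theorem finrank_mul_le {F B : Type*} [Field F] [Ring B] [Algebra F B] (M N : Submodule F B)
    [Module.Finite F M] [Module.Finite F N] :
    Module.Finite F ↥(M * N) ∧
      Module.finrank F ↥(M * N) ≤ Module.finrank F M * Module.finrank F N := by
  rw [← Submodule.mulMap_range, ← Module.finrank_tensorProduct]
  exact ⟨inferInstance, LinearMap.finrank_range_le _⟩

variable {p : ℕ} [Fact p.Prime] {B : Type*} [Ring B] [Algebra (ZMod p) B]

/-- The span contains 1 and is stable under left multiplication by both generators; x is moved to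
the right by x y^(a+1) = y^(a+1) x + y^a ((a+1)X - (a+1)a) and x X^b = (X - 2)^b x, where X = [x,
y]. -/
theorem Sl2Relations.adjoin_le_span {x y : B} (h : Sl2Relations x y) (hx : x ^ p = 0)
    (hy : y ^ p = 0) (hz : ⁅x, y⁆ ^ p = ⁅x, y⁆) :
    Subalgebra.toSubmodule (Algebra.adjoin (ZMod p) {x, y}) ≤
      Submodule.span (ZMod p) (Set.range fun m : Fin p × Fin p × Fin p =>
        y ^ (m.1 : ℕ) * ⁅x, y⁆ ^ (m.2.1 : ℕ) * x ^ (m.2.2 : ℕ)) := by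
  set W := Submodule.span (ZMod p) (Set.range fun m : Fin p × Fin p × Fin p =>
        y ^ (m.1 : ℕ) * ⁅x, y⁆ ^ (m.2.1 : ℕ) * x ^ (m.2.2 : ℕ)) with hW
  have hp := (Fact.out : p.Prime).pos
  have hred : ∀ b, ∃ b' < p, ⁅x, y⁆ ^ b = ⁅x, y⁆ ^ b' := by
    intro b
    induction b using Nat.strong_induction_on with
    | _ b ih =>
      rcases lt_or_ge b p with hb | hb
      · exact ⟨b, hb, rfl⟩
      · obtain ⟨c, rfl⟩ := Nat.exists_eq_add_of_le hb
        have := (Fact.out : p.Prime).one_lt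
        obtain ⟨b', h1, h2⟩ := ih (1 + c) (by omega)
        exact ⟨b', h1, by rw [← h2, pow_add, hz, pow_add, pow_one]⟩
  have hmem : ∀ a b c, y ^ a * ⁅x, y⁆ ^ b * x ^ c ∈ W := by
    intro a b c
    rcases lt_or_ge a p with ha | ha
    · rcases lt_or_ge c p with hc | hc
      · obtain ⟨b', hb', h1⟩ := hred b
        rw [h1]
        exact Submodule.subset_span ⟨(⟨a, ha⟩, ⟨b', hb'⟩, ⟨c, hc⟩), rfl⟩
      · rw [pow_eq_zero_of_le hc hx, mul_zero]
        exact W.zero_mem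
    · rw [pow_eq_zero_of_le ha hy, zero_mul, zero_mul]
      exact W.zero_mem
  have hpoly : ∀ (P : (ZMod p)[X]) (a c : ℕ), y ^ a * Polynomial.aeval ⁅x, y⁆ P * x ^ c ∈ W := by
    intro P a c
    induction P using Polynomial.induction_on' with
    | add P Q hP hQ => rw [map_add, mul_add, add_mul]; exact W.add_mem hP hQ
    | monomial n r =>
      rw [Polynomial.aeval_monomial, ← Algebra.smul_def, mul_smul_comm, smul_mul_assoc]
      exact W.smul_mem r (hmem a n c)
  have hxX : ∀ b, x * ⁅x, y⁆ ^ b = Polynomial.aeval ⁅x, y⁆ ((Polynomial.X - 2) ^ b : (ZMod p)[X]) *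
      x := by
    intro b
    have h1 : SemiconjBy x ⁅x, y⁆ (⁅x, y⁆ - 2) := by
      have := h.lie_mul_x
      rw [SemiconjBy, sub_mul, this]
      noncomm_ring
    have h2 : Polynomial.aeval ⁅x, y⁆ (2 : (ZMod p)[X]) = 2 := map_ofNat _ 2
    simpa [h2] using (h1.pow_right b).eq
  have hY : ∀ w ∈ W, y * w ∈ W := by
    intro w hw
    induction hw using Submodule.span_induction with
    | mem w hw =>
      obtain ⟨m, rfl⟩ := hw
      simp only [← mul_assoc, ← pow_succ']
      exact hmem _ _ _
    | zero => simp
    | add u v _ _ hu hv => rw [mul_add]; exact W.add_mem hu hv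
    | smul c u _ hu => rw [mul_smul_comm]; exact W.smul_mem c hu
  have hX : ∀ w ∈ W, x * w ∈ W := by
    intro w hw
    induction hw using Submodule.span_induction with
    | mem w hw =>
      obtain ⟨m, rfl⟩ := hw
      obtain ⟨⟨a, ha⟩, ⟨b, hb⟩, ⟨c, hc⟩⟩ := m
      simp only
      have key : ∀ a, y ^ a * x * ⁅x, y⁆ ^ b * x ^ c ∈ W := by
        intro a
        rw [mul_assoc (y ^ a), hxX, ← mul_assoc, mul_assoc _ x, ← pow_succ']
        exact hpoly _ _ _
      rcases a with _ | a
      · have := key 0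
        rw [pow_zero, one_mul] at this
        rwa [pow_zero, one_mul, ← mul_assoc]
      · have h1 : x * y ^ (a + 1) = y ^ (a + 1) * x + y ^ a *
            Polynomial.aeval ⁅x, y⁆ (((a : (ZMod p)[X]) + 1) * Polynomial.X -
              ((a : (ZMod p)[X]) + 1) * (a : (ZMod p)[X])) := by
          have := h.mul_mul_y_pow a
          rw [mul_assoc, ← pow_succ'] at this
          rw [this, pow_succ]
          simp only [map_sub, map_mul, map_add, map_natCast, map_one, Polynomial.aeval_X]
          noncomm_ring
        rw [← mul_assoc, ← mul_assoc, h1, add_mul, add_mul]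
        refine W.add_mem (key _) ?_
        rw [mul_assoc (y ^ a)]
        have h2 : ⁅x, y⁆ ^ b = Polynomial.aeval ⁅x, y⁆ (Polynomial.X ^ b : (ZMod p)[X]) := by simp
        rw [h2, ← map_mul]
        exact hpoly _ _ _
    | zero => simp
    | add u v _ _ hu hv => rw [mul_add]; exact W.add_mem hu hv
    | smul c u _ hu => rw [mul_smul_comm]; exact W.smul_mem c hu
  intro u hu
  have key : ∀ w ∈ W, u * w ∈ W := by
    rw [Subalgebra.mem_toSubmodule] at hu
    induction hu using Algebra.adjoin_induction with
    | mem u hu =>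
      rcases hu with rfl | rfl
      · exact hX
      · exact hY
    | algebraMap r =>
      intro w hw
      rw [← Algebra.smul_def]
      exact W.smul_mem r hw
    | add u v _ _ hu hv =>
      intro w hw
      rw [add_mul]
      exact W.add_mem (hu w hw) (hv w hw)
    | mul u v _ _ hu hv =>
      intro w hw
      rw [mul_assoc]
      exact hu _ (hv w hw)
  have := key 1 (by simpa using hmem 0 0 0)
  rwa [mul_one] at this

theorem Sl2Relations.finrank_adjoin_le {x y : B} (h : Sl2Relations x y) (hx : x ^ p = 0)
    (hy : y ^ p = 0) (hz : ⁅x, y⁆ ^ p = ⁅x, y⁆) :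
    Module.Finite (ZMod p) (Algebra.adjoin (ZMod p) {x, y}) ∧
      Module.finrank (ZMod p) (Algebra.adjoin (ZMod p) {x, y}) ≤ p ^ 3 := by
  have h1 := h.adjoin_le_span hx hy hz
  set v := fun m : Fin p × Fin p × Fin p => y ^ (m.1 : ℕ) * ⁅x, y⁆ ^ (m.2.1 : ℕ) * x ^ (m.2.2 : ℕ)
  have hfin : Module.Finite (ZMod p) (Submodule.span (ZMod p) (Set.range v)) :=
    FiniteDimensional.span_of_finite _ (Set.finite_range v)
  refine ⟨Submodule.finiteDimensional_of_le h1, (Submodule.finrank_mono h1).trans ?_⟩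
  refine (finrank_range_le_card v).trans ?_
  simp [pow_succ, mul_assoc]

/-- The subalgebra generated by the first `K` pairs of generators. -/
def levelAlgebra (p : ℕ) [Fact p.Prime] {B : Type*} [Ring B] [Algebra (ZMod p) B] (e f : ℕ → B)
    (K : ℕ) : Subalgebra (ZMod p) B :=
  Algebra.adjoin (ZMod p) (e '' Set.Iio K ∪ f '' Set.Iio K)

namespace HyperRelations

variable {e f : ℕ → B}

theorem e_mem (p : ℕ) [Fact p.Prime] {B : Type*} [Ring B] [Algebra (ZMod p) B] (e f : ℕ → B)
    {i K : ℕ} (hi : i < K) : e i ∈ levelAlgebra p e f K :=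
  Algebra.subset_adjoin (Or.inl ⟨i, hi, rfl⟩)

theorem f_mem (p : ℕ) [Fact p.Prime] {B : Type*} [Ring B] [Algebra (ZMod p) B] (e f : ℕ → B)
    {i K : ℕ} (hi : i < K) : f i ∈ levelAlgebra p e f K :=
  Algebra.subset_adjoin (Or.inr ⟨i, hi, rfl⟩)

theorem lie_mem (p : ℕ) [Fact p.Prime] {B : Type*} [Ring B] [Algebra (ZMod p) B] (e f : ℕ → B)
    {i K : ℕ} (hi : i < K) : ⁅e i, f i⁆ ∈ levelAlgebra p e f K := by
  rw [Ring.lie_def]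
  exact sub_mem (mul_mem (e_mem p e f hi) (f_mem p e f hi))
    (mul_mem (f_mem p e f hi) (e_mem p e f hi))

/-- Commutation with z is a derivation, so generators suffice. -/
theorem commutator_mem_of_generators {K : ℕ} {z : B}
    (hz : ∀ i < K, ⁅e i, z⁆ ∈ levelAlgebra p e f K ∧ ⁅f i, z⁆ ∈ levelAlgebra p e f K) :
    ∀ y ∈ levelAlgebra p e f K, y * z - z * y ∈ levelAlgebra p e f K := by
  intro y hy
  have hy' := hy
  unfold levelAlgebra at hy
  induction hy using Algebra.adjoin_induction with
  | mem y hy =>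
    rcases hy with ⟨i, hi, rfl⟩ | ⟨i, hi, rfl⟩
    · exact (hz i hi).1
    · exact (hz i hi).2
  | algebraMap r =>
    rw [Algebra.commutes, sub_self]
    exact zero_mem _
  | add u v hu hv ihu ihv =>
    have : (u + v) * z - z * (u + v) = (u * z - z * u) + (v * z - z * v) := by noncomm_ring
    rw [this]
    exact add_mem (ihu hu) (ihv hv)
  | mul u v hu hv ihu ihv =>
    have : u * v * z - z * (u * v) = u * (v * z - z * v) + (u * z - z * u) * v := by noncomm_ring
    rw [this]
    exact add_mem (mul_mem hu (ihv hv)) (mul_mem (ihu hu) hv)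

/-- By relations 3 and 4, a commutator of a generator of level i < K with one of level K is zero or
an expression in levels i, ..., K - 1. -/
theorem commutator_mem (h : HyperRelations p e f) (K : ℕ) :
    ∀ y ∈ levelAlgebra p e f K, y * e K - e K * y ∈ levelAlgebra p e f K ∧
      y * f K - f K * y ∈ levelAlgebra p e f K := by
  have hsign : ∀ n : ℕ, ((-1) ^ n : B) ∈ levelAlgebra p e f K := fun n =>
    pow_mem (neg_mem (one_mem _)) n
  have hprod (g : ℕ → B) (hg : ∀ i < K, g i ∈ levelAlgebra p e f K) (i n : ℕ) (hin : i + n = K) :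
      ((List.range n).map fun j => g (i + j) ^ (p - 1)).prod ∈ levelAlgebra p e f K := by
    refine list_prod_mem fun u hu => ?_
    rw [List.mem_map] at hu
    obtain ⟨j, hj, rfl⟩ := hu
    rw [List.mem_range] at hj
    exact pow_mem (hg _ (by omega)) _
  intro y hy
  refine ⟨commutator_mem_of_generators (fun i hi => ?_) y hy,
    commutator_mem_of_generators (fun i hi => ?_) y hy⟩
  · obtain ⟨n, rfl⟩ := Nat.exists_eq_add_of_lt hi
    rw [add_assoc, h.lie_e_e _ _ n.succ_pos, ring_lie_swap (e (i + (n + 1))),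
      h.lie_f_e _ _ n.succ_pos]
    exact ⟨zero_mem _, neg_mem (mul_mem (mul_mem (hsign _)
      (add_mem (lie_mem p e f (by omega)) (one_mem _)))
      (hprod e (fun j hj => e_mem p e f hj) _ _ (by omega)))⟩
  · obtain ⟨n, rfl⟩ := Nat.exists_eq_add_of_lt hi
    rw [add_assoc, h.lie_f_f _ _ n.succ_pos, h.lie_e_f _ _ n.succ_pos]
    exact ⟨mul_mem (mul_mem (hsign _) (hprod f (fun j hj => f_mem p e f hj) _ _ (by omega)))
      (add_mem (lie_mem p e f (by omega)) (one_mem _)), zero_mem _⟩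

/-- With U generated by level K and P by the lower levels, `commutator_mem` gives PU ⊆ UP. Hence UP
is stable under left multiplication by all generators, and it contains 1. -/
theorem levelAlgebra_succ_le (h : HyperRelations p e f) (K : ℕ) :
    Subalgebra.toSubmodule (levelAlgebra p e f (K + 1)) ≤
      Subalgebra.toSubmodule (Algebra.adjoin (ZMod p) {e K, f K}) *
        Subalgebra.toSubmodule (levelAlgebra p e f K) := by
  set U := Algebra.adjoin (ZMod p) {e K, f K} with hU
  set P := levelAlgebra p e f K with hP
  set W := Subalgebra.toSubmodule U * Subalgebra.toSubmodule P with hW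
  have hUW : ∀ u ∈ U, ∀ w ∈ W, u * w ∈ W := by
    intro u hu w hw
    have : u * w ∈ Subalgebra.toSubmodule U * W := Submodule.mul_mem_mul hu hw
    rwa [hW, ← mul_assoc, (Subalgebra.isIdempotentElem_toSubmodule _).eq] at this
  have hPW : ∀ y ∈ P, y ∈ W := fun y hy => by
    have : 1 * y ∈ W := Submodule.mul_mem_mul (one_mem U) hy
    rwa [one_mul] at this
  have hgen : ∀ z ∈ U, (∀ y ∈ P, y * z - z * y ∈ P) → ∀ y ∈ P, y * z ∈ W := by
    intro z hz hyz y hy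
    have : y * z = z * y + (y * z - z * y) := by abel
    rw [this]
    exact add_mem (Submodule.mul_mem_mul hz hy) (hPW _ (hyz y hy))
  have heU : e K ∈ U := Algebra.subset_adjoin (by simp)
  have hfU : f K ∈ U := Algebra.subset_adjoin (by simp)
  have hPU : ∀ u ∈ U, ∀ y ∈ P, y * u ∈ W := by
    intro u hu
    have hu' := hu
    rw [hU] at hu
    induction hu using Algebra.adjoin_induction with
    | mem u hu =>
      rcases hu with rfl | rfl
      · exact hgen _ heU fun y hy => (h.commutator_mem K y hy).1
      · exact hgen _ hfU fun y hy => (h.commutator_mem K y hy).2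
    | algebraMap r =>
      intro y hy
      exact hPW _ (mul_mem hy (algebraMap_mem P r))
    | add u v hu hv ihu ihv =>
      intro y hy
      rw [mul_add]
      exact add_mem (ihu hu y hy) (ihv hv y hy)
    | mul u v hu hv ihu ihv =>
      intro y hy
      rw [← mul_assoc]
      have h1 : y * u ∈ W := ihu hu y hy
      have h2 : ∀ w ∈ W, w * v ∈ W := by
        intro w hw
        induction hw using Submodule.mul_induction_on' with
        | mem_mul_mem a ha b hb =>
          rw [mul_assoc]
          exact hUW a ha _ (ihv hv b hb)
        | add a _ b _ ha hb => rw [add_mul]; exact add_mem ha hb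
      exact h2 _ h1
  have hPW' : ∀ y ∈ P, ∀ w ∈ W, y * w ∈ W := by
    intro y hy w hw
    induction hw using Submodule.mul_induction_on' with
    | mem_mul_mem a ha b hb =>
      rw [← mul_assoc]
      have : y * a * b ∈ W * Subalgebra.toSubmodule P := Submodule.mul_mem_mul (hPU a ha y hy) hb
      rwa [hW, mul_assoc, (Subalgebra.isIdempotentElem_toSubmodule _).eq] at this
    | add a _ b _ ha hb => rw [mul_add]; exact add_mem ha hb
  intro y hy
  have key : ∀ w ∈ W, y * w ∈ W := by
    rw [Subalgebra.mem_toSubmodule, levelAlgebra] at hy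
    induction hy using Algebra.adjoin_induction with
    | mem y hy =>
      rcases hy with ⟨i, hi, rfl⟩ | ⟨i, hi, rfl⟩ <;>
        rcases (Nat.lt_succ_iff.1 hi).lt_or_eq with hi | rfl
      · exact hPW' _ (e_mem p e f hi)
      · exact hUW _ heU
      · exact hPW' _ (f_mem p e f hi)
      · exact hUW _ hfU
    | algebraMap r => exact hUW _ (algebraMap_mem U r)
    | add u v _ _ hu hv =>
      intro w hw
      rw [add_mul]
      exact add_mem (hu w hw) (hv w hw)
    | mul u v _ _ hu hv =>
      intro w hw
      rw [mul_assoc]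
      exact hu _ (hv w hw)
  have := key 1 (hPW 1 (one_mem P))
  rwa [mul_one] at this

theorem finrank_adjoin_le (h : HyperRelations p e f) (k : ℕ) :
    Module.Finite (ZMod p) (Algebra.adjoin (ZMod p) {e k, f k}) ∧
      Module.finrank (ZMod p) (Algebra.adjoin (ZMod p) {e k, f k}) ≤ p ^ 3 :=
  (h.sl2 k).finrank_adjoin_le (h.e_pow k) (h.f_pow k) (h.lie_pow k)

theorem finrank_levelAlgebra_le (h : HyperRelations p e f) (K : ℕ) :
    Module.Finite (ZMod p) (levelAlgebra p e f K) ∧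
      Module.finrank (ZMod p) (levelAlgebra p e f K) ≤ p ^ (3 * K) := by
  induction K with
  | zero =>
    have h0 : levelAlgebra p e f 0 = ⊥ := by simp [levelAlgebra]
    rw [h0]
    rcases subsingleton_or_nontrivial B with hB | hB
    · exact ⟨inferInstance, (Module.finrank_zero_of_subsingleton).trans_le (Nat.zero_le _)⟩
    · exact ⟨inferInstance, (Subalgebra.finrank_bot).trans_le (by simp)⟩
  | succ K ih =>
    obtain ⟨h1, h2⟩ := ih
    obtain ⟨h3, h4⟩ := h.finrank_adjoin_le K
    obtain ⟨h5, h6⟩ := finrank_mul_le (Subalgebra.toSubmodule (Algebra.adjoin (ZMod p) {e K, f K}))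
      (Subalgebra.toSubmodule (levelAlgebra p e f K))
    refine ⟨Submodule.finiteDimensional_of_le (h.levelAlgebra_succ_le K),
      (Submodule.finrank_mono (h.levelAlgebra_succ_le K)).trans (h6.trans ?_)⟩
    rw [mul_add, mul_one, pow_add, mul_comm]
    exact Nat.mul_le_mul h2 h4

/-- The dimension of level K is kept as a factor: against a lower bound for the left side this
bounds it from below. -/
theorem finrank_levelAlgebra_succ_le (h : HyperRelations p e f) (K : ℕ) :
    Module.finrank (ZMod p) (levelAlgebra p e f (K + 1)) ≤
      Module.finrank (ZMod p) (Algebra.adjoin (ZMod p) {e K, f K}) * p ^ (3 * K) := by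
  obtain ⟨h1, h2⟩ := h.finrank_levelAlgebra_le K
  obtain ⟨h3, h4⟩ := h.finrank_adjoin_le K
  obtain ⟨h5, h6⟩ := finrank_mul_le (Subalgebra.toSubmodule (Algebra.adjoin (ZMod p) {e K, f K}))
    (Subalgebra.toSubmodule (levelAlgebra p e f K))
  exact (Submodule.finrank_mono (h.levelAlgebra_succ_le K)).trans
    (h6.trans (Nat.mul_le_mul le_rfl h2))

end HyperRelations
end Spanning

/-! ### Lower bounds for dimensions, and generation of the algebra of distributions -/

section Exhaustion

open LieAlgebra.SpecialLinear (sl)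

variable {p : ℕ} [Fact p.Prime] {g g' : Matrix (Fin 2) (Fin 2) (ZMod p)}
  {e f : sl (Fin 2) (ZMod p)}

/-- Splitting off the leading digit, m = r + p^K d, gives E(m) = E(r) E(p^K d) by Lucas and E(p^K d)
= E(p^K)^d / d!, where d < p. -/
theorem IsDividedPowers.mem_of_pow_mem {B : Type*} [Ring B] [Algebra (ZMod p) B] {E : ℕ → B}
    (h : IsDividedPowers E) (A : Subalgebra (ZMod p) B) (K : ℕ) (hA : ∀ i < K, E (p ^ i) ∈ A) :
    ∀ m < p ^ K, E m ∈ A := by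
  induction K with
  | zero =>
    intro m hm
    obtain rfl : m = 0 := by simpa using hm
    rw [h.zero]
    exact one_mem A
  | succ K ih =>
    intro m hm
    have hq : 0 < p ^ K := pow_pos (Fact.out : p.Prime).pos K
    have hr : m % p ^ K < p ^ K := Nat.mod_lt _ hq
    have hd : m / p ^ K < p := Nat.div_lt_of_lt_mul (by rwa [pow_succ] at hm)
    have h1 := h.pow_eq (p := p) K (m / p ^ K)
    have h2 : ((m / p ^ K).factorial : ZMod p) ≠ 0 := by
      rw [Ne, ZMod.natCast_eq_zero_iff, (Fact.out : p.Prime).dvd_factorial]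
      omega
    have h3 : E (p ^ K * (m / p ^ K)) ∈ A := by
      have : E (p ^ K * (m / p ^ K)) =
          ((m / p ^ K).factorial : ZMod p)⁻¹ • E (p ^ K) ^ (m / p ^ K) := by
        rw [h1, smul_smul, inv_mul_cancel₀ h2, one_smul]
      rw [this]
      exact A.smul_mem (pow_mem (hA K (Nat.lt_succ_self K)) _) _
    have h4 := cast_choose_pow_mul_add (p := p) K (m / p ^ K) 0 hr hr
    rw [Nat.choose_zero_right, Nat.choose_self, mul_zero, zero_add, Nat.div_add_mod] at h4
    have h5 := h.mul_smul (p := p) (m % p ^ K) (p ^ K * (m / p ^ K))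
    rw [Nat.mod_add_div, h4, Nat.cast_one, mul_one, one_smul] at h5
    rw [← h5]
    exact mul_mem (ih (fun i hi => hA i (hi.trans (Nat.lt_succ_self K))) _ hr) h3

/-- The products `f^(α) e^(m) f^(m) e^(δ)`. -/
def quadProduct (e f : sl (Fin 2) (ZMod p)) (he : e.1.det = 0) (hf : f.1.det = 0) (α m δ : ℕ) :
    DistSL2 (ZMod p) :=
  dividedPow f hf α * (dividedPow e he m * dividedPow f hf m) * dividedPow e he δ

theorem Standardizes.quadProduct_apply (S : Standardizes g g' e f) (he : e.1.det = 0)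
    (hf : f.1.det = 0) (α m δ i j k : ℕ) :
    (quadProduct e f he hf α m δ).1 (shiftedMonomial g g' i 0 j k) =
      (j.choose δ : ZMod p) * ((k.choose α : ZMod p) *
        hookCoeff (ZMod p) m m (δ + α) (i + (j - δ)) (i + (k - α))) := by
  rw [quadProduct, S.mul_e_apply_shifted, S.f_mul_apply_shifted, S.e_mul_f_apply_shifted, zero_add]

theorem Standardizes.quadProduct_apply_self (S : Standardizes g g' e f) (he : e.1.det = 0)
    (hf : f.1.det = 0) (α m δ : ℕ) :
    (quadProduct e f he hf α m δ).1 (shiftedMonomial g g' m 0 δ α) = 1 := by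
  rw [S.quadProduct_apply]
  simp [hookCoeff]

theorem Standardizes.quadProduct_apply_ne_zero (S : Standardizes g g' e f) (he : e.1.det = 0)
    (hf : f.1.det = 0) {α m δ i j k : ℕ}
    (h : (quadProduct e f he hf α m δ).1 (shiftedMonomial g g' i 0 j k) ≠ 0) :
    δ ≤ j ∧ α ≤ k ∧ j - δ = k - α ∧ i + (k - α) ≤ m := by
  rw [S.quadProduct_apply, hookCoeff] at h
  have h1 : δ ≤ j := by
    by_contra hlt
    exact h (by rw [Nat.choose_eq_zero_of_lt (not_le.1 hlt), Nat.cast_zero, zero_mul])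
  have h2 : α ≤ k := by
    by_contra hlt
    exact h (by rw [Nat.choose_eq_zero_of_lt (not_le.1 hlt), Nat.cast_zero, zero_mul, mul_zero])
  split_ifs at h with h3
  · omega
  · simp at h

/-- If the value is nonzero, then i + (j - δ) ≤ m < p^K. This excludes i ≥ p^K; and if j ≥ p^K, then
j = p^K + (j - p^K) with j - p^K < δ < p^K, so C(j, δ) = 0 by Lucas. The same argument applies to k
and α. -/
theorem Standardizes.quadProduct_apply_eq_zero (S : Standardizes g g' e f) (he : e.1.det = 0)
    (hf : f.1.det = 0) {K α m δ : ℕ} (hα : α < p ^ K) (hm : m < p ^ K) (hδ : δ < p ^ K)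
    {i j k : ℕ} (h : p ^ K ≤ i ∨ p ^ K ≤ j ∨ p ^ K ≤ k) :
    (quadProduct e f he hf α m δ).1 (shiftedMonomial g g' i 0 j k) = 0 := by
  by_contra h0
  obtain ⟨h1, h2, h3, h4⟩ := S.quadProduct_apply_ne_zero he hf h0
  have hch : ∀ j δ : ℕ, δ < p ^ K → p ^ K ≤ j → j - δ < p ^ K → (j.choose δ : ZMod p) = 0 := by
    intro j δ hδ hj hlt
    have h5 := cast_choose_pow_mul_add (p := p) K 1 0 (a := j - p ^ K) (b := δ) (by omega) hδ
    have h6 : p ^ K * 1 + (j - p ^ K) = j := by omega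
    rw [h6, mul_zero, zero_add, Nat.choose_eq_zero_of_lt (n := j - p ^ K) (by omega),
      Nat.cast_zero, mul_zero] at h5
    exact h5
  rw [S.quadProduct_apply] at h0
  rcases h with h | h | h
  · omega
  · exact h0 (by rw [hch j δ hδ h (by omega), zero_mul])
  · exact h0 (by rw [hch k α hα h (by omega), zero_mul, mul_zero])

/-- The matrix of values of the products `f^(α) e^(m) f^(m) e^(δ)` on monomials is unitriangular
for a suitable order. -/
theorem Standardizes.eq_zero_of_sum_quadProduct (S : Standardizes g g' e f) (he : e.1.det = 0)
    (hf : f.1.det = 0) (q : ℕ) (c : Fin q × Fin q × Fin q → ZMod p)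
    (hc : ∀ t : Fin q × Fin q × Fin q, ∑ u, c u *
      (quadProduct e f he hf u.1 u.2.1 u.2.2).1 (shiftedMonomial g g' t.2.1 0 t.2.2 t.1) = 0) :
    c = 0 := by
  by_contra h0
  obtain ⟨u₀, hu₀⟩ := Function.ne_iff.1 h0
  -- A nonzero value of the product u at the monomial of t, with r = δ_t - δ_u ≥ 0, forces m_u ≥ m_t
  -- + r, so δ_u - m_u ≤ δ_t - m_t - 2r. Minimality of δ - m at t leaves only u = t.
  obtain ⟨t, ht, hmin⟩ := Finset.exists_min_image (Finset.univ.filter fun u => c u ≠ 0)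
    (fun u => (u.2.2 : ℤ) - u.2.1) ⟨u₀, by simpa using hu₀⟩
  rw [Finset.mem_filter] at ht
  have h1 := hc t
  rw [Finset.sum_eq_single t, S.quadProduct_apply_self, mul_one] at h1
  · exact ht.2 h1
  · intro u _ hut
    by_contra h2
    obtain ⟨h3, h4⟩ := mul_ne_zero_iff.1 h2
    obtain ⟨h5, h6, h7, h8⟩ := S.quadProduct_apply_ne_zero he hf h4
    have h9 := hmin u (Finset.mem_filter.2 ⟨Finset.mem_univ _, h3⟩)
    apply hut
    ext
    · omega
    · omega
    · omega
  · simp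

theorem DistSL2.sum_smul_apply {ι : Type*} (s : Finset ι) (c : ι → ZMod p)
    (ν : ι → DistSL2 (ZMod p)) (φ : CoordRing (ZMod p)) :
    (∑ u ∈ s, c u • ν u).1 φ = ∑ u ∈ s, c u * (ν u).1 φ := by
  classical
  induction s using Finset.induction_on with
  | empty => rfl
  | insert a s ha ih =>
    rw [Finset.sum_insert ha, Finset.sum_insert ha, ← ih]
    rfl

theorem Standardizes.linearIndependent_quadProduct (S : Standardizes g g' e f) (he : e.1.det = 0)
    (hf : f.1.det = 0) (q : ℕ) :
    LinearIndependent (ZMod p) fun u : Fin q × Fin q × Fin q =>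
      quadProduct e f he hf u.1 u.2.1 u.2.2 := by
  rw [Fintype.linearIndependent_iff]
  intro c hc
  refine congrFun (S.eq_zero_of_sum_quadProduct he hf q c fun t => ?_)
  rw [← DistSL2.sum_smul_apply, hc]
  rfl

theorem Standardizes.ext_shiftedMonomial (S : Standardizes g g' e f) {μ ν : DistSL2 (ZMod p)}
    (h : ∀ i j k, μ.1 (shiftedMonomial g g' i 0 j k) = ν.1 (shiftedMonomial g g' i 0 j k)) :
    μ = ν := by
  apply S.ext_coordMonomial
  intro i j k
  have h1 : coordMonomial g g' i j k =
      ∑ t ∈ Finset.range (i + 1), (i.choose t : ZMod p) • shiftedMonomial g g' t 0 j k := by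
    have h2 : coordMatrix g g' 0 0 ^ i = ∑ t ∈ Finset.range (i + 1),
        (coordMatrix g g' 0 0 - 1) ^ t * (i.choose t : CoordRing (ZMod p)) := by
      have := add_pow (coordMatrix g g' 0 0 - 1) 1 i
      simpa using this
    rw [coordMonomial, h2, Finset.sum_mul, Finset.sum_mul]
    refine Finset.sum_congr rfl fun t _ => ?_
    rw [shiftedMonomial, Algebra.smul_def, map_natCast]
    ring
  rw [h1]
  change μ.1.ofConv _ = ν.1.ofConv _
  simp only [map_sum, map_smul]
  refine Finset.sum_congr rfl fun t _ => ?_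
  congr 1
  exact h t j k

theorem quadProduct_mem (he : e.1.det = 0) (hf : f.1.det = 0) {K α m δ : ℕ} (hα : α < p ^ K)
    (hm : m < p ^ K) (hδ : δ < p ^ K) :
    quadProduct e f he hf α m δ ∈ levelAlgebra p (fun k => dividedPow e he (p ^ k))
      (fun k => dividedPow f hf (p ^ k)) K := by
  set A := levelAlgebra p (fun k => dividedPow e he (p ^ k)) (fun k => dividedPow f hf (p ^ k)) K
  have hE := (dividedPow_isDividedPowers e he).mem_of_pow_mem A K fun i hi =>
    HyperRelations.e_mem p (fun k => dividedPow e he (p ^ k)) (fun k => dividedPow f hf (p ^ k)) hi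
  have hF := (dividedPow_isDividedPowers f hf).mem_of_pow_mem A K fun i hi =>
    HyperRelations.f_mem p (fun k => dividedPow e he (p ^ k)) (fun k => dividedPow f hf (p ^ k)) hi
  exact mul_mem (mul_mem (hF α hα) (mul_mem (hE m hm) (hF m hm))) (hE δ hδ)

/-- The square unitriangular matrix is invertible, so some combination of the products agrees with μ
for i, j, k < p^K. If an exponent is at least p^K ≥ n, then μ vanishes because a - 1, b, c lie in
the augmentation ideal, and the products vanish by `quadProduct_apply_eq_zero`. -/
theorem Standardizes.exists_mem_levelAlgebra (S : Standardizes g g' e f) (he : e.1.det = 0)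
    (hf : f.1.det = 0) (μ : DistSL2 (ZMod p)) :
    ∃ K, μ ∈ levelAlgebra p (fun k => dividedPow e he (p ^ k))
      (fun k => dividedPow f hf (p ^ k)) K := by
  obtain ⟨n, hn⟩ := μ.2
  obtain ⟨K, hK⟩ : ∃ K, n ≤ p ^ K := ⟨n, (Nat.lt_pow_self (Fact.out : p.Prime).one_lt).le⟩
  refine ⟨K, ?_⟩
  let T : (Fin (p ^ K) × Fin (p ^ K) × Fin (p ^ K) → ZMod p) →ₗ[ZMod p]
      (Fin (p ^ K) × Fin (p ^ K) × Fin (p ^ K) → ZMod p) :=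
    Matrix.mulVecLin (Matrix.of fun t u => (quadProduct e f he hf u.1 u.2.1 u.2.2).1
      (shiftedMonomial g g' t.2.1 0 t.2.2 t.1))
  have hT : ∀ c t, T c t = ∑ u, c u * (quadProduct e f he hf u.1 u.2.1 u.2.2).1
      (shiftedMonomial g g' t.2.1 0 t.2.2 t.1) := by
    intro c t
    simp [T, Matrix.mulVec, dotProduct, mul_comm]
  have hinj : Function.Injective T := by
    rw [injective_iff_map_eq_zero]
    intro c hc
    refine S.eq_zero_of_sum_quadProduct he hf _ c fun t => ?_
    rw [← hT, hc]
    rfl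
  obtain ⟨c, hc⟩ := LinearMap.injective_iff_surjective.1 hinj
    fun t => μ.1 (shiftedMonomial g g' t.2.1 0 t.2.2 t.1)
  have hμ : μ = ∑ u, c u • quadProduct e f he hf u.1 u.2.1 u.2.2 := by
    apply S.ext_shiftedMonomial
    intro i j k
    rw [DistSL2.sum_smul_apply]
    by_cases hijk : i < p ^ K ∧ j < p ^ K ∧ k < p ^ K
    · have := congrFun hc (⟨k, hijk.2.2⟩, ⟨i, hijk.1⟩, ⟨j, hijk.2.1⟩)
      rw [hT] at this
      exact this.symm
    · have hge : p ^ K ≤ i ∨ p ^ K ≤ j ∨ p ^ K ≤ k := by omega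
      rw [Finset.sum_eq_zero fun u _ => by
        rw [S.quadProduct_apply_eq_zero he hf u.1.2 u.2.1.2 u.2.2.2 hge, mul_zero]]
      apply hn
      have hI : ∀ x : CoordRing (ZMod p), Bialgebra.counitAlgHom (ZMod p) (CoordRing (ZMod p)) x = 0 →
          ∀ m, p ^ K ≤ m → x ^ m ∈ augIdeal (ZMod p) (CoordRing (ZMod p)) ^ n := by
        intro x hx m hm
        exact Ideal.pow_le_pow_right (hK.trans hm) (Ideal.pow_mem_pow hx m)
      rw [shiftedMonomial]
      rcases hge with h | h | h
      · refine Ideal.mul_mem_right _ _ (Ideal.mul_mem_right _ _ (Ideal.mul_mem_right _ _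
          (hI _ ?_ _ h)))
        rw [map_sub, map_one, S.counit_coordMatrix]
        simp
      · refine Ideal.mul_mem_right _ _ (Ideal.mul_mem_left _ _ (hI _ ?_ _ h))
        rw [S.counit_coordMatrix]
        simp
      · refine Ideal.mul_mem_left _ _ (hI _ ?_ _ h)
        rw [S.counit_coordMatrix]
        simp
  rw [hμ]
  exact sum_mem fun u _ => Subalgebra.smul_mem _ (quadProduct_mem he hf u.1.2 u.2.1.2 u.2.2.2) _

theorem Standardizes.le_finrank_levelAlgebra (S : Standardizes g g' e f) (he : e.1.det = 0)
    (hf : f.1.det = 0) (K : ℕ)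
    [Module.Finite (ZMod p) (levelAlgebra p (fun k => dividedPow e he (p ^ k))
      (fun k => dividedPow f hf (p ^ k)) K)] :
    p ^ (3 * K) ≤ Module.finrank (ZMod p) (levelAlgebra p (fun k => dividedPow e he (p ^ k))
      (fun k => dividedPow f hf (p ^ k)) K) := by
  let v : Fin (p ^ K) × Fin (p ^ K) × Fin (p ^ K) →
      levelAlgebra p (fun k => dividedPow e he (p ^ k)) (fun k => dividedPow f hf (p ^ k)) K :=
    fun u => ⟨quadProduct e f he hf u.1 u.2.1 u.2.2,
      quadProduct_mem he hf u.1.2 u.2.1.2 u.2.2.2⟩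
  have hv : LinearIndependent (ZMod p) v :=
    LinearIndependent.of_comp (Subalgebra.val _).toLinearMap
      (S.linearIndependent_quadProduct he hf (p ^ K))
  have := hv.fintype_card_le_finrank
  refine le_trans (le_of_eq ?_) this
  simp only [Fintype.card_prod, Fintype.card_fin]
  ring

end Exhaustion

/-! ### p-th powers of sums of elements with the commutation rules of sl₂ -/

section Jacobson

variable {p : ℕ} [Fact p.Prime]

theorem neg_one_pow_mul_choose_sub_one {i : ℕ} (hi : i < p) :
    (-1 : ZMod p) ^ i * ((p - 1).choose i : ZMod p) = 1 := by
  have hp := (Fact.out : p.Prime).pos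
  induction i with
  | zero => simp
  | succ i ih =>
    have h1 : (p - 1).choose i + (p - 1).choose (i + 1) = p.choose (i + 1) := by
      rw [← Nat.choose_succ_succ' (p - 1) i, Nat.sub_add_cancel hp]
    have h2 : ((p.choose (i + 1) : ℕ) : ZMod p) = 0 :=
      (ZMod.natCast_eq_zero_iff _ _).2
        ((Fact.out : p.Prime).dvd_choose_self (Nat.succ_ne_zero i) hi)
    have h3 := ih (by omega)
    have h4 := congrArg (Nat.cast : ℕ → ZMod p) h1
    rw [h2, Nat.cast_add] at h4
    rw [pow_succ, eq_neg_of_add_eq_zero_right h4]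
    linear_combination h3

/-- In characteristic `p`, `(a - b) ^ (p - 1)` is the sum of all `a ^ i * b ^ (p - 1 - i)`. -/
theorem sub_pow_char_sub_one {A : Type*} [Ring A] [Algebra (ZMod p) A] {a b : A}
    (hab : Commute a b) :
    (a - b) ^ (p - 1) = ∑ i ∈ Finset.range p, a ^ i * b ^ (p - 1 - i) := by
  have hp := (Fact.out : p.Prime).pos
  rw [sub_eq_add_neg, hab.neg_right.add_pow, Nat.sub_add_cancel hp]
  refine Finset.sum_congr rfl fun i hi => ?_
  rw [Finset.mem_range] at hi
  have h1 := neg_one_pow_mul_choose_sub_one (p := p) (i := p - 1 - i) (by omega)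
  rw [Nat.choose_symm (by omega)] at h1
  have h2 : ((-1 : A) ^ (p - 1 - i)) * ((p - 1).choose i : A) = 1 := by
    have := congrArg (algebraMap (ZMod p) A) h1
    simpa using this
  rw [neg_pow b, mul_assoc, mul_assoc, ← (Nat.cast_commute ((p - 1).choose i) _).eq, ← mul_assoc _ _ (b ^ _), h2,
    one_mul]

variable {B : Type*} [Ring B]

/-- The derivative of a power, without commutativity. -/
theorem derivative_pow_noncomm (Z : B[X]) (n : ℕ) :
    Polynomial.derivative (Z ^ n) =
      ∑ i ∈ Finset.range n, Z ^ i * Polynomial.derivative Z * Z ^ (n - 1 - i) := by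
  induction n with
  | zero => simp
  | succ n ih =>
    rw [pow_succ, Polynomial.derivative_mul, ih, Finset.sum_range_succ, Finset.sum_mul]
    congr 1
    · refine Finset.sum_congr rfl fun i hi => ?_
      rw [Finset.mem_range] at hi
      rw [mul_assoc _ _ Z, ← pow_succ]
      congr 2
      omega
    · simp

variable [Algebra (ZMod p) B]

/-- Left and right multiplication by Z commute, so the sum is the (p-1)-st power of ad Z; it is also
the derivative of Z^p when w is the derivative of Z. -/
theorem sum_pow_mul_mul_pow (Z w : B) :
    ∑ i ∈ Finset.range p, Z ^ i * w * Z ^ (p - 1 - i) =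
      ((LinearMap.mulLeft (ZMod p) Z - LinearMap.mulRight (ZMod p) Z) ^ (p - 1)) w := by
  rw [sub_pow_char_sub_one (p := p) (LinearMap.commute_mulLeft_right (R := ZMod p) Z Z),
    LinearMap.sum_apply]
  refine Finset.sum_congr rfl fun i _ => ?_
  rw [LinearMap.pow_mulLeft, LinearMap.pow_mulRight, Module.End.mul_apply,
    LinearMap.mulRight_apply, LinearMap.mulLeft_apply, mul_assoc]

/-- The iterated inner derivation of an element with the commutation rules of `sl₂`. -/
theorem ad_pow_of_ad_ad {Z w d b : B} {m : ℕ} (hdZ : Commute d Z) (hbZ : Commute b Z)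
    (hw : Z * (Z * w - w * Z) - (Z * w - w * Z) * Z = 4 * (d * w - b * Z)) :
    ((LinearMap.mulLeft (ZMod p) Z - LinearMap.mulRight (ZMod p) Z) ^ (2 * (m + 1))) w =
      4 ^ (m + 1) * (d ^ m * (d * w - b * Z)) := by
  have had (v : B) : ((LinearMap.mulLeft (ZMod p) Z - LinearMap.mulRight (ZMod p) Z) ^ 2) v =
      Z * (Z * v - v * Z) - (Z * v - v * Z) * Z := by
    rw [pow_two]
    rfl
  have h1 (v : B) : Z * (Z * (d * v) - d * v * Z) - (Z * (d * v) - d * v * Z) * Z =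
      d * (Z * (Z * v - v * Z) - (Z * v - v * Z) * Z) := by
    have h2 (u : B) : Z * (d * u) = d * (Z * u) := by rw [← mul_assoc, ← hdZ.eq, mul_assoc]
    rw [h2, mul_assoc d v Z, ← mul_sub, h2, mul_assoc d, ← mul_sub]
  have h3 : Z * (Z * (b * Z) - b * Z * Z) - (Z * (b * Z) - b * Z * Z) * Z = 0 := by
    rw [← mul_assoc Z b, ← hbZ.eq]
    noncomm_ring
  have h4 : Z * (Z * (d * w - b * Z) - (d * w - b * Z) * Z) -
      (Z * (d * w - b * Z) - (d * w - b * Z) * Z) * Z = 4 * (d * (d * w - b * Z)) := by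
    have h5 : Z * (Z * (d * w - b * Z) - (d * w - b * Z) * Z) -
        (Z * (d * w - b * Z) - (d * w - b * Z) * Z) * Z =
        (Z * (Z * (d * w) - d * w * Z) - (Z * (d * w) - d * w * Z) * Z) -
        (Z * (Z * (b * Z) - b * Z * Z) - (Z * (b * Z) - b * Z * Z) * Z) := by noncomm_ring
    rw [h5, h3, h1, hw, sub_zero]
    noncomm_ring
  generalize hv : d * w - b * Z = v at *
  induction m with
  | zero => rw [zero_add, mul_one, had, hw]; simp
  | succ m ih =>
    have h6 : ∀ n : ℕ, Z * (Z * (d ^ n * v) - d ^ n * v * Z) - (Z * (d ^ n * v) - d ^ n * v * Z) * Z =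
        4 * (d ^ (n + 1) * v) := by
      intro n
      have h7 (u : B) : Z * (d ^ n * u) = d ^ n * (Z * u) := by
        rw [← mul_assoc, ← (hdZ.pow_left n).eq, mul_assoc]
      rw [h7, mul_assoc (d ^ n) v Z, ← mul_sub, h7, mul_assoc (d ^ n), ← mul_sub, h4, pow_succ]
      noncomm_ring
    have h8 (u : B) : Z * (Z * (4 ^ (m + 1) * u) - 4 ^ (m + 1) * u * Z) -
        (Z * (4 ^ (m + 1) * u) - 4 ^ (m + 1) * u * Z) * Z =
        4 ^ (m + 1) * (Z * (Z * u - u * Z) - (Z * u - u * Z) * Z) := by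
      have h9 (t : B) : Z * (4 ^ (m + 1) * t) = 4 ^ (m + 1) * (Z * t) := by
        rw [← mul_assoc, ((Commute.ofNat_right Z 4).pow_right _).eq, mul_assoc]
      rw [h9, mul_assoc _ u Z, ← mul_sub, h9, mul_assoc _ _ Z, ← mul_sub]
    have h10 : 2 * (m + 1 + 1) = 2 + 2 * (m + 1) := by ring
    rw [h10, pow_add, Module.End.mul_apply, ih, had, h8, h6, pow_succ (4 : B) (m + 1), mul_assoc]

theorem commute_map_algebraMap (q : (ZMod p)[X]) (P : B[X]) :
    Commute (q.map (algebraMap (ZMod p) B)) P := by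
  induction q using Polynomial.induction_on' with
  | add a b ha hb => rw [Polynomial.map_add]; exact ha.add_left hb
  | monomial n r =>
    rw [Polynomial.map_monomial, ← Polynomial.C_mul_X_pow_eq_monomial]
    refine Commute.mul_left ?_ (Polynomial.commute_X_pow P n)
    exact Algebra.commutes (A := B[X]) r P

/-- A polynomial of degree at most `p` with zero derivative has only two coefficients. -/
theorem eval_one_of_derivative_eq_zero {G : B[X]} (hG : Polynomial.derivative G = 0)
    (hdeg : G.natDegree ≤ p) : G.eval 1 = G.coeff 0 + G.coeff p := by
  have hp := (Fact.out : p.Prime).pos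
  have h1 : ∀ n ∈ Finset.Ico 1 p, G.coeff n = 0 := by
    intro n hn
    rw [Finset.mem_Ico] at hn
    have h2 := congrArg (fun P : B[X] => P.coeff (n - 1)) hG
    simp only [Polynomial.coeff_derivative, Polynomial.coeff_zero] at h2
    rw [Nat.sub_add_cancel hn.1] at h2
    have h3 : ((n - 1 : ℕ) : B) + 1 = algebraMap (ZMod p) B (n : ZMod p) := by
      rw [map_natCast, ← Nat.cast_succ, Nat.succ_eq_add_one, Nat.sub_add_cancel hn.1]
    have h4 : (n : ZMod p) ≠ 0 := by
      rw [Ne, ZMod.natCast_eq_zero_iff]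
      exact fun h => absurd (Nat.le_of_dvd hn.1 h) (by omega)
    rw [h3, ← Algebra.commutes, ← Algebra.smul_def] at h2
    exact (smul_eq_zero_iff_right h4).1 h2
  rw [Polynomial.eval_eq_sum_range' (Nat.lt_succ_of_le hdeg), Finset.sum_range_succ,
    Finset.range_eq_Ico, Finset.sum_eq_sum_Ico_succ_bot hp,
    Finset.sum_eq_zero fun n hn => by rw [h1 n hn, zero_mul]]
  simp

/-- Additivity of `x ↦ x ^ p - x^[p]` for two elements with the commutation rules of `sl₂`. -/
theorem add_pow_char_sub_of_ad_ad {x y : B} {δx δy β : ZMod p} {m : ℕ} (hm : p = 2 * (m + 1) + 1)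
    (hx : x * (x * y - y * x) - (x * y - y * x) * x = (4 * δx) • y - (4 * β) • x)
    (hy : y * (y * x - x * y) - (y * x - x * y) * y = (4 * δy) • x - (4 * β) • y) :
    (x + y) ^ p - (δx + 2 * β + δy) ^ (m + 1) • (x + y) =
      (x ^ p - δx ^ (m + 1) • x) + (y ^ p - δy ^ (m + 1) • y) := by
  -- On the line Z = Tx + y the defect G = Z^p - d^(m+1) Z turns out to have derivative zero and
  -- degree at most p. So G(1) is the sum of its coefficients at 0 and p, which are the defects of y
  -- and x.
  set Z : B[X] := Polynomial.X * Polynomial.C x + Polynomial.C y with hZ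
  -- This is the quadratic form (minus the determinant, in the case of sl₂) along the line; bF is
  -- half of its derivative.
  set dF : (ZMod p)[X] := Polynomial.C δx * Polynomial.X ^ 2 + Polynomial.C (2 * β) * Polynomial.X +
    Polynomial.C δy with hdF
  set bF : (ZMod p)[X] := Polynomial.C δx * Polynomial.X + Polynomial.C β with hbF
  set d : B[X] := dF.map (algebraMap (ZMod p) B) with hd
  set b : B[X] := bF.map (algebraMap (ZMod p) B) with hb
  have hder_Z : Polynomial.derivative Z = Polynomial.C x := by
    simp [hZ]
  have hZZ : Z * (Z * Polynomial.C x - Polynomial.C x * Z) -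
      (Z * Polynomial.C x - Polynomial.C x * Z) * Z = 4 * (d * Polynomial.C x - b * Z) := by
    have hX (P Q : B[X]) : P * (Polynomial.X * Q) = Polynomial.X * (P * Q) := by
      rw [← mul_assoc, ← Polynomial.X_mul, mul_assoc]
    have h1 : Z * Polynomial.C x - Polynomial.C x * Z = Polynomial.C (y * x - x * y) := by
      rw [hZ, add_mul, mul_add, hX, map_sub, map_mul, map_mul, mul_assoc]
      abel
    have h2 : Z * Polynomial.C (y * x - x * y) - Polynomial.C (y * x - x * y) * Z =
        Polynomial.X * Polynomial.C (x * (y * x - x * y) - (y * x - x * y) * x) +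
          Polynomial.C (y * (y * x - x * y) - (y * x - x * y) * y) := by
      generalize y * x - x * y = w
      rw [hZ, add_mul, mul_add, hX]
      simp only [map_sub, map_mul, mul_sub, mul_assoc]
      abel
    have h3 : x * (y * x - x * y) - (y * x - x * y) * x = (4 * β) • x - (4 * δx) • y := by
      rw [← neg_sub ((4 * δx) • y), ← hx]
      noncomm_ring
    have hC (r : ZMod p) : Polynomial.C (algebraMap (ZMod p) B r) = algebraMap (ZMod p) B[X] r := rfl
    have h4 : d = δx • Polynomial.X ^ 2 + (2 * β) • Polynomial.X + δy • 1 := by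
      simp only [hd, hdF, Polynomial.map_add, Polynomial.map_mul, Polynomial.map_pow,
        Polynomial.map_X, Polynomial.map_C, hC, ← Algebra.smul_def]
      rw [Algebra.algebraMap_eq_smul_one]
    have h5 : b = δx • Polynomial.X + β • 1 := by
      simp only [hb, hbF, Polynomial.map_add, Polynomial.map_mul,
        Polynomial.map_X, Polynomial.map_C, hC, ← Algebra.smul_def]
      rw [Algebra.algebraMap_eq_smul_one]
    have h6 : (4 : B[X]) = (4 : ZMod p) • 1 := by
      rw [← Algebra.algebraMap_eq_smul_one, map_ofNat]
    rw [h1, h2, h3, hy, h4, h5, hZ, h6]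
    simp only [map_sub, ← Polynomial.smul_C, mul_sub, mul_add, add_mul, smul_mul_assoc, one_mul,
      mul_smul_comm, pow_two, mul_assoc]
    module
  have hcast : ((2 * (m + 1) : ℕ) : ZMod p) = -1 := by
    have h1 := congrArg (Nat.cast : ℕ → ZMod p) hm
    rw [CharP.cast_eq_zero, Nat.cast_succ] at h1
    linear_combination -h1
  -- By Fermat, since 4^(m+1) = 2^(p-1).
  have hfour : (4 : B[X]) ^ (m + 1) = 1 := by
    have h2 : (2 : ZMod p) ≠ 0 := by
      have h0 : ((2 : ℕ) : ZMod p) ≠ 0 := by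
        rw [Ne, ZMod.natCast_eq_zero_iff]
        exact fun h => absurd (Nat.le_of_dvd two_pos h) (by omega)
      exact_mod_cast h0
    have h1 := ZMod.pow_card_sub_one_eq_one h2
    have h3 : p - 1 = 2 * (m + 1) := by omega
    rw [h3, pow_mul] at h1
    have h4 := congrArg (algebraMap (ZMod p) B[X]) h1
    rw [map_pow, map_pow, map_ofNat, map_one] at h4
    rw [← h4]
    norm_num
  -- The derivative is (ad Z)^(p-1) x, and (ad Z)² x = 4(dx - bZ), where ad Z kills Z and d is
  -- central.
  have hder_pow : Polynomial.derivative (Z ^ p) = d ^ m * (d * Polynomial.C x - b * Z) := by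
    rw [derivative_pow_noncomm, hder_Z, sum_pow_mul_mul_pow (p := p)]
    have h3 : p - 1 = 2 * (m + 1) := by omega
    rw [h3, ad_pow_of_ad_ad (commute_map_algebraMap _ _) (commute_map_algebraMap _ _) hZZ, hfour,
      one_mul]
  have hder_mul : Polynomial.derivative (d ^ (m + 1) * Z) =
      d ^ m * (d * Polynomial.C x - b * Z) := by
    -- The factor is 2(m + 1) = p - 1 = -1.
    have h1 : Polynomial.derivative (dF ^ (m + 1)) = -(dF ^ m * bF) := by
      have h2 : Polynomial.derivative dF = 2 * bF := by
        have h3 : (Polynomial.C 2 : (ZMod p)[X]) = 2 := map_ofNat Polynomial.C 2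
        simp [hdF, hbF, h3]
        ring
      have h4 := congrArg (Polynomial.C : ZMod p →+* (ZMod p)[X]) hcast
      rw [map_natCast, map_neg, map_one] at h4
      push_cast at h4
      rw [Polynomial.derivative_pow_succ, h2]
      simp only [map_add, map_natCast, map_one]
      linear_combination dF ^ m * bF * h4
    rw [Polynomial.derivative_mul, hder_Z, hd, ← Polynomial.map_pow, Polynomial.derivative_map, h1,
      Polynomial.map_neg, Polynomial.map_mul, Polynomial.map_pow, Polynomial.map_pow, ← hd, ← hb,
      pow_succ]
    noncomm_ring
  set G : B[X] := Z ^ p - d ^ (m + 1) * Z with hG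
  have hder : Polynomial.derivative G = 0 := by
    rw [hG, Polynomial.derivative_sub, hder_pow, hder_mul, sub_self]
  have hZdeg : Z.natDegree ≤ 1 := by
    rw [hZ]
    compute_degree
  have hddeg : d.natDegree ≤ 2 := by
    refine Polynomial.natDegree_map_le.trans ?_
    rw [hdF]
    compute_degree
  have hZpdeg : (Z ^ p).natDegree ≤ p := by
    simpa using Polynomial.natDegree_pow_le_of_le p hZdeg
  have hdmdeg : (d ^ (m + 1)).natDegree ≤ (m + 1) * 2 :=
    Polynomial.natDegree_pow_le_of_le (m + 1) hddeg
  have hdeg : G.natDegree ≤ p := by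
    refine (Polynomial.natDegree_sub_le _ _).trans (max_le hZpdeg ?_)
    exact (Polynomial.natDegree_mul_le_of_le hdmdeg hZdeg).trans (by omega)
  have h0 : G.coeff 0 = y ^ p - δy ^ (m + 1) • y := by
    have h1 : ∀ P : B[X], P.coeff 0 = Polynomial.constantCoeff P := fun _ => rfl
    rw [h1, hG, map_sub, map_pow, map_mul, map_pow, Algebra.smul_def]
    simp [hZ, hd, hdF]
  have hpc : G.coeff p = x ^ p - δx ^ (m + 1) • x := by
    have h1 : (Z ^ p).coeff p = x ^ p := by
      have := Polynomial.coeff_pow_of_natDegree_le (m := p) hZdeg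
      rw [mul_one] at this
      rw [this]
      simp [hZ]
    have h2 : (d ^ (m + 1) * Z).coeff p = δx ^ (m + 1) • x := by
      have h3 : p = (m + 1) * 2 + 1 := by omega
      conv_lhs => rw [h3]
      rw [Polynomial.coeff_mul_add_eq_of_natDegree_le hdmdeg hZdeg,
        Polynomial.coeff_pow_of_natDegree_le hddeg, Algebra.smul_def]
      simp [hZ, hd, hdF, Polynomial.coeff_C]
    rw [hG, Polynomial.coeff_sub, h1, h2]
  have heval : G.eval 1 = (x + y) ^ p - (δx + 2 * β + δy) ^ (m + 1) • (x + y) := by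
    have h1 : ∀ P : B[X], P.eval 1 = Polynomial.eval₂RingHom' (RingHom.id B) 1
        (fun a => Commute.one_right a) P := fun P => rfl
    rw [h1, hG, map_sub, map_pow, map_mul, map_pow, ← h1, ← h1, Algebra.smul_def]
    simp [hZ, hd, hdF]
  rw [← heval, eval_one_of_derivative_eq_zero hder hdeg, h0, hpc, add_comm]

end Jacobson

/-! ### The restricted enveloping algebra: its universal property and dimension -/

section Restricted

open LieAlgebra.SpecialLinear (sl)

variable {p : ℕ} [Fact p.Prime]

/-- The linear combinations of `[x, y]`, `x` and `y`. -/
def sl2Comb {B : Type*} [Ring B] [Algebra (ZMod p) B] (x y : B) (a b c : ZMod p) : B :=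
  a • ⁅x, y⁆ + b • x + c • y

namespace Sl2Relations

variable {B : Type*} [Ring B] [Algebra (ZMod p) B] {x y : B}

theorem sl2Comb_commutator (h : Sl2Relations x y) (a b c a' b' c' : ZMod p) :
    sl2Comb x y a b c * sl2Comb x y a' b' c' - sl2Comb x y a' b' c' * sl2Comb x y a b c =
      sl2Comb x y (b * c' - b' * c) (2 * (a * b' - a' * b)) (2 * (c * a' - c' * a)) := by
  have h1 : ⁅x, y⁆ * x = x * ⁅x, y⁆ + (2 : ZMod p) • x := by
    rw [h.lie_mul_x, ofNat_smul_eq_nsmul]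
    noncomm_ring
  have h2 : ⁅x, y⁆ * y = y * ⁅x, y⁆ - (2 : ZMod p) • y := by
    rw [h.lie_mul_y, ofNat_smul_eq_nsmul]
    noncomm_ring
  have h3 : x * y = y * x + ⁅x, y⁆ := by
    rw [Ring.lie_def]
    abel
  simp only [sl2Comb, mul_add, add_mul, smul_mul_assoc, mul_smul_comm]
  generalize ⁅x, y⁆ = z at *
  rw [h1, h2, h3]
  module

theorem sl2Comb_add (x y : B) (a b c a' b' c' : ZMod p) :
    sl2Comb x y (a + a') (b + b') (c + c') = sl2Comb x y a b c + sl2Comb x y a' b' c' := by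
  simp only [sl2Comb]
  module

theorem sl2Comb_smul (x y : B) (r a b c : ZMod p) :
    sl2Comb x y (r * a) (r * b) (r * c) = r • sl2Comb x y a b c := by
  simp only [sl2Comb]
  module

/-- This provides the hypotheses of `add_pow_char_sub_of_ad_ad`, with δ = a² + bc and 2β the polar
form of the two arguments. -/
theorem sl2Comb_double_commutator (h : Sl2Relations x y) (a b c a' b' c' : ZMod p) :
    sl2Comb x y a b c * (sl2Comb x y a b c * sl2Comb x y a' b' c' -
        sl2Comb x y a' b' c' * sl2Comb x y a b c) -
      (sl2Comb x y a b c * sl2Comb x y a' b' c' -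
        sl2Comb x y a' b' c' * sl2Comb x y a b c) * sl2Comb x y a b c =
    (4 * (a ^ 2 + b * c)) • sl2Comb x y a' b' c' -
      (2 * (2 * (a * a') + b * c' + b' * c)) • sl2Comb x y a b c := by
  rw [h.sl2Comb_commutator, h.sl2Comb_commutator]
  simp only [sl2Comb]
  module

/-- The formula holds for multiples of the three basis elements; two applications of
`add_pow_char_sub_of_ad_ad` add them up. -/
theorem sl2Comb_pow (h : Sl2Relations x y) (hx : x ^ p = 0) (hy : y ^ p = 0)
    (hz : ⁅x, y⁆ ^ p = ⁅x, y⁆) {m : ℕ} (hm : p = 2 * (m + 1) + 1) (a b c : ZMod p) :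
    sl2Comb x y a b c ^ p = (a ^ 2 + b * c) ^ (m + 1) • sl2Comb x y a b c := by
  have h2 : (2 : ZMod p) ≠ 0 := by
    have h0 : ((2 : ℕ) : ZMod p) ≠ 0 := by
      rw [Ne, ZMod.natCast_eq_zero_iff]
      exact fun h => absurd (Nat.le_of_dvd two_pos h) (by omega)
    exact_mod_cast h0
  have hz' : sl2Comb x y a 0 0 ^ p = (a ^ 2) ^ (m + 1) • sl2Comb x y a 0 0 := by
    have h1 : (a ^ 2) ^ (m + 1) * a = a ^ p := by rw [← pow_mul, ← pow_succ, ← hm]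
    simp only [sl2Comb, zero_smul, add_zero]
    rw [smul_pow, hz, smul_smul, h1]
  have hx' : sl2Comb x y 0 b 0 ^ p = 0 := by
    simp [sl2Comb, smul_pow, hx]
  have hy' : sl2Comb x y 0 0 c ^ p = 0 := by
    simp [sl2Comb, smul_pow, hy]
  have hzx := add_pow_char_sub_of_ad_ad (x := sl2Comb x y a 0 0) (y := sl2Comb x y 0 b 0)
    (δx := a ^ 2) (δy := 0) (β := 0) hm
    (by rw [h.sl2Comb_double_commutator]; congr 2 <;> ring)
    (by rw [h.sl2Comb_double_commutator]; congr 2 <;> ring)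
  rw [← sl2Comb_add, hz', hx', sub_self, zero_pow m.succ_ne_zero, zero_smul, sub_zero,
    add_zero (0 : B), sub_eq_zero] at hzx
  simp only [add_zero, zero_add, mul_zero] at hzx
  -- The last summand has δ = 0, so the quadratic form of the sum exceeds a² by 2β, which must be
  -- bc.
  obtain ⟨β, hβ⟩ : ∃ β, 2 * β = b * c := ⟨b * c / 2, by field_simp⟩
  have hzxy := add_pow_char_sub_of_ad_ad (x := sl2Comb x y a b 0) (y := sl2Comb x y 0 0 c)
    (δx := a ^ 2) (δy := 0) (β := β) hm
    (by rw [h.sl2Comb_double_commutator]; congr 2 <;> first | ring1 | linear_combination (-2) * hβ)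
    (by rw [h.sl2Comb_double_commutator]; congr 2 <;> first | ring1 | linear_combination (-2) * hβ)
  rw [← sl2Comb_add, hzx, hy', sub_self, zero_pow m.succ_ne_zero, zero_smul, sub_zero,
    add_zero (0 : B), sub_eq_zero, hβ] at hzxy
  simpa only [add_zero, zero_add] using hzxy

end Sl2Relations

theorem sl_mul_self {R : Type*} [CommRing R] (x : sl (Fin 2) R) : x.1 * x.1 = (-x.1.det) • 1 := by
  have htr : x.1 1 1 = - x.1 0 0 := by
    have h : Matrix.trace x.1 = 0 := x.2
    rw [Matrix.trace_fin_two] at h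
    linear_combination h
  rw [Matrix.det_fin_two, htr]
  ext i j
  fin_cases i <;> fin_cases j <;> simp [Matrix.mul_apply, Fin.sum_univ_two, htr] <;> ring

theorem sl_pow {R : Type*} [CommRing R] (x : sl (Fin 2) R) (m : ℕ) :
    x.1 ^ (2 * m + 1) = (-x.1.det) ^ m • x.1 := by
  rw [pow_succ, pow_mul, pow_two, sl_mul_self, smul_pow, one_pow, smul_mul_assoc, one_mul]

attribute [local instance] LieRing.ofAssociativeRing

variable {g g' : Matrix (Fin 2) (Fin 2) (ZMod p)} {e f : sl (Fin 2) (ZMod p)}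
  {B : Type*} [Ring B] [Algebra (ZMod p) B] {x y : B}

namespace Standardizes

theorem conj_apply_one_one (S : Standardizes g g' e f) (u : sl (Fin 2) (ZMod p)) :
    (g' * u.1 * g) 1 1 = -(g' * u.1 * g) 0 0 := by
  have h : Matrix.trace u.1 = 0 := u.2
  have h1 : Matrix.trace (g' * u.1 * g) = 0 := by
    rw [Matrix.trace_mul_comm, ← mul_assoc, S.mul_eq, one_mul, h]
  rw [Matrix.trace_fin_two] at h1
  linear_combination h1

theorem conj_mul (S : Standardizes g g' e f) (u v : Matrix (Fin 2) (Fin 2) (ZMod p)) :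
    g' * (u * v) * g = (g' * u * g) * (g' * v * g) := by
  have : (g' * u * g) * (g' * v * g) = g' * u * (g * g') * v * g := by noncomm_ring
  rw [this, S.mul_eq]
  noncomm_ring

theorem det_conj (S : Standardizes g g' e f) (u : Matrix (Fin 2) (Fin 2) (ZMod p)) :
    (g' * u * g).det = u.det := by
  rw [Matrix.det_mul, Matrix.det_mul, mul_right_comm, ← Matrix.det_mul, S.mul_eq',
    Matrix.det_one, one_mul]

/-- The homomorphism of Lie algebras from `sl₂` defined by a pair of elements with the commutation
rules of a standard basis. -/
def lieHom (S : Standardizes g g' e f) (h : Sl2Relations x y) : sl (Fin 2) (ZMod p) →ₗ⁅ZMod p⁆ B where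
  toFun u := sl2Comb x y ((g' * u.1 * g) 0 0) ((g' * u.1 * g) 0 1) ((g' * u.1 * g) 1 0)
  map_add' u v := by
    rw [← Sl2Relations.sl2Comb_add]
    congr 1 <;> simp [mul_add, add_mul]
  map_smul' r u := by
    rw [RingHom.id_apply, ← Sl2Relations.sl2Comb_smul]
    congr 1 <;> simp
  map_lie' := by
    intro u v
    rw [Ring.lie_def, h.sl2Comb_commutator]
    have h1 : g' * (⁅u, v⁆ : sl (Fin 2) (ZMod p)).1 * g =
        (g' * u.1 * g) * (g' * v.1 * g) - (g' * v.1 * g) * (g' * u.1 * g) := by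
      rw [LieAlgebra.SpecialLinear.sl_bracket, mul_sub, sub_mul, S.conj_mul, S.conj_mul]
    have hu := S.conj_apply_one_one u
    have hv := S.conj_apply_one_one v
    rw [h1]
    congr 1 <;> simp only [Matrix.sub_apply, Matrix.mul_apply (M := g' * u.1 * g),
      Matrix.mul_apply (M := g' * v.1 * g), Fin.sum_univ_two, hu, hv] <;> ring

theorem lieHom_apply (S : Standardizes g g' e f) (h : Sl2Relations x y)
    (u : sl (Fin 2) (ZMod p)) : S.lieHom h u =
      sl2Comb x y ((g' * u.1 * g) 0 0) ((g' * u.1 * g) 0 1) ((g' * u.1 * g) 1 0) := rfl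

theorem lieHom_e (S : Standardizes g g' e f) (h : Sl2Relations x y) : S.lieHom h e = x := by
  simp [lieHom_apply, S.conj_e, sl2Comb]

theorem lieHom_f (S : Standardizes g g' e f) (h : Sl2Relations x y) : S.lieHom h f = y := by
  simp [lieHom_apply, S.conj_f, sl2Comb]

/-- For matrices of trace zero u^p = (-det u)^((p-1)/2) u; in the adapted coordinates -det u is a² +
bc, so this matches `sl2Comb_pow`. -/
theorem lieHom_pow (S : Standardizes g g' e f) (h : Sl2Relations x y) (hx : x ^ p = 0)
    (hy : y ^ p = 0) (hz : ⁅x, y⁆ ^ p = ⁅x, y⁆) (hp : 3 ≤ p) {u v : sl (Fin 2) (ZMod p)}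
    (huv : v.1 = u.1 ^ p) : S.lieHom h u ^ p = S.lieHom h v := by
  obtain ⟨m, hm⟩ : ∃ m, p = 2 * (m + 1) + 1 := by
    obtain ⟨k, hk⟩ := (Fact.out : p.Prime).odd_of_ne_two (by omega)
    exact ⟨k - 1, by omega⟩
  have hdet : (g' * u.1 * g) 0 0 ^ 2 + (g' * u.1 * g) 0 1 * (g' * u.1 * g) 1 0 = -u.1.det := by
    rw [← S.det_conj, Matrix.det_fin_two, S.conj_apply_one_one]
    ring
  have hv : v = (-u.1.det) ^ (m + 1) • u := by
    apply Subtype.ext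
    have h1 := sl_pow u (m + 1)
    rw [← hm] at h1
    rw [huv, h1]
    rfl
  rw [hv, map_smul, S.lieHom_apply h u, h.sl2Comb_pow hx hy hz hm, hdet]

/-- The universal property of the restricted enveloping algebra of `sl₂`, in terms of a standard
basis. -/
theorem exists_restrictedEnv_algHom (S : Standardizes g g' e f) (h : Sl2Relations x y)
    (hx : x ^ p = 0) (hy : y ^ p = 0) (hz : ⁅x, y⁆ ^ p = ⁅x, y⁆) (hp : 3 ≤ p) :
    ∃ ψ : RestrictedEnv p →ₐ[ZMod p] B, ψ (restrictedι p e) = x ∧ ψ (restrictedι p f) = y := by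
  refine ⟨RingQuot.liftAlgHom (ZMod p)
    ⟨UniversalEnvelopingAlgebra.lift (ZMod p) (S.lieHom h), ?_⟩, ?_, ?_⟩
  · rintro _ _ ⟨u, v, huv⟩
    rw [map_pow, UniversalEnvelopingAlgebra.lift_ι_apply, UniversalEnvelopingAlgebra.lift_ι_apply,
      S.lieHom_pow h hx hy hz hp huv]
  · rw [restrictedι, RingQuot.liftAlgHom_mkAlgHom_apply, UniversalEnvelopingAlgebra.lift_ι_apply,
      S.lieHom_e]
  · rw [restrictedι, RingQuot.liftAlgHom_mkAlgHom_apply, UniversalEnvelopingAlgebra.lift_ι_apply,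
      S.lieHom_f]

theorem eq_comb (S : Standardizes g g' e f) (u : sl (Fin 2) (ZMod p)) :
    u = (g' * u.1 * g) 0 0 • ⁅e, f⁆ + (g' * u.1 * g) 0 1 • e + (g' * u.1 * g) 1 0 • f := by
  have h1 : g' * ((g' * u.1 * g) 0 0 • ⁅e, f⁆ + (g' * u.1 * g) 0 1 • e +
      (g' * u.1 * g) 1 0 • f : sl (Fin 2) (ZMod p)).1 * g = g' * u.1 * g := by
    change g' * ((g' * u.1 * g) 0 0 • (⁅e, f⁆ : sl (Fin 2) (ZMod p)).1 +
      (g' * u.1 * g) 0 1 • e.1 + (g' * u.1 * g) 1 0 • f.1) * g = _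
    simp only [mul_add, add_mul, mul_smul_comm, smul_mul_assoc]
    rw [LieAlgebra.SpecialLinear.sl_bracket, mul_sub, sub_mul, S.conj_mul, S.conj_mul, S.conj_e,
      S.conj_f]
    have hu := S.conj_apply_one_one u
    generalize g' * u.1 * g = M at *
    ext i j
    fin_cases i <;> fin_cases j <;> simp [hu]
  have h2 (v : Matrix (Fin 2) (Fin 2) (ZMod p)) : v = g * (g' * v * g) * g' := by
    have : g * (g' * v * g) * g' = (g * g') * v * (g * g') := by noncomm_ring
    rw [this, S.mul_eq, one_mul, mul_one]
  apply Subtype.ext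
  exact (h2 _).trans ((congrArg (fun v => g * v * g') h1.symm).trans (h2 _).symm)

end Standardizes

theorem restrictedι_lie {p : ℕ} (u v : sl (Fin 2) (ZMod p)) :
    restrictedι p ⁅u, v⁆ = ⁅restrictedι p u, restrictedι p v⁆ := by
  rw [restrictedι, LieHom.map_lie, Ring.lie_def, Ring.lie_def, map_sub, map_mul, map_mul]
  rfl

theorem restrictedι_add (u v : sl (Fin 2) (ZMod p)) :
    restrictedι p (u + v) = restrictedι p u + restrictedι p v := by
  rw [restrictedι, map_add, map_add]
  rfl

theorem restrictedι_smul (r : ZMod p) (u : sl (Fin 2) (ZMod p)) :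
    restrictedι p (r • u) = r • restrictedι p u := by
  rw [restrictedι, map_smul, map_smul]
  rfl

theorem restrictedι_pow {u v : sl (Fin 2) (ZMod p)} (huv : v.1 = u.1 ^ p) :
    restrictedι p u ^ p = restrictedι p v := by
  rw [restrictedι, ← map_pow]
  exact RingQuot.mkAlgHom_rel _ (RestrictedRel.pow u v huv)

/-- A subalgebra containing the image of sl₂ is everything: by the universal property the quotient
map from the enveloping algebra factors through it. -/
theorem adjoin_restrictedι (s : Set (sl (Fin 2) (ZMod p)))
    (hs : ∀ u, restrictedι p u ∈ Algebra.adjoin (ZMod p) (restrictedι p '' s)) :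
    Algebra.adjoin (ZMod p) (restrictedι p '' s) = ⊤ := by
  set A := Algebra.adjoin (ZMod p) (restrictedι p '' s)
  let ρ : sl (Fin 2) (ZMod p) →ₗ⁅ZMod p⁆ A :=
    { toFun := fun u => ⟨restrictedι p u, hs u⟩
      map_add' := fun u v => Subtype.ext (restrictedι_add u v)
      map_smul' := fun r u => Subtype.ext (restrictedι_smul r u)
      map_lie' := fun {u v} => Subtype.ext (restrictedι_lie u v) }
  have h1 : A.val.comp (UniversalEnvelopingAlgebra.lift (ZMod p) ρ) =
      RingQuot.mkAlgHom (ZMod p) (RestrictedRel p) := by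
    apply UniversalEnvelopingAlgebra.hom_ext
    ext u
    change ((UniversalEnvelopingAlgebra.lift (ZMod p) ρ
      (UniversalEnvelopingAlgebra.ι (ZMod p) u) : A) : RestrictedEnv p) = _
    rw [UniversalEnvelopingAlgebra.lift_ι_apply]
    rfl
  rw [eq_top_iff]
  intro w _
  obtain ⟨t, rfl⟩ := RingQuot.mkAlgHom_surjective (ZMod p) (RestrictedRel p) w
  rw [← h1]
  exact SetLike.coe_mem _

namespace Standardizes

theorem adjoin_restrictedι_eq_top (S : Standardizes g g' e f) :
    Algebra.adjoin (ZMod p) {restrictedι p e, restrictedι p f} = ⊤ := by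
  have he : restrictedι p e ∈ Algebra.adjoin (ZMod p) {restrictedι p e, restrictedι p f} :=
    Algebra.subset_adjoin (by simp)
  have hf : restrictedι p f ∈ Algebra.adjoin (ZMod p) {restrictedι p e, restrictedι p f} :=
    Algebra.subset_adjoin (by simp)
  rw [← Set.image_pair] at he hf ⊢
  refine adjoin_restrictedι _ fun u => ?_
  rw [S.eq_comb u, restrictedι_add, restrictedι_add, restrictedι_smul, restrictedι_smul,
    restrictedι_smul, restrictedι_lie, Ring.lie_def]
  exact add_mem (add_mem (Subalgebra.smul_mem _ (sub_mem (mul_mem he hf) (mul_mem hf he)) _)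
    (Subalgebra.smul_mem _ he _)) (Subalgebra.smul_mem _ hf _)

/-- The p-operation kills e and f and fixes h (as -det h = 1), so the straightening bound for one
level applies. -/
theorem finrank_restrictedEnv_le (S : Standardizes g g' e f) {h : sl (Fin 2) (ZMod p)}
    (ht : IsSl2Triple h e f) (hp : 3 ≤ p) :
    Module.Finite (ZMod p) (RestrictedEnv p) ∧
      Module.finrank (ZMod p) (RestrictedEnv p) ≤ p ^ 3 := by
  have hnil {u : sl (Fin 2) (ZMod p)} (hu : u.1.det = 0) : restrictedι p u ^ p = 0 := by
    have h1 := restrictedι_smul (p := p) 0 u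
    rw [zero_smul, zero_smul] at h1
    rw [← h1]
    refine restrictedι_pow ?_
    obtain ⟨k, hk⟩ := Nat.exists_eq_add_of_le (show 2 ≤ p by omega)
    have h2 : u.1 ^ (2 + k) = 0 := by
      rw [pow_add, pow_two, sl_mul_self, hu, neg_zero, zero_smul, zero_mul]
    rw [← hk] at h2
    rw [h2]
    rfl
  have hss : restrictedι p h ^ p = restrictedι p h := by
    refine restrictedι_pow ?_
    have hdet : -h.1.det = 1 := by
      rw [← S.det_conj, ← ht.lie_e_f, LieAlgebra.SpecialLinear.sl_bracket, mul_sub, sub_mul,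
        S.conj_mul, S.conj_mul, S.conj_e, S.conj_f]
      simp [Matrix.det_fin_two]
    obtain ⟨k, hk⟩ := (Fact.out : p.Prime).odd_of_ne_two (by omega)
    have h1 := sl_pow h k
    rw [← hk, hdet, one_pow, one_smul] at h1
    exact h1.symm
  have hlie : ⁅restrictedι p e, restrictedι p f⁆ = restrictedι p h := by
    rw [← restrictedι_lie, ht.lie_e_f]
  have hsl2 : Sl2Relations (restrictedι p e) (restrictedι p f) := by
    constructor
    · rw [hlie, ← restrictedι_lie, ht.lie_h_e_nsmul, two_nsmul, restrictedι_add, two_mul]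
    · rw [hlie, ← restrictedι_lie, ht.lie_h_f_nsmul]
      have h1 : -(2 • f) = (-1 : ZMod p) • (f + f) := by rw [two_nsmul, neg_smul, one_smul]
      rw [h1, restrictedι_smul, restrictedι_add, neg_smul, one_smul, neg_mul, two_mul]
  have h1 := hsl2.finrank_adjoin_le (hnil (det_eq_zero_of_triple hp ht))
    (hnil (det_eq_zero_of_triple hp ht.symm)) (by rw [hlie, hss])
  rw [S.adjoin_restrictedι_eq_top] at h1
  obtain ⟨h2, h3⟩ := h1
  refine ⟨Module.Finite.equiv Subalgebra.topEquiv.toLinearEquiv, ?_⟩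
  rwa [← Subalgebra.topEquiv.toLinearEquiv.finrank_eq]

end Standardizes
end Restricted

/-! ### The presented algebra and the criterion for injectivity -/

section Presentation

variable {p : ℕ} [Fact p.Prime]

/-- The generators of the presented algebra satisfy the relations. -/
theorem hyperRelations_presented :
    HyperRelations p (fun k => RingQuot.mkAlgHom (ZMod p) (Rel p) (genE p k))
      (fun k => RingQuot.mkAlgHom (ZMod p) (Rel p) (genF p k)) := by
  set π := RingQuot.mkAlgHom (ZMod p) (Rel p) with hπ
  have hrel {a b : FreeAlgebra (ZMod p) Gen} (hab : Rel p a b) : π a = π b :=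
    RingQuot.mkAlgHom_rel _ hab
  have hlie (a b : FreeAlgebra (ZMod p) Gen) : π ⁅a, b⁆ = ⁅π a, π b⁆ := by
    rw [Ring.lie_def, Ring.lie_def, map_sub, map_mul, map_mul]
  have hX (k : ℕ) : ⁅π (genE p k), π (genF p k)⁆ = π (genX p k) := (hlie _ _).symm
  have hE (k n : ℕ) : ((List.range n).map fun i => π (genE p (k + i)) ^ (p - 1)).prod =
      π (prodE p k n) := by
    rw [prodE, map_list_prod, List.map_map]
    simp [Function.comp_def]
  have hF (k n : ℕ) : ((List.range n).map fun i => π (genF p (k + i)) ^ (p - 1)).prod =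
      π (prodF p k n) := by
    rw [prodF, map_list_prod, List.map_map]
    simp [Function.comp_def]
  have h2 : π 2 = 2 := map_ofNat π 2
  refine ⟨fun k => ⟨?_, ?_⟩, fun k n hn => ?_, fun k n hn => ?_, fun k n hn => ?_,
    fun k n hn => ?_, fun k n hn => ?_, fun k n hn => ?_, fun k => ?_, fun k => ?_, fun k => ?_⟩
  · simpa [hlie, hX, h2] using hrel (Rel.rel1_e k)
  · simpa only [hlie, hX, h2, map_mul, map_neg] using hrel (Rel.rel1_f k)
  · simpa [hlie, hX] using hrel (Rel.rel2_e k n hn)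
  · simpa [hlie, hX] using hrel (Rel.rel2_f k n hn)
  · simpa [hlie, hX] using hrel (Rel.rel3_e k n hn)
  · simpa [hlie, hX] using hrel (Rel.rel3_f k n hn)
  · simpa [hlie, hX, hF] using hrel (Rel.rel4_f k n hn)
  · simpa [hlie, hX, hE] using hrel (Rel.rel4_e k n hn)
  · simpa using hrel (Rel.rel5_e k)
  · simpa using hrel (Rel.rel5_f k)
  · simpa [hlie, hX] using hrel (Rel.rel6 k)

variable {B : Type*} [Ring B] [Algebra (ZMod p) B] {e f : ℕ → B}

/-- The universal property of the presented algebra. -/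
theorem HyperRelations.exists_algHom (h : HyperRelations p e f) :
    ∃ φ : Presented p →ₐ[ZMod p] B, ∀ k, φ (RingQuot.mkAlgHom (ZMod p) (Rel p) (genE p k)) = e k ∧
      φ (RingQuot.mkAlgHom (ZMod p) (Rel p) (genF p k)) = f k := by
  let φ₀ : FreeAlgebra (ZMod p) Gen →ₐ[ZMod p] B :=
    FreeAlgebra.lift (ZMod p) fun | Gen.e k => e k | Gen.f k => f k
  have hE (k : ℕ) : φ₀ (genE p k) = e k := FreeAlgebra.lift_ι_apply _ _
  have hF (k : ℕ) : φ₀ (genF p k) = f k := FreeAlgebra.lift_ι_apply _ _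
  have hlie (a b : FreeAlgebra (ZMod p) Gen) : φ₀ ⁅a, b⁆ = ⁅φ₀ a, φ₀ b⁆ := by
    rw [Ring.lie_def, Ring.lie_def, map_sub, map_mul, map_mul]
  have hX (k : ℕ) : φ₀ (genX p k) = ⁅e k, f k⁆ := by rw [genX, hlie, hE, hF]
  have hprodE (k n : ℕ) : φ₀ (prodE p k n) =
      ((List.range n).map fun i => e (k + i) ^ (p - 1)).prod := by
    rw [prodE, map_list_prod, List.map_map]
    simp [Function.comp_def, hE]
  have hprodF (k n : ℕ) : φ₀ (prodF p k n) =
      ((List.range n).map fun i => f (k + i) ^ (p - 1)).prod := by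
    rw [prodF, map_list_prod, List.map_map]
    simp [Function.comp_def, hF]
  refine ⟨RingQuot.liftAlgHom (ZMod p) ⟨φ₀, ?_⟩, fun k => ?_⟩
  · intro a b hab
    induction hab <;>
      simp only [hlie, hX, hE, hF, hprodE, hprodF, map_mul, map_pow, map_neg, map_one, map_zero,
        map_add, map_ofNat]
    · exact (h.sl2 _).lie_x
    · exact (h.sl2 _).lie_y
    · exact h.lie_lie_e _ _ ‹_›
    · exact h.lie_lie_f _ _ ‹_›
    · exact h.lie_e_e _ _ ‹_›
    · exact h.lie_f_f _ _ ‹_›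
    · exact h.lie_e_f _ _ ‹_›
    · exact h.lie_f_e _ _ ‹_›
    · exact h.e_pow _
    · exact h.f_pow _
    · exact h.lie_pow _
  · rw [RingQuot.liftAlgHom_mkAlgHom_apply, RingQuot.liftAlgHom_mkAlgHom_apply, hE, hF]
    exact ⟨rfl, rfl⟩

theorem levelAlgebra_mono (e f : ℕ → B) : Monotone (levelAlgebra p e f) := fun _ _ h =>
  Algebra.adjoin_mono (Set.union_subset_union (Set.image_mono (Set.Iio_subset_Iio h))
    (Set.image_mono (Set.Iio_subset_Iio h)))

theorem exists_mem_levelAlgebra_presented (w : Presented p) :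
    ∃ K, w ∈ levelAlgebra p (fun k => RingQuot.mkAlgHom (ZMod p) (Rel p) (genE p k))
      (fun k => RingQuot.mkAlgHom (ZMod p) (Rel p) (genF p k)) K := by
  obtain ⟨t, rfl⟩ := RingQuot.mkAlgHom_surjective (ZMod p) (Rel p) w
  have hmono := levelAlgebra_mono (p := p)
    (fun k => RingQuot.mkAlgHom (ZMod p) (Rel p) (genE p k))
    (fun k => RingQuot.mkAlgHom (ZMod p) (Rel p) (genF p k))
  induction t using FreeAlgebra.induction with
  | grade0 r => exact ⟨0, by rw [AlgHom.commutes]; exact algebraMap_mem _ r⟩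
  | grade1 x =>
    cases x with
    | e k => exact ⟨k + 1, HyperRelations.e_mem p _ _ k.lt_succ_self⟩
    | f k => exact ⟨k + 1, HyperRelations.f_mem p _ _ k.lt_succ_self⟩
  | mul a b ha hb =>
    obtain ⟨K, hK⟩ := ha
    obtain ⟨M, hM⟩ := hb
    exact ⟨max K M, by
      rw [map_mul]
      exact mul_mem (hmono (le_max_left K M) hK) (hmono (le_max_right K M) hM)⟩
  | add a b ha hb =>
    obtain ⟨K, hK⟩ := ha
    obtain ⟨M, hM⟩ := hb
    exact ⟨max K M, by
      rw [map_add]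
      exact add_mem (hmono (le_max_left K M) hK) (hmono (le_max_right K M) hM)⟩

theorem map_levelAlgebra {C : Type*} [Ring C] [Algebra (ZMod p) C] (φ : B →ₐ[ZMod p] C)
    (e f : ℕ → B) (K : ℕ) : (levelAlgebra p e f K).map φ =
      levelAlgebra p (fun k => φ (e k)) (fun k => φ (f k)) K := by
  rw [levelAlgebra, AlgHom.map_adjoin, Set.image_union, Set.image_image, Set.image_image]
  rfl

/-- A homomorphism is injective on a finite-dimensional subalgebra whose image is not smaller. -/
theorem injOn_of_finrank_le {F V W : Type*} [Field F] [Ring V] [Algebra F V]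
    [Ring W] [Algebra F W] (φ : V →ₐ[F] W) (U : Subalgebra F V) [Module.Finite F U]
    (h : Module.finrank F U ≤ Module.finrank F (U.map φ)) : Set.InjOn φ U := by
  have h1 := LinearMap.finrank_range_add_finrank_ker
    (φ.toLinearMap.domRestrict (Subalgebra.toSubmodule U))
  have h3 : Module.finrank F (U.map φ) =
    Module.finrank F ((Subalgebra.toSubmodule U).map φ.toLinearMap) := rfl
  have h4 : Module.finrank F U = Module.finrank F (Subalgebra.toSubmodule U) := rfl
  rw [LinearMap.range_domRestrict] at h1
  have h2 : Module.finrank F (LinearMap.ker (φ.toLinearMap.domRestrict (Subalgebra.toSubmodule U))) = 0 := by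
    omega
  rw [Submodule.finrank_eq_zero, LinearMap.ker_eq_bot] at h2
  intro a ha b hb hab
  exact congrArg Subtype.val (@h2 ⟨a, ha⟩ ⟨b, hb⟩ hab)

theorem injective_of_finrank_le {F V W : Type*} [Field F] [Ring V] [Algebra F V]
    [Ring W] [Algebra F W] (φ : V →ₐ[F] W) [Module.Finite F V]
    (h : Module.finrank F V ≤ Module.finrank F φ.range) : Function.Injective φ := by
  have h1 := injOn_of_finrank_le φ ⊤ (by
    rwa [Subalgebra.topEquiv.toLinearEquiv.finrank_eq, Algebra.map_top])
  exact fun a b hab => h1 (Set.mem_univ a) (Set.mem_univ b) hab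

/-- On each level algebra the dimension of the source is at most p^(3K), so an image of at least
this dimension leaves no kernel; the level algebras exhaust B. -/
theorem HyperRelations.injective {C : Type*} [Ring C] [Algebra (ZMod p) C]
    (h : HyperRelations p e f) (hmem : ∀ w, ∃ K, w ∈ levelAlgebra p e f K) (φ : B →ₐ[ZMod p] C)
    (hφ : ∀ K, p ^ (3 * K) ≤
      Module.finrank (ZMod p) (levelAlgebra p (fun k => φ (e k)) (fun k => φ (f k)) K)) :
    Function.Injective φ := by
  rw [injective_iff_map_eq_zero]
  intro w hw
  obtain ⟨K, hK⟩ := hmem w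
  obtain ⟨h1, h2⟩ := h.finrank_levelAlgebra_le K
  have h4 := hφ K
  rw [← map_levelAlgebra] at h4
  exact injOn_of_finrank_le φ _ (h2.trans h4) hK (zero_mem _) (hw.trans (map_zero φ).symm)

end Presentation

/-! ### The two isomorphisms -/

section Main

open LieAlgebra.SpecialLinear (sl)

variable {p : ℕ} [Fact p.Prime]

theorem exists_presented_algEquiv (hp : 3 ≤ p) {h e f : sl (Fin 2) (ZMod p)}
    (ht : IsSl2Triple h e f) :
    ∃ Φ : Presented p ≃ₐ[ZMod p] DistSL2 (ZMod p), ∀ k : ℕ,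
      Φ (RingQuot.mkAlgHom (ZMod p) (Rel p) (genE p k)) =
        dividedPow e (det_eq_zero_of_triple hp ht) (p ^ k) ∧
      Φ (RingQuot.mkAlgHom (ZMod p) (Rel p) (genF p k)) =
        dividedPow f (det_eq_zero_of_triple hp ht.symm) (p ^ k) := by
  obtain ⟨g, g', S⟩ := exists_standardizes hp ht
  have hD := (dividedPowerPair_dividedPow hp ht).hyperRelations hp
  obtain ⟨φ, hφ⟩ := hD.exists_algHom
  have hmap (K : ℕ) := map_levelAlgebra φ
    (fun k => RingQuot.mkAlgHom (ZMod p) (Rel p) (genE p k))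
    (fun k => RingQuot.mkAlgHom (ZMod p) (Rel p) (genF p k)) K
  simp only [(hφ _).1, (hφ _).2] at hmap
  have hsurj : Function.Surjective φ := by
    intro μ
    obtain ⟨K, hK⟩ := S.exists_mem_levelAlgebra (det_eq_zero_of_triple hp ht)
      (det_eq_zero_of_triple hp ht.symm) μ
    rw [← hmap] at hK
    obtain ⟨w, -, hw⟩ := hK
    exact ⟨w, hw⟩
  have hinj : Function.Injective φ := by
    refine (hyperRelations_presented (p := p)).injective (B := Presented p)
      (C := DistSL2 (ZMod p)) exists_mem_levelAlgebra_presented φ fun K => ?_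
    obtain ⟨h1, -⟩ := hD.finrank_levelAlgebra_le K
    have h2 := S.le_finrank_levelAlgebra (det_eq_zero_of_triple hp ht)
      (det_eq_zero_of_triple hp ht.symm) K
    have h3 := fun k => (hφ k).1
    have h4 := fun k => (hφ k).2
    rwa [← funext h3, ← funext h4] at h2
  exact ⟨AlgEquiv.ofBijective φ ⟨hinj, hsurj⟩, hφ⟩

theorem exists_restrictedEnv_injective (hp : 3 ≤ p) {h e f : sl (Fin 2) (ZMod p)}
    (ht : IsSl2Triple h e f) (k : ℕ) :
    ∃ ψ : RestrictedEnv p →ₐ[ZMod p] DistSL2 (ZMod p), Function.Injective ψ ∧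
      ψ (restrictedι p e) = dividedPow e (det_eq_zero_of_triple hp ht) (p ^ k) ∧
      ψ (restrictedι p f) = dividedPow f (det_eq_zero_of_triple hp ht.symm) (p ^ k) ∧
      ψ.range = Algebra.adjoin (ZMod p)
        {dividedPow e (det_eq_zero_of_triple hp ht) (p ^ k),
          dividedPow f (det_eq_zero_of_triple hp ht.symm) (p ^ k)} := by
  obtain ⟨g, g', S⟩ := exists_standardizes hp ht
  have hD := (dividedPowerPair_dividedPow hp ht).hyperRelations hp
  obtain ⟨ψ, he, hf⟩ := S.exists_restrictedEnv_algHom (hD.sl2 k) (hD.e_pow k) (hD.f_pow k)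
    (hD.lie_pow k) hp
  have hrange : ψ.range = Algebra.adjoin (ZMod p)
        {dividedPow e (det_eq_zero_of_triple hp ht) (p ^ k),
          dividedPow f (det_eq_zero_of_triple hp ht.symm) (p ^ k)} := by
    rw [← Algebra.map_top, ← S.adjoin_restrictedι_eq_top, AlgHom.map_adjoin, Set.image_pair, he, hf]
  refine ⟨ψ, ?_, he, hf, hrange⟩
  obtain ⟨h1, h2⟩ := S.finrank_restrictedEnv_le ht hp
  obtain ⟨h3, -⟩ := hD.finrank_levelAlgebra_le (k + 1)
  -- Hence p^(3(k+1)) ≤ dim(level k) · p^(3k), and level k, the image of the map, has dimension at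
  -- least p^3.
  have h4 := (S.le_finrank_levelAlgebra (det_eq_zero_of_triple hp ht)
      (det_eq_zero_of_triple hp ht.symm) (k + 1)).trans (hD.finrank_levelAlgebra_succ_le k)
  rw [mul_add, mul_one, pow_add, mul_comm] at h4
  have h5 := Nat.le_of_mul_le_mul_right h4 (pow_pos (Fact.out : p.Prime).pos _)
  rw [← hrange] at h5
  have h6 : Module.finrank (ZMod p) (RestrictedEnv p) ≤ Module.finrank (ZMod p) ψ.range :=
    h2.trans h5
  have h7 := @injective_of_finrank_le (ZMod p) (RestrictedEnv p) (DistSL2 (ZMod p)) _ _ _ _ _ ψ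
  exact h7 h6

end Main

end SL2Dist
end

theorem theorem1 (p : ℕ) [Fact p.Prime] (hp : 3 ≤ p)
    (h e f : LieAlgebra.SpecialLinear.sl (Fin 2) (ZMod p)) (ht : IsSl2Triple h e f) :
    (∃ Φ : SL2Dist.Presented p ≃ₐ[ZMod p] SL2Dist.DistSL2 (ZMod p), ∀ k : ℕ,
      Φ (RingQuot.mkAlgHom (ZMod p) (SL2Dist.Rel p) (SL2Dist.genE p k)) =
        SL2Dist.dividedPow e (SL2Dist.det_eq_zero_of_triple hp ht) (p ^ k) ∧
      Φ (RingQuot.mkAlgHom (ZMod p) (SL2Dist.Rel p) (SL2Dist.genF p k)) =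
        SL2Dist.dividedPow f (SL2Dist.det_eq_zero_of_triple hp ht.symm) (p ^ k)) ∧
    ∀ k : ℕ, ∃ ψ : SL2Dist.RestrictedEnv p →ₐ[ZMod p] SL2Dist.DistSL2 (ZMod p),
      Function.Injective ψ ∧
      ψ (SL2Dist.restrictedι p e) =
        SL2Dist.dividedPow e (SL2Dist.det_eq_zero_of_triple hp ht) (p ^ k) ∧
      ψ (SL2Dist.restrictedι p f) =
        SL2Dist.dividedPow f (SL2Dist.det_eq_zero_of_triple hp ht.symm) (p ^ k) ∧
      ψ.range = Algebra.adjoin (ZMod p)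
        {SL2Dist.dividedPow e (SL2Dist.det_eq_zero_of_triple hp ht) (p ^ k),
          SL2Dist.dividedPow f (SL2Dist.det_eq_zero_of_triple hp ht.symm) (p ^ k)} :=
  ⟨SL2Dist.exists_presented_algEquiv hp ht, SL2Dist.exists_restrictedEnv_injective hp ht⟩
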